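/- A \emph{distorted monoidal category} is a monoidal category $(\mathcal C,\otimes,\mathbf I,\alpha,\lambda,\rho)$ with a natural transformation $\Lambda:\mathrm{Id}_{\mathcal C}\Rightarrow\mathrm{Id}_{\mathcal C}$ and a natural transformation $\sigma_{X,Y}:X\otimes Y\to Y\otimes X$ (neither assumed invertible) such that (D1) $(g\otimes f)\circ\sigma_{X,Y}=\sigma_{X',Y'}\circ(f\otimes g)$ for all $f:X\to X'$, $g:Y\to Y'$; (D2) $\sigma_{X,\mathbf I}=\lambda_X^{-1}\circ\rho_X$, $\sigma_{\mathbf I,X}=\rho_X^{-1}\circ\lambda_X$ and $\Lambda_{\mathbf I}=\mathrm{id}$; (D3) $\sigma_{X\otimes Y,Z}=\alpha_{Z,X,Y}\circ(\sigma_{X,Z}\otimes\mathrm{id}_Y)\circ\alpha^{-1}_{X,Z,Y}\circ(\mathrm{id}_X\otimes\sigma_{Y,Z})\circ\alpha_{X,Y,Z}$ and $\sigma_{X,Y\otimes Z}=\alpha^{-1}_{Y,Z,X}\circ(\mathrm{id}_Y\otimes\sigma_{X,Z})\circ\alpha_{Y,X,Z}\circ(\sigma_{X,Y}\otimes\mathrm{id}_Z)\circ\alpha^{-1}_{X,Y,Z}$;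 (D4) $\Lambda_{X\otimes Y}=\Lambda_X\otimes\Lambda_Y$. A \emph{$\sigma$-lax monoidal functor} $F:\mathcal C\to\mathcal D$ between distorted monoidal categories is a lax monoidal functor, with structure maps $\mu_{X,Y}:FX\otimes FY\to F(X\otimes Y)$ and $\varepsilon:\mathbf I\to F\mathbf I$, such that (S$\Lambda$) $F(\Lambda_Z)=\Lambda_{FZ}$ and (S$\sigma$) $F(\sigma_{X,Y})\circ\mu_{X,Y}=\mu_{Y,X}\circ\sigma_{FX,FY}$ for all $X,Y,Z$. A natural transformation between such functors is \emph{monoidal} if it commutes with $\mu$ and $\varepsilon$ in the usual sense. Distorted monoidal categories, $\sigma$-lax monoidal functors and monoidal natural transformations form a 2-category $\mathbf{DistMon}$. Let $\mathsf T_\sigma$ be the strict 2-monad on $\mathbf{Cat}$ (categories whose objects and whose hom-sets lie in fixed, arbitrary universes) that sends $\mathcal C$ to the free strict monoidal category on $\mathcal C$ with freely adjoined $\sigma$ and $\Lambda$ satisfying (D1)--(D4): its objects are the finite lists of objects of $\mathcal C$, with concatenation as tensor product and the empty list as unit, and its morphisms are the terms generated under composition and tensor product by identities, the morphisms of $\mathcal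 C$, and families $\sigma_{a,b}:ab\to ba$ and $\Lambda_a:a\to a$ ($a,b$ lists), modulo the smallest congruence that enforces the axioms of a strict monoidal category, functoriality of the inclusion of $\mathcal C$ as the lists of length one, naturality of $\sigma$ and $\Lambda$, and (D1)--(D4) with identities for $\alpha,\lambda,\rho$. The unit $\eta$ of $\mathsf T_\sigma$ is the inclusion of $\mathcal C$ as lists of length one, and the multiplication $m$ evaluates lists of lists. A \emph{$\mathsf T_\sigma$-pseudoalgebra} on a category $\mathcal C$ is a functor $a:\mathsf T_\sigma\mathcal C\to\mathcal C$ with natural isomorphisms $\iota:\mathrm{Id}\cong a\circ\eta$ and $\kappa:a\circ\mathsf T_\sigma a\cong a\circ m$ satisfying the two unit axioms and the associativity axiom. A \emph{lax $\mathsf T_\sigma$-morphism} $(\mathcal C,a)\to(\mathcal D,b)$ is a functor $F$ with a natural transformation $\bar F:b\circ\mathsf T_\sigma F\Rightarrow F\circ a$ compatible with $\iota$ and $\kappa$, and a \emph{$\mathsf T_\sigma$-transformation} is a natural transformation $\theta:F\Rightarrow G$ with $\theta a\cdot\bar F=\bar G\cdot b\,\mathsf T_\sigma\theta$. These form a 2-category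 $\mathbf{PsAlg}(\mathsf T_\sigma)$. \textbf{Proposition.} There is a 2-functor $\Phi:\mathbf{DistMon}\to\mathbf{PsAlg}(\mathsf T_\sigma)$ that leaves underlying categories, functors and natural transformations unchanged, such that: \begin{enumerate} \item $\Phi$ is a biequivalence: every $\mathsf T_\sigma$-pseudoalgebra is equivalent in $\mathbf{PsAlg}(\mathsf T_\sigma)$ to one of the form $\Phi(\mathcal C)$, and $\Phi$ is an equivalence of categories on each hom-category; \item for all distorted monoidal categories $\mathcal C,\mathcal D$ and every functor $F:\mathcal C\to\mathcal D$, $\Phi$ restricts to a bijection from the $\sigma$-lax monoidal structures on $F$ to the lax $\mathsf T_\sigma$-morphism structures $\Phi(\mathcal C)\to\Phi(\mathcal D)$ on $F$; \item a natural transformation between $\sigma$-lax monoidal functors $F,G$ is monoidal if and only if it is a $\mathsf T_\sigma$-transformation $\Phi(F)\Rightarrow\Phi(G)$; \item $\Phi$ interprets the operation symbols by the given structure: for each distorted monoidal category $\mathcal C$, writing $a$, $\iota$, $\kappa$ for the pseudoalgebra $\Phi(\mathcal C)$, there are isomorphisms $t_{X,Y}:a[X,Y]\cong X\otimes Y$,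 natural in $X,Y$, and $t_0:a[\,]\cong\mathbf I$ which together with $\iota$ and $\kappa$ carry the images under $a$ of $\sigma_{[X],[Y]}$ and $\Lambda_{[X]}$ to $\sigma_{X,Y}$ and $\Lambda_X$ and the comparison isomorphisms determined by $\kappa$ to $\alpha,\lambda,\rho$. These isomorphisms can be chosen for all $\mathcal C$ so that, for every $\sigma$-lax monoidal functor $F:\mathcal C\to\mathcal D$, they identify the components at $[X,Y]$ and $[\,]$ of the cell of the lax morphism $\Phi(F)$ with $\mu_{X,Y}$ and $\varepsilon$. \end{enumerate} -/

import Mathlib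

open CategoryTheory

universe w v u v' u' v'' u''

namespace Distorted

section Free

variable {C : Type u} [Category.{v} C]

/-- Terms for the morphisms of the free strict monoidal category on `C` with a distortion `σ` and a
unit distortion `Λ`. Its objects are finite lists of objects of `C`; the tensor product of objects
is concatenation and the unit object is the empty list. -/
inductive Term : List C → List C → Type (max u v)
  | id (a : List C) : Term a a
  | comp {a b c : List C} (f : Term a b) (g : Term b c) : Term a c
  | tensor {a b c d : List C} (f : Term a b) (g : Term c d) : Term (a ++ c) (b ++ d)
  | of {X Y : C} (f : X ⟶ Y) : Term [X] [Y]
  | sigma (a b : List C) : Term (a ++ b) (b ++ a)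
  | lam (a : List C) : Term a a

namespace Term

/-- The identity term between equal lists. -/
def cast {a b : List C} (h : a = b) : Term a b := h ▸ Term.id a

/-- The congruence on terms generated by the axioms of a strict monoidal category, functoriality
of the inclusion of `C`, binaturality of `σ`, the unit normalizations, the two hexagons, and
naturality and monoidality of `Λ` (all associators and unitors being identities). -/
inductive Rel : ∀ {a b : List C}, Term a b → Term a b → Prop
  | refl {a b : List C} (f : Term a b) : Rel f f
  | symm {a b : List C} {f g : Term a b} : Rel f g → Rel g f
  | trans {a b : List C} {f g h : Term a b} : Rel f g → Rel g h → Rel f h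
  | comp_congr {a b c : List C} {f f' : Term a b} {g g' : Term b c} :
      Rel f f' → Rel g g' → Rel (f.comp g) (f'.comp g')
  | tensor_congr {a b c d : List C} {f f' : Term a b} {g g' : Term c d} :
      Rel f f' → Rel g g' → Rel (f.tensor g) (f'.tensor g')
  | id_comp {a b : List C} (f : Term a b) : Rel ((Term.id a).comp f) f
  | comp_id {a b : List C} (f : Term a b) : Rel (f.comp (Term.id b)) f
  | assoc {a b c d : List C} (f : Term a b) (g : Term b c) (h : Term c d) :
      Rel ((f.comp g).comp h) (f.comp (g.comp h))
  | of_id (X : C) : Rel (Term.of (𝟙 X)) (Term.id [X])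
  | of_comp {X Y Z : C} (f : X ⟶ Y) (g : Y ⟶ Z) :
      Rel (Term.of (f ≫ g)) ((Term.of f).comp (Term.of g))
  | tensor_id (a b : List C) : Rel ((Term.id a).tensor (Term.id b)) (Term.id (a ++ b))
  | tensor_comp {a b c a' b' c' : List C}
      (f : Term a b) (g : Term b c) (f' : Term a' b') (g' : Term b' c') :
      Rel ((f.comp g).tensor (f'.comp g')) ((f.tensor f').comp (g.tensor g'))
  | tensor_assoc {a b c a' b' c' : List C} (f : Term a a') (g : Term b b') (h : Term c c') :
      Rel (((f.tensor g).tensor h).comp (cast (List.append_assoc a' b' c')))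
        ((cast (List.append_assoc a b c)).comp (f.tensor (g.tensor h)))
  | unit_tensor {a b : List C} (f : Term a b) :
      Rel (((Term.id []).tensor f).comp (cast (List.nil_append b)))
        ((cast (List.nil_append a)).comp f)
  | tensor_unit {a b : List C} (f : Term a b) :
      Rel ((f.tensor (Term.id [])).comp (cast (List.append_nil b)))
        ((cast (List.append_nil a)).comp f)
  | sigma_naturality {a b a' b' : List C} (f : Term a a') (g : Term b b') :
      Rel ((f.tensor g).comp (sigma a' b')) ((sigma a b).comp (g.tensor f))
  | sigma_unit (a : List C) :
      Rel (sigma a [])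
        ((cast (List.append_nil a)).comp (cast (List.nil_append a).symm))
  | unit_sigma (a : List C) :
      Rel (sigma [] a)
        ((cast (List.nil_append a)).comp (cast (List.append_nil a).symm))
  | lam_unit : Rel (lam []) (Term.id [])
  | hexagon_left (a b c : List C) :
      Rel (sigma (a ++ b) c)
        ((cast (List.append_assoc a b c)).comp
          (((Term.id a).tensor (sigma b c)).comp
            ((cast (List.append_assoc a c b).symm).comp
              (((sigma a c).tensor (Term.id b)).comp (cast (List.append_assoc c a b))))))
  | hexagon_right (a b c : List C) :
      Rel (sigma a (b ++ c))
        ((cast (List.append_assoc a b c).symm).comp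
          (((sigma a b).tensor (Term.id c)).comp
            ((cast (List.append_assoc b a c)).comp
              (((Term.id b).tensor (sigma a c)).comp (cast (List.append_assoc b c a).symm)))))
  | lam_naturality {a b : List C} (f : Term a b) : Rel (f.comp (lam b)) ((lam a).comp f)
  | lam_tensor (a b : List C) : Rel (lam (a ++ b)) ((lam a).tensor (lam b))

instance setoid (a b : List C) : Setoid (Term a b) :=
  ⟨Rel, ⟨Rel.refl, Rel.symm, Rel.trans⟩⟩

end Term

variable (C) in
/-- The free strict distorted monoidal category on `C`. -/
abbrev Free : Type u := List C

namespace Free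

instance : Category.{max u v} (Free C) where
  Hom a b := Quotient (Term.setoid (C := C) a b)
  id a := ⟦Term.id a⟧
  comp := Quotient.map₂ Term.comp (fun _ _ hf _ _ hg ↦ Term.Rel.comp_congr hf hg)
  id_comp := by rintro a b ⟨f⟩; exact Quotient.sound (Term.Rel.id_comp f)
  comp_id := by rintro a b ⟨f⟩; exact Quotient.sound (Term.Rel.comp_id f)
  assoc := by rintro a b c d ⟨f⟩ ⟨g⟩ ⟨h⟩; exact Quotient.sound (Term.Rel.assoc f g h)

end Free
end Free
end Distorted

namespace Distorted
namespace Free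
variable {C : Type u} [Category.{v} C] {D : Type u'} [Category.{v'} D]
  {E : Type u''} [Category.{v''} E]

def tens {a b c d : List C} (f : (a : List C) ⟶ (b : List C))
    (g : (c : List C) ⟶ (d : List C)) :
    (a ++ c : List C) ⟶ (b ++ d : List C) :=
  Quotient.map₂ Term.tensor (fun _ _ hf _ _ hg ↦ Term.Rel.tensor_congr hf hg) f g

def sigma (a b : List C) : (a ++ b : List C) ⟶ (b ++ a : List C) :=
  ⟦Term.sigma a b⟧

def lam (a : List C) : (a : List C) ⟶ (a : List C) :=
  ⟦Term.lam a⟧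

variable (C) in
def of : C ⥤ Free C where
  obj X := [X]
  map f := ⟦Term.of f⟧
  map_id X := Quotient.sound (Term.Rel.of_id X)
  map_comp f g := Quotient.sound (Term.Rel.of_comp f g)

theorem mk_cast {a b : List C} (h : a = b) :
    (⟦Term.cast h⟧ : (a : List C) ⟶ (b : List C)) = eqToHom h := by
  subst h; rfl

theorem tens_id (a b : List C) :
    tens (𝟙 (a : List C)) (𝟙 (b : List C)) = 𝟙 (a ++ b : List C) :=
  Quotient.sound (Term.Rel.tensor_id a b)

theorem tens_comp {a b c a' b' c' : List C}
    (f : (a : List C) ⟶ (b : List C))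
    (g : (b : List C) ⟶ (c : List C))
    (f' : (a' : List C) ⟶ (b' : List C))
    (g' : (b' : List C) ⟶ (c' : List C)) :
    tens (f ≫ g) (f' ≫ g') = tens f f' ≫ tens g g' := by
  induction f using Quotient.inductionOn
  induction g using Quotient.inductionOn
  induction f' using Quotient.inductionOn
  induction g' using Quotient.inductionOn
  exact Quotient.sound (Term.Rel.tensor_comp _ _ _ _)

theorem tens_assoc {a b c a' b' c' : List C}
    (f : (a : List C) ⟶ (a' : List C))
    (g : (b : List C) ⟶ (b' : List C))
    (h : (c : List C) ⟶ (c' : List C)) :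
    tens (tens f g) h ≫ eqToHom (List.append_assoc a' b' c') =
      eqToHom (List.append_assoc a b c) ≫ tens f (tens g h) := by
  induction f using Quotient.inductionOn
  induction g using Quotient.inductionOn
  induction h using Quotient.inductionOn
  rw [← mk_cast, ← mk_cast]
  exact Quotient.sound (Term.Rel.tensor_assoc _ _ _)

theorem nil_tens {a b : List C} (f : (a : List C) ⟶ (b : List C)) :
    tens (𝟙 ([] : List C)) f = f := by
  have : tens (𝟙 ([] : List C)) f ≫ eqToHom (List.nil_append b) =
      eqToHom (List.nil_append a) ≫ f := by
    induction f using Quotient.inductionOn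
    rw [← mk_cast, ← mk_cast]
    exact Quotient.sound (Term.Rel.unit_tensor _)
  simpa using this

theorem tens_nil {a b : List C} (f : (a : List C) ⟶ (b : List C)) :
    tens f (𝟙 ([] : List C)) ≫ eqToHom (List.append_nil b) =
      eqToHom (List.append_nil a) ≫ f := by
  induction f using Quotient.inductionOn
  rw [← mk_cast, ← mk_cast]
  exact Quotient.sound (Term.Rel.tensor_unit _)

theorem sigma_naturality {a b a' b' : List C}
    (f : (a : List C) ⟶ (a' : List C))
    (g : (b : List C) ⟶ (b' : List C)) :
    tens f g ≫ sigma a' b' = sigma a b ≫ tens g f := by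
  induction f using Quotient.inductionOn
  induction g using Quotient.inductionOn
  exact Quotient.sound (Term.Rel.sigma_naturality _ _)

theorem sigma_nil (a : List C) :
    sigma a [] = eqToHom (List.append_nil a : a ++ [] = [] ++ a) := by
  have : sigma a [] = eqToHom (List.append_nil a) ≫ eqToHom (List.nil_append a).symm := by
    rw [← mk_cast, ← mk_cast]
    exact Quotient.sound (Term.Rel.sigma_unit a)
  simpa using this

theorem nil_sigma (a : List C) :
    sigma [] a = eqToHom ((List.append_nil a).symm : [] ++ a = a ++ []) := by
  have : sigma [] a = eqToHom (List.nil_append a) ≫ eqToHom (List.append_nil a).symm := by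
    rw [← mk_cast, ← mk_cast]
    exact Quotient.sound (Term.Rel.unit_sigma a)
  simpa using this

theorem sigma_append_left (a b c : List C) :
    sigma (a ++ b) c =
      eqToHom (List.append_assoc a b c) ≫ tens (𝟙 (a : List C)) (sigma b c) ≫
        eqToHom (List.append_assoc a c b).symm ≫ tens (sigma a c) (𝟙 (b : List C)) ≫
          eqToHom (List.append_assoc c a b) := by
  rw [← mk_cast, ← mk_cast, ← mk_cast]
  exact Quotient.sound (Term.Rel.hexagon_left a b c)

theorem sigma_append_right (a b c : List C) :
    sigma a (b ++ c) =
      eqToHom (List.append_assoc a b c).symm ≫ tens (sigma a b) (𝟙 (c : List C)) ≫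
        eqToHom (List.append_assoc b a c) ≫ tens (𝟙 (b : List C)) (sigma a c) ≫
          eqToHom (List.append_assoc b c a).symm := by
  rw [← mk_cast, ← mk_cast, ← mk_cast]
  exact Quotient.sound (Term.Rel.hexagon_right a b c)

theorem lam_nil : lam ([] : List C) = 𝟙 _ := Quotient.sound Term.Rel.lam_unit

theorem lam_naturality {a b : List C} (f : (a : List C) ⟶ (b : List C)) :
    f ≫ lam b = lam a ≫ f := by
  induction f using Quotient.inductionOn
  exact Quotient.sound (Term.Rel.lam_naturality _)

theorem lam_append (a b : List C) : lam (a ++ b) = tens (lam a) (lam b) :=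
  Quotient.sound (Term.Rel.lam_tensor a b)

theorem tens_conj {a b c d a' b' c' d' : List C}
    (f : (a : List C) ⟶ (b : List C))
    (g : (c : List C) ⟶ (d : List C))
    (ha : a' = a) (hb : b = b') (hc : c' = c) (hd : d = d') :
    tens (eqToHom (ha : (a' : List C) = a) ≫ f ≫ eqToHom hb)
      (eqToHom (hc : (c' : List C) = c) ≫ g ≫ eqToHom hd) =
    eqToHom (congrArg₂ (· ++ ·) ha hc) ≫ tens f g ≫ eqToHom (congrArg₂ (· ++ ·) hb hd) := by
  subst ha hb hc hd; simp

end Free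
end Distorted

namespace Distorted
namespace Free
variable {C : Type u} [Category.{v} C] {D : Type u'} [Category.{v'} D]
  {E : Type u''} [Category.{v''} E]

theorem tens_conj_left {a b c d a' b' : List C} (f : (a : List C) ⟶ (b : List C))
    (g : (c : List C) ⟶ (d : List C)) (ha : a' = a) (hb : b = b') :
    tens (eqToHom ha ≫ f ≫ eqToHom hb) g =
    eqToHom (congrArg (· ++ c) ha) ≫ tens f g ≫ eqToHom (congrArg (· ++ d) hb) := by
  subst ha hb; simp

theorem tens_conj_right {a b c d c' d' : List C} (f : (a : List C) ⟶ (b : List C))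
    (g : (c : List C) ⟶ (d : List C)) (hc : c' = c) (hd : d = d') :
    tens f (eqToHom hc ≫ g ≫ eqToHom hd) =
    eqToHom (congrArg (a ++ ·) hc) ≫ tens f g ≫ eqToHom (congrArg (b ++ ·) hd) := by
  subst hc hd; simp

theorem sigma_congr {a b a' b' : List C} (ha : a = a') (hb : b = b') :
    sigma a b = eqToHom (congrArg₂ (· ++ ·) ha hb) ≫ sigma a' b' ≫
      eqToHom (congrArg₂ (· ++ ·) hb.symm ha.symm) := by
  subst ha hb; simp

theorem lam_congr {a a' : List C} (ha : a = a') :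
    lam a = eqToHom ha ≫ lam a' ≫ eqToHom ha.symm := by
  subst ha; simp

theorem tens_assoc' {a b c a' b' c' : List C}
    (f : (a : List C) ⟶ (a' : List C))
    (g : (b : List C) ⟶ (b' : List C))
    (h : (c : List C) ⟶ (c' : List C)) :
    tens (tens f g) h = eqToHom (List.append_assoc a b c) ≫ tens f (tens g h) ≫
       eqToHom (List.append_assoc a' b' c').symm := by
  rw [← reassoc_of% tens_assoc f g h]; simp

theorem tens_nil' {a b : List C} (f : (a : List C) ⟶ (b : List C)) :
    tens f (𝟙 ([] : List C)) =
      eqToHom (List.append_nil a) ≫ f ≫ eqToHom (List.append_nil b).symm := by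
  rw [← reassoc_of% tens_nil f]; simp

theorem tens_eqToHom {a b c d : List C} (h : a = b) (k : c = d) :
    tens (eqToHom h) (eqToHom k) = eqToHom (congrArg₂ (· ++ ·) h k) := by
  subst h k; simp [tens_id]

theorem tens_id_eqToHom (a : List C) {c d : List C} (k : c = d) :
    tens (𝟙 (a : List C)) (eqToHom k) = eqToHom (congrArg (a ++ ·) k) := by
  subst k; simp [tens_id]

theorem conj_rfl {a b : C} (f : a ⟶ b) (h : a = a) (k : b = b) :
    eqToHom h ≫ f ≫ eqToHom k = f := by simp

theorem conj_conj {a b x x' y y' : C} (f : a ⟶ b) (p : x = a) (q : b = x')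
    (p' : x = y) (p'' : y = a) (q'' : b = y') (q' : y' = x') :
    eqToHom p ≫ f ≫ eqToHom q =
      eqToHom p' ≫ (eqToHom p'' ≫ f ≫ eqToHom q'') ≫ eqToHom q' := by
  subst p q p'' q''; simp

theorem conj_tens_nil {a b a' b' : List C} (f : a ⟶ b) (h : a' = a ++ []) (k : b ++ [] = b')
    (k' : b' = b) (h' : a' = a) :
    eqToHom h ≫ tens f (𝟙 ([] : List C)) ≫ eqToHom k ≫ eqToHom k' = eqToHom h' ≫ f := by
  rw [tens_nil']; subst h'; simp

theorem conj_sigma_nil {a' b' : List C} (a : List C) (h : a' = a ++ []) (k : [] ++ a = b')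
    (h' : a' = b') : eqToHom h ≫ sigma a [] ≫ eqToHom k = eqToHom h' := by
  rw [sigma_nil]; subst h'; simp

theorem conj_nil_sigma {a' b' : List C} (a : List C) (h : a' = [] ++ a) (k : a ++ [] = b')
    (h' : a' = b') : eqToHom h ≫ sigma [] a ≫ eqToHom k = eqToHom h' := by
  rw [nil_sigma]; subst h'; simp

def liftObj (F : C → List D) (a : List C) : List D := a.flatMap F

theorem liftObj_append (F : C → List D) (a b : List C) :
    liftObj F (a ++ b) = liftObj F a ++ liftObj F b := List.flatMap_append

theorem liftObj_singleton (F : C → List D) (X : C) : liftObj F [X] = F X := by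
  simp [liftObj]

def liftTerm (F : C ⥤ Free D) : {a b : List C} → Term a b →
    (liftObj F.obj a ⟶ liftObj F.obj b)
  | _, _, .id a => 𝟙 (liftObj F.obj a)
  | _, _, .comp f g => liftTerm F f ≫ liftTerm F g
  | _, _, .tensor (a := a) (b := b) (c := c) (d := d) f g =>
      eqToHom (liftObj_append F.obj a c) ≫ tens (liftTerm F f) (liftTerm F g) ≫
        eqToHom (liftObj_append F.obj b d).symm
  | _, _, .of (X := X) (Y := Y) f =>
      eqToHom (liftObj_singleton F.obj X) ≫ F.map f ≫ eqToHom (liftObj_singleton F.obj Y).symm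
  | _, _, .sigma a b =>
      eqToHom (liftObj_append F.obj a b) ≫ sigma _ _ ≫ eqToHom (liftObj_append F.obj b a).symm
  | _, _, .lam a => lam (liftObj F.obj a)

theorem liftTerm_cast (F : C ⥤ Free D) {a b : List C} (h : a = b) :
    liftTerm F (Term.cast h) = eqToHom (congrArg (liftObj F.obj) h) := by
  subst h; rfl

theorem liftTerm_rel (F : C ⥤ Free D) {a b : List C} {f g : Term a b} (h : Term.Rel f g) :
    liftTerm F f = liftTerm F g := by
  induction h with
  | refl => rfl
  | symm _ ih => exact ih.symm
  | trans _ _ h₁ h₂ => exact h₁.trans h₂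
  | comp_congr _ _ h₁ h₂ => simp only [liftTerm, h₁, h₂]
  | tensor_congr _ _ h₁ h₂ => simp only [liftTerm, h₁, h₂]
  | id_comp => simp [liftTerm]
  | comp_id => simp [liftTerm]
  | assoc => simp [liftTerm]
  | of_id => simp [liftTerm]
  | of_comp => simp [liftTerm]
  | tensor_id => simp [liftTerm, tens_id]
  | tensor_comp => simp [liftTerm, tens_comp]
  | tensor_assoc f g h =>
    simp [liftTerm, liftTerm_cast, tens_conj_left, tens_conj_right, tens_assoc']
  | unit_tensor f =>
    simp only [liftTerm, liftTerm_cast, eqToHom_refl, Category.comp_id, Category.id_comp]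
    exact (conj_rfl _ _ _).trans (nil_tens (liftTerm F f))
  | tensor_unit f =>
    simp only [liftTerm, liftTerm_cast, Category.assoc]
    exact conj_tens_nil (liftTerm F f) _ _ _ _
  | sigma_naturality f g => simp [liftTerm, reassoc_of% sigma_naturality]
  | sigma_unit a =>
    simp only [liftTerm, liftTerm_cast, eqToHom_trans]
    exact conj_sigma_nil (liftObj F.obj a) _ _ _
  | unit_sigma a =>
    simp only [liftTerm, liftTerm_cast, eqToHom_trans]
    exact conj_nil_sigma (liftObj F.obj a) _ _ _
  | lam_unit => exact lam_nil
  | hexagon_left a b c =>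
    simp [liftTerm, liftTerm_cast, sigma_congr (liftObj_append F.obj a b) rfl, sigma_append_left, 
     tens_conj_left, tens_conj_right]
  | hexagon_right a b c => 
    simp [liftTerm, liftTerm_cast, sigma_congr rfl (liftObj_append F.obj b c), sigma_append_right, 
     tens_conj_left, tens_conj_right]
  | lam_naturality f => simp [liftTerm, lam_naturality]
  | lam_tensor a b => 
    simp [liftTerm, lam_congr (liftObj_append F.obj a b), lam_append]


def liftMap (F : C ⥤ Free D) {a b : List C} (f : a ⟶ b) : liftObj F.obj a ⟶ liftObj F.obj b :=
  Quotient.liftOn f (liftTerm F) (fun _ _ h => liftTerm_rel F h)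

theorem liftMap_id (F : C ⥤ Free D) (a : List C) : liftMap F (𝟙 a) = 𝟙 _ := rfl

theorem liftMap_comp (F : C ⥤ Free D) {a b c : List C} (f : a ⟶ b) (g : b ⟶ c) :
    liftMap F (f ≫ g) = liftMap F f ≫ liftMap F g := by
  induction f using Quotient.inductionOn
  induction g using Quotient.inductionOn
  rfl

theorem liftMap_eqToHom (F : C ⥤ Free D) {a b : List C} (h : a = b) :
    liftMap F (eqToHom h) = eqToHom (congrArg (liftObj F.obj) h) := by
  subst h; rfl

theorem liftMap_tens (F : C ⥤ Free D) {a b c d : List C} (f : a ⟶ b) (g : c ⟶ d) :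
    liftMap F (tens f g) = eqToHom (liftObj_append F.obj a c) ≫
      tens (liftMap F f) (liftMap F g) ≫ eqToHom (liftObj_append F.obj b d).symm := by
  induction f using Quotient.inductionOn
  induction g using Quotient.inductionOn
  rfl

theorem liftMap_sigma (F : C ⥤ Free D) (a b : List C) :
    liftMap F (sigma a b) = eqToHom (liftObj_append F.obj a b) ≫
      sigma (liftObj F.obj a) (liftObj F.obj b) ≫ eqToHom (liftObj_append F.obj b a).symm := rfl

theorem liftMap_lam (F : C ⥤ Free D) (a : List C) :
    liftMap F (lam a) = lam (liftObj F.obj a) := rfl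

def ofHom {X Y : C} (f : X ⟶ Y) : [X] ⟶ [Y] := (of C).map f

theorem liftMap_ofHom (F : C ⥤ Free D) {X Y : C} (f : X ⟶ Y) :
    liftMap F (ofHom f) = eqToHom (liftObj_singleton F.obj X) ≫ F.map f ≫
      eqToHom (liftObj_singleton F.obj Y).symm := rfl

theorem hom_induction {motive : ∀ {a b : List C}, (a ⟶ b) → Prop}
    (id : ∀ a : List C, motive (𝟙 a))
    (comp : ∀ {a b c : List C} (f : a ⟶ b) (g : b ⟶ c), motive f → motive g → motive (f ≫ g))
    (tens : ∀ {a b c d : List C} (f : a ⟶ b) (g : c ⟶ d), motive f → motive g →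
      motive (tens f g))
    (ofHom : ∀ {X Y : C} (f : X ⟶ Y), motive (ofHom f))
    (sigma : ∀ a b : List C, motive (sigma a b))
    (lam : ∀ a : List C, motive (lam a))
    {a b : List C} (f : a ⟶ b) : motive f := by
  induction f using Quotient.inductionOn with | h f => ?_
  induction f with
  | id a => exact id a
  | comp f g hf hg => exact comp _ _ hf hg
  | tensor f g hf hg => exact tens _ _ hf hg
  | of f => exact ofHom f
  | sigma a b => exact sigma a b
  | lam a => exact lam a

def lift (F : C ⥤ Free D) : Free C ⥤ Free D where
  obj a := liftObj F.obj a
  map f := liftMap F f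
  map_id a := rfl
  map_comp f g := liftMap_comp F f g

theorem of_comp_lift (F : C ⥤ Free D) : of C ⋙ lift F = F :=
  CategoryTheory.Functor.ext (fun X => liftObj_singleton F.obj X) (fun _ _ f => liftMap_ofHom F f)

theorem liftObj_of (a : List C) : liftObj (of C).obj a = a := by
  simp [liftObj, of]

theorem liftMap_of {a b : List C} (f : a ⟶ b) :
    liftMap (of C) f = eqToHom (liftObj_of a) ≫ f ≫ eqToHom (liftObj_of b).symm := by
  induction f using hom_induction with
  | id a => rw [liftMap_id]; simp
  | comp f g hf hg => rw [liftMap_comp, hf, hg]; simp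
  | tens f g hf hg => rw [liftMap_tens, hf, hg, tens_conj]; simp
  | ofHom f => exact liftMap_ofHom (of C) f
  | sigma a b => rw [liftMap_sigma, sigma_congr (liftObj_of a) (liftObj_of b)]; simp
  | lam a => rw [liftMap_lam, lam_congr (liftObj_of a)]

theorem lift_of_eq_id : lift (of C) = 𝟭 (Free C) :=
  CategoryTheory.Functor.ext liftObj_of (fun _ _ f => liftMap_of f)

theorem liftObj_liftObj (F : C ⥤ Free D) (G : D ⥤ Free E) (a : List C) :
    liftObj G.obj (liftObj F.obj a) = liftObj (F ⋙ lift G).obj a := by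
  change _ = liftObj (fun X => liftObj G.obj (F.obj X)) a
  simp [liftObj, List.flatMap_assoc]

theorem liftMap_liftMap (F : C ⥤ Free D) (G : D ⥤ Free E) {a b : List C} (f : a ⟶ b) :
    liftMap G (liftMap F f) = eqToHom (liftObj_liftObj F G a) ≫ liftMap (F ⋙ lift G) f ≫
      eqToHom (liftObj_liftObj F G b).symm := by
  induction f using hom_induction with
  | id a => rw [liftMap_id, liftMap_id, liftMap_id]; simp
  | comp f g hf hg => rw [liftMap_comp, liftMap_comp, liftMap_comp, hf, hg]; simp
  | tens f g hf hg =>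
    rw [liftMap_tens, liftMap_tens, liftMap_comp, liftMap_comp, liftMap_tens, hf, hg, tens_conj,
      liftMap_eqToHom, liftMap_eqToHom]
    simp
  | ofHom f =>
    rw [liftMap_ofHom, liftMap_ofHom, liftMap_comp, liftMap_comp, liftMap_eqToHom,
      liftMap_eqToHom]
    simp only [Category.assoc, eqToHom_trans, eqToHom_trans_assoc]
    rfl
  | sigma a b =>
    rw [liftMap_sigma, liftMap_sigma, liftMap_comp, liftMap_comp, liftMap_sigma, liftMap_eqToHom,
      liftMap_eqToHom, sigma_congr (liftObj_liftObj F G a) (liftObj_liftObj F G b)]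
    simp
  | lam a => rw [liftMap_lam, liftMap_lam, liftMap_lam, lam_congr (liftObj_liftObj F G a)]

theorem lift_comp_lift (F : C ⥤ Free D) (G : D ⥤ Free E) :
    lift F ⋙ lift G = lift (F ⋙ lift G) :=
  CategoryTheory.Functor.ext (liftObj_liftObj F G) (fun _ _ f => liftMap_liftMap F G f)

def lift₂App {F G : C ⥤ Free D} (θ : F ⟶ G) : (a : List C) → (liftObj F.obj a ⟶ liftObj G.obj a)
  | [] => 𝟙 ([] : List D)
  | X :: a => tens (θ.app X) (lift₂App θ a)

theorem lift₂App_append {F G : C ⥤ Free D} (θ : F ⟶ G) (a b : List C) :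
    lift₂App θ (a ++ b) = eqToHom (liftObj_append F.obj a b) ≫
      tens (lift₂App θ a) (lift₂App θ b) ≫ eqToHom (liftObj_append G.obj a b).symm := by
  induction a with
  | nil => exact ((conj_rfl _ _ _).trans (nil_tens (lift₂App θ b))).symm
  | cons X a ih =>
    have h : tens (θ.app X) (lift₂App θ (a ++ b)) =
        eqToHom (congrArg (F.obj X ++ ·) (liftObj_append F.obj a b)) ≫
        eqToHom (List.append_assoc _ _ _).symm ≫
        tens (tens (θ.app X) (lift₂App θ a)) (lift₂App θ b) ≫
        eqToHom (List.append_assoc _ _ _) ≫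
        eqToHom (congrArg (G.obj X ++ ·) (liftObj_append G.obj a b)).symm := by
      rw [ih, tens_assoc', tens_conj_right]
      simp
    simp only [eqToHom_trans, eqToHom_trans_assoc] at h
    exact h

theorem lift₂App_singleton {F G : C ⥤ Free D} (θ : F ⟶ G) (X : C) :
    lift₂App θ [X] = eqToHom (liftObj_singleton F.obj X) ≫ θ.app X ≫
      eqToHom (liftObj_singleton G.obj X).symm := tens_nil' (θ.app X)

theorem lift₂_naturality {F G : C ⥤ Free D} (θ : F ⟶ G) {a b : List C} (f : a ⟶ b) :
    liftMap F f ≫ lift₂App θ b = lift₂App θ a ≫ liftMap G f := by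
  induction f using hom_induction with
  | id a => rw [liftMap_id, liftMap_id]; simp
  | comp f g hf hg => rw [liftMap_comp, liftMap_comp, Category.assoc, hg, reassoc_of% hf]
  | tens f g hf hg =>
    rw [liftMap_tens, liftMap_tens, lift₂App_append, lift₂App_append]
    simp only [Category.assoc, eqToHom_trans_assoc, eqToHom_refl, Category.id_comp]
    rw [← reassoc_of% tens_comp, ← reassoc_of% tens_comp, hf, hg]
  | ofHom f =>
    rw [liftMap_ofHom, liftMap_ofHom, lift₂App_singleton, lift₂App_singleton]
    simp
  | sigma a b =>
    rw [liftMap_sigma, liftMap_sigma, lift₂App_append, lift₂App_append]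
    simp only [Category.assoc, eqToHom_trans_assoc, eqToHom_refl, Category.id_comp]
    rw [reassoc_of% sigma_naturality (lift₂App θ a) (lift₂App θ b)]
  | lam a => exact (lam_naturality _).symm

def lift₂ {F G : C ⥤ Free D} (θ : F ⟶ G) : lift F ⟶ lift G where
  app a := lift₂App θ a
  naturality _ _ f := lift₂_naturality θ f

theorem lift₂_id (F : C ⥤ Free D) : lift₂ (𝟙 F) = 𝟙 (lift F) := by
  ext a
  change lift₂App (𝟙 F) a = 𝟙 (liftObj F.obj a)
  induction a with
  | nil => rfl
  | cons X a ih =>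
    rw [lift₂App, ih]
    exact tens_id (F.obj X) (liftObj F.obj a)

theorem lift₂_comp {F G H : C ⥤ Free D} (θ : F ⟶ G) (τ : G ⟶ H) :
    lift₂ (θ ≫ τ) = lift₂ θ ≫ lift₂ τ := by
  ext a
  change lift₂App (θ ≫ τ) a = lift₂App θ a ≫ lift₂App τ a
  induction a with
  | nil => exact (Category.comp_id _).symm
  | cons X a ih =>
    rw [lift₂App, ih]
    exact tens_comp _ _ _ _

theorem lift₂App_whiskerRight {F F' : C ⥤ Free D} (θ : F ⟶ F') (G : D ⥤ Free E) (a : List C) :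
    liftMap G (lift₂App θ a) = eqToHom (liftObj_liftObj F G a) ≫
      lift₂App (Functor.whiskerRight θ (lift G)) a ≫ eqToHom (liftObj_liftObj F' G a).symm := by
  induction a with
  | nil => exact (conj_rfl _ _ _).symm
  | cons X a ih =>
    have h : liftMap G (tens (θ.app X) (lift₂App θ a)) = _ := liftMap_tens G _ _
    rw [ih, tens_conj_right] at h
    simp only [Category.assoc, eqToHom_trans, eqToHom_trans_assoc] at h
    exact h

theorem lift₂App_whiskerLeft (F : C ⥤ Free D) {G G' : D ⥤ Free E} (θ : G ⟶ G') (a : List C) :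
    lift₂App θ (liftObj F.obj a) = eqToHom (liftObj_liftObj F G a) ≫
      lift₂App (Functor.whiskerLeft F (lift₂ θ)) a ≫ eqToHom (liftObj_liftObj F G' a).symm := by
  induction a with
  | nil => exact (conj_rfl _ _ _).symm
  | cons X a ih =>
    have h : lift₂App θ (F.obj X ++ liftObj F.obj a) = _ := lift₂App_append θ _ _
    rw [ih, tens_conj_right] at h
    simp only [Category.assoc, eqToHom_trans, eqToHom_trans_assoc] at h
    exact h

end Free
end Distorted

namespace Distorted
namespace Free
variable {C : Type u} [Category.{v} C]

inductive Move : Type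
  | swap : Move
  | twist : Move
  | skip (m : Move) : Move

def Move.run : Move → (a : List C) → Σ b : List C, (a ⟶ b)
  | .swap, X :: Y :: a => ⟨Y :: X :: a, tens (sigma [X] [Y]) (𝟙 a)⟩
  | .swap, [X] => ⟨[X], 𝟙 [X]⟩
  | .swap, [] => ⟨[], 𝟙 []⟩
  | .twist, X :: a => ⟨X :: a, tens (lam [X]) (𝟙 a)⟩
  | .twist, [] => ⟨[], 𝟙 []⟩
  | .skip m, X :: a => ⟨X :: (m.run a).1, tens (𝟙 [X]) (m.run a).2⟩
  | .skip _, [] => ⟨[], 𝟙 []⟩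

def runWord : List Move → (a : List C) → Σ b : List C, (a ⟶ b)
  | [], a => ⟨a, 𝟙 a⟩
  | m :: w, a => ⟨(runWord w (m.run a).1).1, (m.run a).2 ≫ (runWord w (m.run a).1).2⟩

def Comps : List C → List C → Type v
  | [], [] => PUnit
  | X :: a, Y :: b => (X ⟶ Y) × Comps a b
  | [], _ :: _ => PEmpty
  | _ :: _, [] => PEmpty

def Comps.hom : {a b : List C} → Comps a b → (a ⟶ b)
  | [], [], _ => 𝟙 []
  | _ :: _, _ :: _, φ => tens (ofHom φ.1) (Comps.hom φ.2)
  | [], _ :: _, φ => PEmpty.elim φ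
  | _ :: _, [], φ => PEmpty.elim φ

def Comps.cons {X Y : C} {a b : List C} (f : X ⟶ Y) (φ : Comps a b) : Comps (X :: a) (Y :: b) :=
  (f, φ)

theorem Comps.hom_cons {X Y : C} {a b : List C} (f : X ⟶ Y) (φ : Comps a b) :
    (Comps.cons f φ).hom = tens (ofHom f) φ.hom := rfl

def IsNormal {a b : List C} (f : a ⟶ b) : Prop :=
  ∃ (w : List Move) (φ : Comps (runWord w a).1 b), f = (runWord w a).2 ≫ φ.hom

theorem ofHom_id (X : C) : ofHom (𝟙 X) = 𝟙 [X] := (of C).map_id X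

theorem exists_comps_id (a : List C) : ∃ φ : Comps a a, φ.hom = 𝟙 a := by
  induction a with
  | nil => exact ⟨PUnit.unit, rfl⟩
  | cons X a ih =>
    obtain ⟨φ, hφ⟩ := ih
    refine ⟨.cons (𝟙 X) φ, ?_⟩
    rw [Comps.hom_cons, hφ, ofHom_id]
    exact tens_id [X] a

theorem exists_comps_comp {a b c : List C} (φ : Comps a b) (ψ : Comps b c) :
    ∃ χ : Comps a c, χ.hom = φ.hom ≫ ψ.hom := by
  induction a generalizing b c with
  | nil =>
    match b, c, φ, ψ with
    | [], [], _, _ => exact ⟨PUnit.unit, (Category.comp_id _).symm⟩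
  | cons X a ih =>
    match b, c, φ, ψ with
    | Y :: b, Z :: c, φ, ψ =>
      obtain ⟨χ, hχ⟩ := ih φ.2 ψ.2
      refine ⟨.cons (φ.1 ≫ ψ.1) χ, ?_⟩
      rw [Comps.hom_cons, hχ]
      have : ofHom (φ.1 ≫ ψ.1) = ofHom φ.1 ≫ ofHom ψ.1 := (of C).map_comp _ _
      rw [this]
      exact tens_comp _ _ _ _

theorem exists_comps_tens {a b c d : List C} (φ : Comps a b) (ψ : Comps c d) :
    ∃ χ : Comps (a ++ c) (b ++ d), χ.hom = tens φ.hom ψ.hom := by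
  induction a generalizing b with
  | nil =>
    match b, φ with
    | [], _ => exact ⟨ψ, (nil_tens _).symm⟩
  | cons X a ih =>
    match b, φ with
    | Y :: b, φ =>
      obtain ⟨χ, hχ⟩ := ih φ.2
      refine ⟨.cons φ.1 χ, ?_⟩
      rw [Comps.hom_cons, hχ]
      exact ((tens_assoc' (ofHom φ.1) φ.2.hom ψ.hom).trans (conj_rfl _ _ _)).symm

theorem exists_comps_move {a b : List C} (φ : Comps a b) (m : Move) :
    ∃ ψ : Comps (m.run a).1 (m.run b).1, φ.hom ≫ (m.run b).2 = (m.run a).2 ≫ ψ.hom := by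
  induction m generalizing a b with
  | swap =>
    match a, b, φ with
    | [], [], φ => exact ⟨show Comps [] [] from φ, (Category.comp_id _).trans (Category.id_comp _).symm⟩
    | [X], [Y], φ => exact ⟨show Comps [X] [Y] from φ, (Category.comp_id _).trans (Category.id_comp _).symm⟩
    | X :: X' :: a, Y :: Y' :: b, φ =>
      refine ⟨show Comps (X' :: X :: a) (Y' :: Y :: b) from .cons φ.2.1 (.cons φ.1 φ.2.2), ?_⟩
      have h₁ : φ.hom = tens (tens (ofHom φ.1) (ofHom φ.2.1)) φ.2.2.hom :=
        ((tens_assoc' (ofHom φ.1) (ofHom φ.2.1) φ.2.2.hom).trans (conj_rfl _ _ _)).symm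
      have h₂ : tens (ofHom φ.2.1) (tens (ofHom φ.1) φ.2.2.hom) =
          tens (tens (ofHom φ.2.1) (ofHom φ.1)) φ.2.2.hom :=
        ((tens_assoc' (ofHom φ.2.1) (ofHom φ.1) φ.2.2.hom).trans (conj_rfl _ _ _)).symm
      rw [h₁]
      change tens (tens (ofHom φ.1) (ofHom φ.2.1)) φ.2.2.hom ≫ tens (sigma [Y] [Y']) (𝟙 b) =
        tens (sigma [X] [X']) (𝟙 a) ≫
          (Free.tens (a := [X']) (ofHom φ.2.1) (tens (a := [X]) (ofHom φ.1) φ.2.2.hom))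
      refine Eq.trans ?_ (congrArg (fun z => tens (sigma [X] [X']) (𝟙 a) ≫ z) h₂.symm)
      refine (tens_comp _ _ _ _).symm.trans (Eq.trans ?_ (tens_comp _ _ _ _))
      rw [sigma_naturality, Category.comp_id, Category.id_comp]
    | [X], Y :: Y' :: b, φ => exact PEmpty.elim φ.2
    | X :: X' :: a, [Y], φ => exact PEmpty.elim φ.2
  | twist =>
    match a, b, φ with
    | [], [], φ => exact ⟨show Comps [] [] from φ, (Category.comp_id _).trans (Category.id_comp _).symm⟩
    | X :: a, Y :: b, φ =>
      refine ⟨show Comps (X :: a) (Y :: b) from φ, ?_⟩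
      change tens (ofHom φ.1) (Comps.hom φ.2) ≫ tens (lam [Y]) (𝟙 b) =
        tens (lam [X]) (𝟙 a) ≫ tens (ofHom φ.1) (Comps.hom φ.2)
      refine (tens_comp _ _ _ _).symm.trans (Eq.trans ?_ (tens_comp _ _ _ _))
      rw [lam_naturality, Category.comp_id, Category.id_comp]
  | skip m ih =>
    match a, b, φ with
    | [], [], φ => exact ⟨show Comps [] [] from φ, (Category.comp_id _).trans (Category.id_comp _).symm⟩
    | X :: a, Y :: b, φ =>
      obtain ⟨ψ, hψ⟩ := ih φ.2
      refine ⟨show Comps (X :: (m.run a).1) (Y :: (m.run b).1) from .cons φ.1 ψ, ?_⟩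
      change tens (ofHom φ.1) (Comps.hom φ.2) ≫ tens (𝟙 [Y]) (m.run b).2 =
        tens (𝟙 [X]) (m.run a).2 ≫ tens (ofHom φ.1) ψ.hom
      refine (tens_comp _ _ _ _).symm.trans (Eq.trans ?_ (tens_comp _ _ _ _))
      rw [hψ, Category.comp_id, Category.id_comp]

theorem exists_comps_word {a b : List C} (φ : Comps a b) (w : List Move) :
    ∃ ψ : Comps (runWord w a).1 (runWord w b).1,
      φ.hom ≫ (runWord w b).2 = (runWord w a).2 ≫ ψ.hom := by
  induction w generalizing a b with
  | nil => exact ⟨φ, (Category.comp_id _).trans (Category.id_comp _).symm⟩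
  | cons m w ih =>
    obtain ⟨ψ, hψ⟩ := exists_comps_move φ m
    obtain ⟨χ, hχ⟩ := ih ψ
    refine ⟨χ, ?_⟩
    simp only [runWord]
    rw [reassoc_of% hψ, hχ, Category.assoc]

theorem IsNormal.of_comps {a b : List C} (φ : Comps a b) : IsNormal φ.hom :=
  ⟨[], φ, (Category.id_comp _).symm⟩

theorem IsNormal.id (a : List C) : IsNormal (𝟙 a) := by
  obtain ⟨φ, hφ⟩ := exists_comps_id a
  rw [← hφ]
  exact .of_comps φ

theorem IsNormal.eqToHom {a b : List C} (h : a = b) : IsNormal (eqToHom h) := by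
  subst h; exact .id _

theorem IsNormal.of_move (m : Move) (a : List C) : IsNormal (m.run a).2 := by
  obtain ⟨φ, hφ⟩ := exists_comps_id (m.run a).1
  refine ⟨[m], φ, ?_⟩
  refine ((congrArg (fun z => ((m.run a).2 ≫ 𝟙 _) ≫ z) hφ).trans ?_).symm
  simp

theorem IsNormal.move_comp (m : Move) {a b : List C} {f : (m.run a).1 ⟶ b} (hf : IsNormal f) :
    IsNormal ((m.run a).2 ≫ f) := by
  obtain ⟨w, φ, rfl⟩ := hf
  exact ⟨m :: w, φ, (Category.assoc _ _ _).symm⟩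

theorem IsNormal.word_comp (w : List Move) {a b : List C} {f : (runWord w a).1 ⟶ b}
    (hf : IsNormal f) : IsNormal ((runWord w a).2 ≫ f) := by
  induction w generalizing a with
  | nil =>
    have e : (runWord [] a).2 ≫ f = f := Category.id_comp (X := a) f
    rw [e]; exact hf
  | cons m w ih =>
    have e : (runWord (m :: w) a).2 ≫ f = (m.run a).2 ≫ (runWord w (m.run a).1).2 ≫ f :=
      Category.assoc _ _ _
    rw [e]; exact move_comp m (ih hf)

theorem IsNormal.comp {a b c : List C} {f : a ⟶ b} {g : b ⟶ c} (hf : IsNormal f)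
    (hg : IsNormal g) : IsNormal (f ≫ g) := by
  obtain ⟨w, φ, rfl⟩ := hf
  obtain ⟨w', ψ, rfl⟩ := hg
  rw [Category.assoc]
  refine word_comp w ?_
  obtain ⟨χ, hχ⟩ := exists_comps_word φ w'
  rw [reassoc_of% hχ]
  refine word_comp w' ?_
  obtain ⟨κ, hκ⟩ := exists_comps_comp χ ψ
  rw [← hκ]
  exact .of_comps κ

theorem IsNormal.tens_comp {a b c a' b' c' : List C} {f : a ⟶ b} {g : b ⟶ c}
    {f' : a' ⟶ b'} {g' : b' ⟶ c'} (h : IsNormal (tens f f')) (k : IsNormal (tens g g')) :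
    IsNormal (tens (f ≫ g) (f' ≫ g')) := by
  rw [Free.tens_comp]; exact h.comp k

theorem IsNormal.cons_move (X : C) (m : Move) (a : List C) :
    IsNormal (tens (𝟙 [X]) (m.run a).2) :=
  IsNormal.of_move (.skip m) (X :: a)

theorem IsNormal.cons_word (X : C) (w : List Move) {a b : List C} {f : (runWord w a).1 ⟶ b}
    (hf : IsNormal (tens (𝟙 [X]) f)) : IsNormal (tens (𝟙 [X]) ((runWord w a).2 ≫ f)) := by
  induction w generalizing a with
  | nil =>
    have e : (runWord [] a).2 ≫ f = f := Category.id_comp (X := a) f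
    rw [e]; exact hf
  | cons m w ih =>
    have e : (runWord (m :: w) a).2 ≫ f = (m.run a).2 ≫ (runWord w (m.run a).1).2 ≫ f :=
      Category.assoc _ _ _
    have h := tens_comp (cons_move X m a) (ih hf)
    rw [Category.comp_id] at h
    rw [e]; exact h

theorem IsNormal.cons (X : C) {a b : List C} {f : a ⟶ b} (hf : IsNormal f) :
    IsNormal (tens (𝟙 [X]) f) := by
  obtain ⟨w, φ, rfl⟩ := hf
  refine cons_word X w ?_
  rw [← ofHom_id]
  exact IsNormal.of_comps (.cons (𝟙 X) φ)

theorem IsNormal.id_tens (c : List C) {a b : List C} {f : a ⟶ b} (hf : IsNormal f) :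
    IsNormal (tens (𝟙 c) f) := by
  induction c with
  | nil => rw [nil_tens]; exact hf
  | cons X c ih =>
    have h : tens (𝟙 (X :: c)) f = tens (𝟙 [X]) (tens (𝟙 c) f) := by
      rw [← (conj_rfl (tens (𝟙 [X]) (tens (𝟙 c) f)) rfl rfl)]
      exact (congrArg (fun z => tens z f) (tens_id [X] c)).symm.trans (tens_assoc' (𝟙 [X]) (𝟙 c) f)
    rw [h]
    exact ih.cons X

theorem IsNormal.move_tens (m : Move) (a d : List C) : IsNormal (tens (m.run a).2 (𝟙 d)) := by
  induction m generalizing a with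
  | swap =>
    match a with
    | [] => rw [Move.run, tens_id]; exact .id _
    | [X] => rw [Move.run, tens_id]; exact .id _
    | X :: Y :: a =>
      have h := tens_assoc' (sigma [X] [Y]) (𝟙 a) (𝟙 d)
      rw [tens_id] at h
      have h' := h.trans (conj_rfl (tens (sigma [X] [Y]) (𝟙 (a ++ d))) _ _)
      have k := IsNormal.of_move .swap (X :: Y :: (a ++ d))
      rw [Move.run, ← h'] at k
      exact k
  | twist =>
    match a with
    | [] => rw [Move.run, tens_id]; exact .id _
    | X :: a =>
      have h := tens_assoc' (Free.lam [X]) (𝟙 a) (𝟙 d)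
      rw [tens_id] at h
      have h' := h.trans (conj_rfl (tens (Free.lam [X]) (𝟙 (a ++ d))) _ _)
      have k := IsNormal.of_move .twist (X :: (a ++ d))
      rw [Move.run, ← h'] at k
      exact k
  | skip m ih =>
    match a with
    | [] => rw [Move.run, tens_id]; exact .id _
    | X :: a =>
      have h := (tens_assoc' (𝟙 [X]) (m.run a).2 (𝟙 d)).trans (conj_rfl _ _ _)
      have k := (ih a).cons X
      rw [← h] at k
      exact k

theorem IsNormal.word_tens (d : List C) (w : List Move) {a b : List C}
    {f : (runWord w a).1 ⟶ b} (hf : IsNormal (tens f (𝟙 d))) :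
    IsNormal (tens ((runWord w a).2 ≫ f) (𝟙 d)) := by
  induction w generalizing a with
  | nil =>
    have e : (runWord [] a).2 ≫ f = f := Category.id_comp (X := a) f
    rw [e]; exact hf
  | cons m w ih =>
    have e : (runWord (m :: w) a).2 ≫ f = (m.run a).2 ≫ (runWord w (m.run a).1).2 ≫ f :=
      Category.assoc _ _ _
    have h := tens_comp (move_tens m a d) (ih hf)
    rw [Category.comp_id] at h
    rw [e]; exact h

theorem IsNormal.tens_id (d : List C) {a b : List C} {f : a ⟶ b} (hf : IsNormal f) :
    IsNormal (tens f (𝟙 d)) := by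
  obtain ⟨w, φ, rfl⟩ := hf
  refine word_tens d w ?_
  obtain ⟨δ, hδ⟩ := exists_comps_id d
  obtain ⟨χ, hχ⟩ := exists_comps_tens φ δ
  rw [← hδ, ← hχ]
  exact .of_comps χ

theorem IsNormal.tens {a b c d : List C} {f : a ⟶ b} {g : c ⟶ d} (hf : IsNormal f)
    (hg : IsNormal g) : IsNormal (tens f g) := by
  have h := tens_comp (hf.tens_id c) (hg.id_tens b)
  rwa [Category.comp_id, Category.id_comp] at h

theorem IsNormal.sigma_singleton (X : C) (b : List C) : IsNormal (sigma [X] b) := by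
  induction b with
  | nil => rw [sigma_nil]; exact .eqToHom _
  | cons Y b ih =>
    have h : IsNormal (sigma [X] [Y]) := by
      have k := IsNormal.of_move .swap [X, Y]
      have e : Free.tens (sigma [X] [Y]) (𝟙 []) = sigma [X] [Y] :=
        (tens_nil' _).trans (conj_rfl _ _ _)
      rw [Move.run, e] at k
      exact k
    have k := sigma_append_right [X] [Y] b
    change IsNormal (sigma [X] ([Y] ++ b))
    rw [k]
    exact (IsNormal.eqToHom _).comp ((h.tens_id _).comp
      ((IsNormal.eqToHom _).comp ((ih.id_tens _).comp (.eqToHom _))))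

theorem IsNormal.sigma (a b : List C) : IsNormal (sigma a b) := by
  induction a with
  | nil => rw [nil_sigma]; exact .eqToHom _
  | cons X a ih =>
    change IsNormal (Free.sigma ([X] ++ a) b)
    rw [sigma_append_left [X] a b]
    exact (IsNormal.eqToHom _).comp ((ih.id_tens _).comp
      ((IsNormal.eqToHom _).comp (((sigma_singleton X b).tens_id _).comp (.eqToHom _))))

theorem IsNormal.lam (a : List C) : IsNormal (lam a) := by
  induction a with
  | nil => rw [lam_nil]; exact .id _
  | cons X a ih =>
    have h : IsNormal (Free.lam [X]) := by
      have k := IsNormal.of_move .twist [X]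
      have e : Free.tens (Free.lam [X]) (𝟙 []) = Free.lam [X] :=
        (tens_nil' _).trans (conj_rfl _ _ _)
      rw [Move.run, e] at k
      exact k
    change IsNormal (Free.lam ([X] ++ a))
    rw [lam_append]
    exact h.tens ih

theorem isNormal {a b : List C} (f : a ⟶ b) : IsNormal f := by
  induction f using hom_induction with
  | id a => exact .id a
  | comp f g hf hg => exact hf.comp hg
  | tens f g hf hg => exact hf.tens hg
  | @ofHom X Y f =>
    have e : tens (ofHom f) (𝟙 []) = ofHom f := (tens_nil' _).trans (conj_rfl _ _ _)
    rw [← e]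
    exact IsNormal.of_comps (.cons f (show Comps [] [] from PUnit.unit))
  | sigma a b => exact .sigma a b
  | lam a => exact .lam a

instance : LocallySmall.{v} (Free C) where
  hom_small a b := by
    have : Small.{v} (List Move) := inferInstance
    refine small_of_surjective
      (f := fun p : Σ w : List Move, Comps (runWord w a).1 b => (runWord p.1 a).2 ≫ p.2.hom) ?_
    intro f
    obtain ⟨w, φ, h⟩ := isNormal f
    exact ⟨⟨w, φ⟩, h.symm⟩

end Free
end Distorted

namespace Distorted

/-- A (strict) 2-monad on the 2-category of categories, functors and natural transformations:
a strict 2-functor with strictly 2-natural unit and multiplication satisfying the monad laws.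
Equations between natural transformations whose sources and targets agree only propositionally
are stated componentwise. -/
structure TwoMonad where
  obj : Cat.{v, u} → Cat.{v, u}
  map {C D : Cat.{v, u}} (F : C ⥤ D) : obj C ⥤ obj D
  map₂ {C D : Cat.{v, u}} {F G : C ⥤ D} (θ : F ⟶ G) : map F ⟶ map G
  map_id (C : Cat.{v, u}) : map (𝟭 C) = 𝟭 (obj C)
  map_comp {C D E : Cat.{v, u}} (F : C ⥤ D) (G : D ⥤ E) : map (F ⋙ G) = map F ⋙ map G
  map₂_id {C D : Cat.{v, u}} (F : C ⥤ D) : map₂ (𝟙 F) = 𝟙 (map F)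
  map₂_comp {C D : Cat.{v, u}} {F G H : C ⥤ D} (θ : F ⟶ G) (τ : G ⟶ H) :
    map₂ (θ ≫ τ) = map₂ θ ≫ map₂ τ
  map₂_whiskerLeft {C D E : Cat.{v, u}} (F : C ⥤ D) {G H : D ⥤ E} (θ : G ⟶ H) (X : obj C) :
    (map₂ (Functor.whiskerLeft F θ)).app X =
      eqToHom (Functor.congr_obj (map_comp F G) X) ≫ (map₂ θ).app ((map F).obj X) ≫
        eqToHom (Functor.congr_obj (map_comp F H) X).symm
  map₂_whiskerRight {C D E : Cat.{v, u}} {F G : C ⥤ D} (θ : F ⟶ G) (H : D ⥤ E) (X : obj C) :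
    (map₂ (Functor.whiskerRight θ H)).app X =
      eqToHom (Functor.congr_obj (map_comp F H) X) ≫ (map H).map ((map₂ θ).app X) ≫
        eqToHom (Functor.congr_obj (map_comp G H) X).symm
  unit (C : Cat.{v, u}) : C ⥤ obj C
  unit_naturality {C D : Cat.{v, u}} (F : C ⥤ D) : F ⋙ unit D = unit C ⋙ map F
  unit_naturality₂ {C D : Cat.{v, u}} {F G : C ⥤ D} (θ : F ⟶ G) (X : C) :
    (unit D).map (θ.app X) =
      eqToHom (Functor.congr_obj (unit_naturality F) X) ≫ (map₂ θ).app ((unit C).obj X) ≫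
        eqToHom (Functor.congr_obj (unit_naturality G) X).symm
  mult (C : Cat.{v, u}) : obj (obj C) ⥤ obj C
  mult_naturality {C D : Cat.{v, u}} (F : C ⥤ D) :
    map (map F) ⋙ mult D = mult C ⋙ map F
  mult_naturality₂ {C D : Cat.{v, u}} {F G : C ⥤ D} (θ : F ⟶ G) (X : obj (obj C)) :
    (mult D).map ((map₂ (map₂ θ)).app X) =
      eqToHom (Functor.congr_obj (mult_naturality F) X) ≫ (map₂ θ).app ((mult C).obj X) ≫
        eqToHom (Functor.congr_obj (mult_naturality G) X).symm
  unit_mult (C : Cat.{v, u}) : unit (obj C) ⋙ mult C = 𝟭 (obj C)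
  map_unit_mult (C : Cat.{v, u}) : map (unit C) ⋙ mult C = 𝟭 (obj C)
  mult_assoc (C : Cat.{v, u}) : map (mult C) ⋙ mult C = mult (obj C) ⋙ mult C

namespace Free

theorem lift₂App_congr {C : Type u} [Category.{v} C] {D : Type u'} [Category.{v'} D]
    {F F' G G' : C ⥤ Free D} (θ : F ⟶ G) (θ' : F' ⟶ G')
    (hF : F = F') (hG : G = G')
    (h : ∀ X, θ.app X = eqToHom (Functor.congr_obj hF X) ≫ θ'.app X ≫
      eqToHom (Functor.congr_obj hG X).symm)
    (a : List C) :
    lift₂App θ a = eqToHom (congrArg (fun F : C ⥤ Free D => liftObj F.obj a) hF) ≫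
      lift₂App θ' a ≫ eqToHom (congrArg (fun F : C ⥤ Free D => liftObj F.obj a) hG).symm := by
  subst hF hG
  have : θ = θ' := by ext X; simpa using h X
  subst this
  simp

end Free

variable {C : Type u} [Category.{v} C] {D : Type u'} [Category.{v'} D]
  {E : Type u''} [Category.{v''} E]

/-- The objects of the free strict distorted monoidal category; its hom-sets are as small as those
of `C`, and `Words C` is the isomorphic category whose hom-sets lie in the universe of those of
`C`. -/
structure Words (C : Type u) where
  toList : List C

namespace Words

open Free

noncomputable instance : Category.{v} (Words C) where
  Hom a b := Shrink.{v} (a.toList ⟶ b.toList)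
  id a := equivShrink _ (𝟙 a.toList)
  comp f g := equivShrink _ ((equivShrink _).symm f ≫ (equivShrink _).symm g)

variable (C) in
noncomputable def wrap : Free C ⥤ Words C where
  obj a := ⟨a⟩
  map f := equivShrink _ f
  map_comp f g := by
    change _ = equivShrink _ ((equivShrink _).symm _ ≫ (equivShrink _).symm _)
    simp

variable (C) in
noncomputable def unwrap : Words C ⥤ Free C where
  obj a := a.toList
  map f := (equivShrink _).symm f
  map_id a := (equivShrink _).symm_apply_apply _
  map_comp f g := (equivShrink _).symm_apply_apply _

theorem unwrap_map_wrap_map {a b : Free C} (f : a ⟶ b) :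
    (unwrap C).map ((wrap C).map f) = f := (equivShrink _).symm_apply_apply _

theorem wrap_map_unwrap_map {a b : Words C} (f : a ⟶ b) :
    (wrap C).map ((unwrap C).map f) = f := (equivShrink _).apply_symm_apply _

theorem wrap_unwrap : wrap C ⋙ unwrap C = 𝟭 (Free C) :=
  CategoryTheory.Functor.ext (fun _ => rfl)
    (fun _ _ f => (unwrap_map_wrap_map f).trans (conj_rfl _ _ _).symm)

theorem unwrap_wrap : unwrap C ⋙ wrap C = 𝟭 (Words C) :=
  CategoryTheory.Functor.ext (fun _ => rfl)
    (fun _ _ f => (wrap_map_unwrap_map f).trans (conj_rfl _ _ _).symm)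

variable (C) in
noncomputable def of : C ⥤ Words C := Free.of C ⋙ wrap C

noncomputable def ext (F : C ⥤ Words D) : Words C ⥤ Words D :=
  unwrap C ⋙ lift (F ⋙ unwrap D) ⋙ wrap D

noncomputable def ext₂ {F G : C ⥤ Words D} (θ : F ⟶ G) : ext F ⟶ ext G :=
  Functor.whiskerLeft (unwrap C)
    (Functor.whiskerRight (lift₂ (Functor.whiskerRight θ (unwrap D))) (wrap D))

theorem of_comp_ext (F : C ⥤ Words D) : of C ⋙ ext F = F := by
  change Free.of C ⋙ (wrap C ⋙ unwrap C) ⋙ lift (F ⋙ unwrap D) ⋙ wrap D = F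
  rw [wrap_unwrap, Functor.id_comp, ← Functor.assoc, Free.of_comp_lift, Functor.assoc, unwrap_wrap,
    Functor.comp_id]

theorem ext_of : ext (of C) = 𝟭 (Words C) := by
  change unwrap C ⋙ lift (Free.of C ⋙ (wrap C ⋙ unwrap C)) ⋙ wrap C = _
  rw [wrap_unwrap, Functor.comp_id, Free.lift_of_eq_id, Functor.id_comp, unwrap_wrap]

theorem ext_comp_ext (F : C ⥤ Words D) (G : D ⥤ Words E) :
    ext F ⋙ ext G = ext (F ⋙ ext G) := by
  change unwrap C ⋙ lift (F ⋙ unwrap D) ⋙ (wrap D ⋙ unwrap D) ⋙ lift (G ⋙ unwrap E) ⋙ wrap E =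
    unwrap C ⋙ lift ((F ⋙ unwrap D ⋙ lift (G ⋙ unwrap E)) ⋙ (wrap E ⋙ unwrap E)) ⋙ wrap E
  rw [wrap_unwrap, wrap_unwrap, Functor.id_comp, Functor.comp_id, ← Functor.assoc (lift _),
    Free.lift_comp_lift, Functor.assoc]

theorem ext₂_id (F : C ⥤ Words D) : ext₂ (𝟙 F) = 𝟙 (ext F) := by
  rw [ext₂, Functor.whiskerRight_id', lift₂_id, Functor.whiskerRight_id', Functor.whiskerLeft_id']
  rfl

theorem ext₂_comp {F G H : C ⥤ Words D} (θ : F ⟶ G) (τ : G ⟶ H) :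
    ext₂ (θ ≫ τ) = ext₂ θ ≫ ext₂ τ := by
  rw [ext₂, Functor.whiskerRight_comp, lift₂_comp, Functor.whiskerRight_comp,
    Functor.whiskerLeft_comp]
  rfl

theorem ext₂_of_app {F G : C ⥤ Words D} (θ : F ⟶ G) (X : C) :
    (ext₂ θ).app ((of C).obj X) = eqToHom (Functor.congr_obj (of_comp_ext F) X) ≫ θ.app X ≫
      eqToHom (Functor.congr_obj (of_comp_ext G) X).symm := by
  have h := congrArg (wrap D).map (lift₂App_singleton (Functor.whiskerRight θ (unwrap D)) X)
  rw [Functor.map_comp, Functor.map_comp, eqToHom_map, eqToHom_map, Functor.whiskerRight_app,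
    wrap_map_unwrap_map] at h
  exact h

theorem ext₂_congr {F F' G G' : C ⥤ Words D} (θ : F ⟶ G) (θ' : F' ⟶ G')
    (hF : F = F') (hG : G = G')
    (h : ∀ X, θ.app X = eqToHom (Functor.congr_obj hF X) ≫ θ'.app X ≫
      eqToHom (Functor.congr_obj hG X).symm)
    (a : Words C) :
    (ext₂ θ).app a = eqToHom (Functor.congr_obj (congrArg ext hF) a) ≫
      (ext₂ θ').app a ≫ eqToHom (Functor.congr_obj (congrArg ext hG) a).symm := by
  subst hF hG
  have : θ = θ' := by ext X; simpa using h X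
  subst this
  simp

theorem ext₂_whiskerRight {F F' : C ⥤ Words D} (θ : F ⟶ F') (G : D ⥤ Words E) (a : Words C) :
    (ext G).map ((ext₂ θ).app a) = eqToHom (Functor.congr_obj (ext_comp_ext F G) a) ≫
      (ext₂ (Functor.whiskerRight θ (ext G))).app a ≫
        eqToHom (Functor.congr_obj (ext_comp_ext F' G) a).symm := by
  have h₁ : (ext G).map ((ext₂ θ).app a) = (wrap E).map (liftMap (G ⋙ unwrap E)
      (lift₂App (Functor.whiskerRight θ (unwrap D)) a.toList)) :=
    congrArg (fun z => (wrap E).map (liftMap (G ⋙ unwrap E) z)) (unwrap_map_wrap_map _)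
  rw [h₁, lift₂App_whiskerRight, Functor.map_comp, Functor.map_comp, eqToHom_map, eqToHom_map]
  have e : ∀ F : C ⥤ Words D, (F ⋙ unwrap D) ⋙ lift (G ⋙ unwrap E) =
    (F ⋙ ext G) ⋙ unwrap E := fun F => by
      change _ = F ⋙ unwrap D ⋙ lift (G ⋙ unwrap E) ⋙ (wrap E ⋙ unwrap E)
      rw [wrap_unwrap]; rfl
  have h₂ := Free.lift₂App_congr
    (Functor.whiskerRight (Functor.whiskerRight θ (unwrap D)) (lift (G ⋙ unwrap E)))
    (Functor.whiskerRight (Functor.whiskerRight θ (ext G)) (unwrap E))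
    (e F) (e F') (fun X => (unwrap_map_wrap_map _).symm.trans (conj_rfl _ _ _).symm) a.toList
  rw [h₂, Functor.map_comp, Functor.map_comp, eqToHom_map, eqToHom_map]
  simp only [Category.assoc, eqToHom_trans, eqToHom_trans_assoc]
  rfl

theorem ext₂_whiskerLeft (F : C ⥤ Words D) {G G' : D ⥤ Words E} (θ : G ⟶ G') (a : Words C) :
    (ext₂ θ).app ((ext F).obj a) = eqToHom (Functor.congr_obj (ext_comp_ext F G) a) ≫
      (ext₂ (Functor.whiskerLeft F (ext₂ θ))).app a ≫
        eqToHom (Functor.congr_obj (ext_comp_ext F G') a).symm := by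
  have h₁ : (ext₂ θ).app ((ext F).obj a) = (wrap E).map (lift₂App
      (Functor.whiskerRight θ (unwrap E)) (liftObj (F ⋙ unwrap D).obj a.toList)) := rfl
  rw [h₁, lift₂App_whiskerLeft, Functor.map_comp, Functor.map_comp, eqToHom_map, eqToHom_map]
  have e : ∀ G : D ⥤ Words E, (F ⋙ unwrap D) ⋙ lift (G ⋙ unwrap E) =
    (F ⋙ ext G) ⋙ unwrap E := fun G => by
      change _ = F ⋙ unwrap D ⋙ lift (G ⋙ unwrap E) ⋙ (wrap E ⋙ unwrap E)
      rw [wrap_unwrap]; rfl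
  have h₂ := Free.lift₂App_congr
    (Functor.whiskerLeft (F ⋙ unwrap D) (lift₂ (Functor.whiskerRight θ (unwrap E))))
    (Functor.whiskerRight (Functor.whiskerLeft F (ext₂ θ)) (unwrap E))
    (e G) (e G') (fun X => (unwrap_map_wrap_map _).symm.trans (conj_rfl _ _ _).symm) a.toList
  rw [h₂, Functor.map_comp, Functor.map_comp, eqToHom_map, eqToHom_map]
  simp only [Category.assoc, eqToHom_trans, eqToHom_trans_assoc]
  rfl

noncomputable def map (F : C ⥤ D) : Words C ⥤ Words D := ext (F ⋙ of D)

noncomputable def map₂ {F G : C ⥤ D} (θ : F ⟶ G) : map F ⟶ map G :=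
  ext₂ (Functor.whiskerRight θ (of D))

variable (C) in
noncomputable def mult : Words (Words C) ⥤ Words C := ext (𝟭 (Words C))

theorem map_comp_ext (F : C ⥤ D) (G : D ⥤ Words E) : map F ⋙ ext G = ext (F ⋙ G) := by
  rw [map, ext_comp_ext, Functor.assoc, of_comp_ext]

theorem mult_comp_ext (F : C ⥤ Words D) : mult C ⋙ ext F = ext (ext F) := by
  rw [mult, ext_comp_ext, Functor.id_comp]

theorem map_comp (F : C ⥤ D) (G : D ⥤ E) : map (F ⋙ G) = map F ⋙ map G :=
  (map_comp_ext F (G ⋙ of E)).symm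

theorem mult_naturality (F : C ⥤ D) : map (map F) ⋙ mult D = mult C ⋙ map F :=
  (map_comp_ext (map F) (𝟭 (Words D))).trans (mult_comp_ext (F ⋙ of D)).symm

theorem map_unit_mult : map (of C) ⋙ mult C = 𝟭 (Words C) :=
  (map_comp_ext (of C) (𝟭 (Words C))).trans ext_of

theorem mult_assoc : map (mult C) ⋙ mult C = mult (Words C) ⋙ mult C :=
  (map_comp_ext (mult C) (𝟭 (Words C))).trans (mult_comp_ext (𝟭 (Words C))).symm

theorem map₂_id (F : C ⥤ D) : map₂ (𝟙 F) = 𝟙 (map F) := by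
  rw [map₂, Functor.whiskerRight_id', ext₂_id]; rfl

theorem map₂_comp {F G H : C ⥤ D} (θ : F ⟶ G) (τ : G ⟶ H) :
    map₂ (θ ≫ τ) = map₂ θ ≫ map₂ τ := by
  rw [map₂, Functor.whiskerRight_comp, ext₂_comp]; rfl

theorem map₂_whiskerLeft (F : C ⥤ D) {G H : D ⥤ E} (θ : G ⟶ H) (X : Words C) :
    (map₂ (Functor.whiskerLeft F θ)).app X =
      eqToHom (Functor.congr_obj (map_comp F G) X) ≫ (map₂ θ).app ((map F).obj X) ≫
        eqToHom (Functor.congr_obj (map_comp F H) X).symm := by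
  have h := ext₂_whiskerLeft (F ⋙ of D) (Functor.whiskerRight θ (of E)) X
  have e : ∀ G : D ⥤ E, (F ⋙ of D) ⋙ ext (G ⋙ of E) = (F ⋙ G) ⋙ of E := fun G => by
    rw [Functor.assoc, of_comp_ext, Functor.assoc]
  have h₂ := ext₂_congr (Functor.whiskerLeft (F ⋙ of D) (ext₂ (Functor.whiskerRight θ (of E))))
    (Functor.whiskerRight (Functor.whiskerLeft F θ) (of E)) (e G) (e H)
    (fun X => ext₂_of_app (Functor.whiskerRight θ (of E)) (F.obj X)) X
  rw [h₂] at h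
  change (map₂ θ).app ((map F).obj X) = _ at h
  rw [h]
  simp only [Category.assoc, eqToHom_trans, eqToHom_trans_assoc]
  exact (conj_rfl (C := Words E) _ rfl rfl).symm.trans (conj_conj _ _ _ _ _ _ _)

theorem map₂_whiskerRight {F G : C ⥤ D} (θ : F ⟶ G) (H : D ⥤ E) (X : Words C) :
    (map₂ (Functor.whiskerRight θ H)).app X =
      eqToHom (Functor.congr_obj (map_comp F H) X) ≫ (map H).map ((map₂ θ).app X) ≫
        eqToHom (Functor.congr_obj (map_comp G H) X).symm := by
  have h := ext₂_whiskerRight (Functor.whiskerRight θ (of D)) (H ⋙ of E) X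
  have e : ∀ F : C ⥤ D, (F ⋙ of D) ⋙ ext (H ⋙ of E) = (F ⋙ H) ⋙ of E := fun F => by
    rw [Functor.assoc, of_comp_ext, Functor.assoc]
  have h₂ := ext₂_congr (Functor.whiskerRight (Functor.whiskerRight θ (of D)) (ext (H ⋙ of E)))
    (Functor.whiskerRight (Functor.whiskerRight θ H) (of E)) (e F) (e G)
    (fun X => Functor.congr_hom (of_comp_ext (H ⋙ of E)) (θ.app X)) X
  rw [h₂] at h
  change (map H).map ((map₂ θ).app X) = _ at h
  rw [h]
  simp only [Category.assoc, eqToHom_trans, eqToHom_trans_assoc]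
  exact (conj_rfl (C := Words E) _ rfl rfl).symm.trans (conj_conj _ _ _ _ _ _ _)

theorem unit_naturality₂ {F G : C ⥤ D} (θ : F ⟶ G) (X : C) :
    (of D).map (θ.app X) =
      eqToHom (Functor.congr_obj (of_comp_ext (F ⋙ of D)).symm X) ≫
        (map₂ θ).app ((of C).obj X) ≫
        eqToHom (Functor.congr_obj (of_comp_ext (G ⋙ of D)).symm X).symm := by
  rw [map₂, ext₂_of_app]
  exact (conj_rfl ((of D).map (θ.app X)) rfl rfl).symm.trans (conj_conj _ _ _ _ _ _ _)

theorem mult_naturality₂ {F G : C ⥤ D} (θ : F ⟶ G) (X : Words (Words C)) :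
    (mult D).map ((map₂ (map₂ θ)).app X) =
      eqToHom (Functor.congr_obj (mult_naturality F) X) ≫ (map₂ θ).app ((mult C).obj X) ≫
        eqToHom (Functor.congr_obj (mult_naturality G) X).symm := by
  have h := ext₂_whiskerRight (Functor.whiskerRight (map₂ θ) (of (Words D))) (𝟭 (Words D)) X
  have k := ext₂_whiskerLeft (𝟭 (Words C)) (Functor.whiskerRight θ (of D)) X
  change (map₂ θ).app ((mult C).obj X) = _ at k
  change (mult D).map ((map₂ (map₂ θ)).app X) = _ at h
  rw [h, k]
  have e : ∀ F : C ⥤ D, (map F ⋙ of (Words D)) ⋙ ext (𝟭 (Words D)) =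
      𝟭 (Words C) ⋙ map F := fun F => by
    rw [Functor.assoc, of_comp_ext, Functor.comp_id, Functor.id_comp]
  rw [ext₂_congr _ (Functor.whiskerLeft (𝟭 (Words C)) (map₂ θ)) (e F) (e G)
    (fun X => Functor.congr_hom (of_comp_ext (𝟭 (Words D))) ((map₂ θ).app X)) X]
  simp only [Category.assoc, eqToHom_trans, eqToHom_trans_assoc]
  exact conj_conj (C := Words D) _ _ _ _ _ _ _

end Words

/-- The 2-monad of strict distorted monoidal categories: `C` is sent to the free strict distorted
monoidal category on `C`, the unit is the inclusion of words of length one, and the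
multiplication evaluates words of words. -/
noncomputable def Tσ : TwoMonad.{v, u} where
  obj C := Cat.of (Words C)
  map F := Words.map F
  map₂ θ := Words.map₂ θ
  map_id _ := Words.ext_of
  map_comp F G := Words.map_comp F G
  map₂_id F := Words.map₂_id F
  map₂_comp θ τ := Words.map₂_comp θ τ
  map₂_whiskerLeft F _ _ θ X := Words.map₂_whiskerLeft F θ X
  map₂_whiskerRight θ H X := Words.map₂_whiskerRight θ H X
  unit C := Words.of C
  unit_naturality {_ D} F := (Words.of_comp_ext (F ⋙ Words.of D)).symm
  unit_naturality₂ θ X := Words.unit_naturality₂ θ X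
  mult C := Words.mult C
  mult_naturality F := Words.mult_naturality F
  mult_naturality₂ θ X := Words.mult_naturality₂ θ X
  unit_mult C := Words.of_comp_ext (𝟭 (Words C))
  map_unit_mult _ := Words.map_unit_mult
  mult_assoc _ := Words.mult_assoc

end Distorted

namespace Distorted

/-- A pseudoalgebra structure on `C`: an action together with invertible unit and multiplication
2-cells, subject to the two unit axioms and the associativity axiom. -/
structure PseudoAlgebra (T : TwoMonad.{v, u}) (C : Cat.{v, u}) where
  act : T.obj C ⥤ C
  unitIso : 𝟭 C ≅ T.unit C ⋙ act
  multIso : T.map act ⋙ act ≅ T.mult C ⋙ act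
  unit_left (X : T.obj C) :
    unitIso.hom.app (act.obj X) ≫
      act.map (eqToHom (Functor.congr_obj (T.unit_naturality act) X)) ≫
      multIso.hom.app ((T.unit (T.obj C)).obj X) ≫
      act.map (eqToHom (Functor.congr_obj (T.unit_mult C) X)) = 𝟙 (act.obj X)
  unit_right (X : T.obj C) :
    act.map (eqToHom (Functor.congr_obj (T.map_id C) X).symm) ≫
      act.map ((T.map₂ unitIso.hom).app X) ≫
      act.map (eqToHom (Functor.congr_obj (T.map_comp (T.unit C) act) X)) ≫
      multIso.hom.app ((T.map (T.unit C)).obj X) ≫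
      act.map (eqToHom (Functor.congr_obj (T.map_unit_mult C) X)) = 𝟙 (act.obj X)
  mult_assoc (X : T.obj (T.obj (T.obj C))) :
    act.map ((T.map₂ multIso.hom).app X) ≫
      act.map (eqToHom (Functor.congr_obj (T.map_comp (T.mult C) act) X)) ≫
      multIso.hom.app ((T.map (T.mult C)).obj X) ≫
      act.map (eqToHom (Functor.congr_obj (T.mult_assoc C) X)) =
    act.map (eqToHom (Functor.congr_obj (T.map_comp (T.map act) act) X)) ≫
      multIso.hom.app ((T.map (T.map act)).obj X) ≫
      act.map (eqToHom (Functor.congr_obj (T.mult_naturality act) X)) ≫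
      multIso.hom.app ((T.mult (T.obj C)).obj X)

/-- A lax morphism structure on a functor between pseudoalgebras. -/
@[ext]
structure LaxMorphism {T : TwoMonad.{v, u}} {C D : Cat.{v, u}} (A : PseudoAlgebra T C)
    (B : PseudoAlgebra T D) (F : C ⥤ D) where
  cell : T.map F ⋙ B.act ⟶ A.act ⋙ F
  unit (X : C) :
    B.unitIso.hom.app (F.obj X) ≫
      B.act.map (eqToHom (Functor.congr_obj (T.unit_naturality F) X)) ≫
      cell.app ((T.unit C).obj X) = F.map (A.unitIso.hom.app X)
  mult (X : T.obj (T.obj C)) :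
    B.act.map ((T.map₂ cell).app X) ≫
      B.act.map (eqToHom (Functor.congr_obj (T.map_comp A.act F) X)) ≫
      cell.app ((T.map A.act).obj X) ≫ F.map (A.multIso.hom.app X) =
    B.act.map (eqToHom (Functor.congr_obj (T.map_comp (T.map F) B.act) X)) ≫
      B.multIso.hom.app ((T.map (T.map F)).obj X) ≫
      B.act.map (eqToHom (Functor.congr_obj (T.mult_naturality F) X)) ≫
      cell.app ((T.mult C).obj X)

/-- A natural transformation between lax morphisms is a transformation if it commutes with the
structure cells. -/
def IsTransformation {T : TwoMonad.{v, u}} {C D : Cat.{v, u}} {A : PseudoAlgebra T C}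
    {B : PseudoAlgebra T D} {F G : C ⥤ D} (f : LaxMorphism A B F) (g : LaxMorphism A B G)
    (θ : F ⟶ G) : Prop :=
  ∀ X : T.obj C, f.cell.app X ≫ θ.app (A.act.obj X) = B.act.map ((T.map₂ θ).app X) ≫ g.cell.app X

theorem TwoMonad.map₂_eqToHom_app (T : TwoMonad.{v, u}) {C D : Cat.{v, u}} {F G : C ⥤ D}
    (h : F = G) (X : T.obj C) :
    (T.map₂ (eqToHom h)).app X = eqToHom (congrArg (fun F => (T.map F).obj X) h) := by
  subst h; simp [T.map₂_id]

theorem app_conj {C : Type u} [Category.{v} C] {D : Type u'} [Category.{v'} D] {F G : C ⥤ D}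
    (θ : F ⟶ G) {X Y : C} (h : X = Y) :
    θ.app X = eqToHom (congrArg F.obj h) ≫ θ.app Y ≫ eqToHom (congrArg G.obj h).symm := by
  subst h; simp

namespace LaxMorphism

theorem comp_aux {C : Type u} [Category.{v} C]
    {a₁ a₂ b₁ b₂ c₁ c₂ c₂' k₁ k₂ k₂' d₂ z m₂ M₁ M₂ M₁' M₂' l₁ l₁' l₂' x : C}
    (a : a₁ ⟶ a₂) (b : b₁ ⟶ b₂) (c : c₁ ⟶ c₂) (c' : b₂ ⟶ c₂') (k : k₁ ⟶ k₂) (k' : b₁ ⟶ k₂')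
    (b' : k₂' ⟶ c₂') (d : c₂ ⟶ d₂) (e : d₂ ⟶ z) (m : k₂ ⟶ m₂) (d' : l₂' ⟶ z) (M : M₁ ⟶ M₂)
    (l : l₁ ⟶ m₂) (l' : l₁' ⟶ l₂') (M' : M₁' ⟶ M₂')
    (p₁ : b₁ = k₁) (p₂ : b₂ = c₁) (p₃ : c₂ = c₂') (p₄ : k₂ = k₂') (p₅ : m₂ = l₂') (p₆ : a₁ = M₁)
    (p₇ : M₂ = l₁) (p₈ : l₁ = l₁') {p₉ : M₁' = M₁} {q₁ : M₂ = M₂'} {q₂ : a₂ = k₁} (q₃ : x = a₁)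
    {q₄ : a₂ = b₁} {q₅ : x = M₁'} {q₆ : M₂' = l₁'}
    (hn : b ≫ c' = k' ≫ b') (h₁ : k' = eqToHom p₁ ≫ k ≫ eqToHom p₄)
    (h₂ : c' = eqToHom p₂ ≫ c ≫ eqToHom p₃)
    (hf : b' ≫ eqToHom p₃.symm ≫ d ≫ e = eqToHom p₄.symm ≫ m ≫ eqToHom p₅ ≫ d')
    (hg : a ≫ eqToHom q₂ ≫ k ≫ m = eqToHom p₆ ≫ M ≫ eqToHom p₇ ≫ l)
    (h₃ : l = eqToHom p₈ ≫ l' ≫ eqToHom p₅.symm)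
    (h₄ : M' = eqToHom p₉ ≫ M ≫ eqToHom q₁) :
    eqToHom q₃ ≫ a ≫ eqToHom q₄ ≫ b ≫ eqToHom p₂ ≫ c ≫ d ≫ e =
      eqToHom q₅ ≫ M' ≫ eqToHom q₆ ≫ l' ≫ d' := by
  subst p₁ p₂ p₃ p₄ p₅ p₆ p₇ p₈ q₃ h₁ h₂ h₃ h₄
  simp only [eqToHom_refl, Category.id_comp, Category.comp_id, Category.assoc,
    eqToHom_trans_assoc] at *
  subst q₂
  simp only [eqToHom_refl, Category.id_comp] at *
  rw [reassoc_of% hn, hf, reassoc_of% hg]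

variable {T : TwoMonad.{v, u}} {C D E K : Cat.{v, u}} {A : PseudoAlgebra T C}
  {B : PseudoAlgebra T D} {B' : PseudoAlgebra T E} {B'' : PseudoAlgebra T K}

def id (A : PseudoAlgebra T C) : LaxMorphism A A (𝟭 C) where
  cell := Functor.whiskerRight (eqToHom (T.map_id C)) A.act
  unit X := by
    simp [eqToHom_map]
  mult X := by
    simp only [Functor.comp_obj, Functor.id_obj, Functor.id_map, Functor.whiskerRight_app,
      eqToHom_app, eqToHom_map, T.map₂_whiskerRight, T.map₂_eqToHom_app]
    rw [app_conj A.multIso.hom (show (T.map (T.map (𝟭 C))).obj X = X by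
      rw [T.map_id, T.map_id]; rfl)]
    simp [eqToHom_map]

def compCell {F : C ⥤ D} {G : D ⥤ E} (f : LaxMorphism A B F) (g : LaxMorphism B B' G) :
    T.map (F ⋙ G) ⋙ B'.act ⟶ A.act ⋙ F ⋙ G :=
  Functor.whiskerRight (eqToHom (T.map_comp F G)) B'.act ≫
    Functor.whiskerLeft (T.map F) g.cell ≫ Functor.whiskerRight f.cell G

theorem compCell_app {F : C ⥤ D} {G : D ⥤ E} (f : LaxMorphism A B F) (g : LaxMorphism B B' G)
    (X : T.obj C) :
    (compCell f g).app X =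
      eqToHom (congrArg B'.act.obj (Functor.congr_obj (T.map_comp F G) X)) ≫
        g.cell.app ((T.map F).obj X) ≫ G.map (f.cell.app X) := by
  simp [compCell, eqToHom_map]

theorem map₂_compCell_app {F : C ⥤ D} {G : D ⥤ E} (f : LaxMorphism A B F) (g : LaxMorphism B B' G)
    (X : T.obj (T.obj C)) (p) (q) (r) :
    (T.map₂ (compCell f g)).app X =
      eqToHom p ≫ (T.map₂ g.cell).app ((T.map (T.map F)).obj X) ≫ eqToHom q ≫
        (T.map G).map ((T.map₂ f.cell).app X) ≫ eqToHom r := by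
  rw [compCell, T.map₂_comp, T.map₂_comp, NatTrans.comp_app, NatTrans.comp_app,
    T.map₂_whiskerRight, T.map₂_whiskerLeft, T.map₂_whiskerRight, T.map₂_eqToHom_app, eqToHom_map]
  simp only [Category.assoc, eqToHom_trans, eqToHom_trans_assoc]

def comp {F : C ⥤ D} {G : D ⥤ E} (f : LaxMorphism A B F) (g : LaxMorphism B B' G) :
    LaxMorphism A B' (F ⋙ G) where
  cell := compCell f g
  unit X := by
    have h₁ := g.unit (F.obj X)
    have h₂ := congrArg G.map (f.unit X)
    simp only [Functor.map_comp, ← h₁, eqToHom_map] at h₂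
    have h₃ := app_conj g.cell (Functor.congr_obj (T.unit_naturality F) X)
    change g.cell.app ((T.unit D).obj (F.obj X)) = _ at h₃
    rw [h₃] at h₂
    rw [compCell_app, eqToHom_map]
    refine Eq.trans ?_ h₂
    simp only [Category.assoc, eqToHom_trans, eqToHom_trans_assoc]
    simp
  mult X := by
    have hf := congrArg G.map (f.mult X)
    have hg := g.mult ((T.map (T.map F)).obj X)
    have hn := g.cell.naturality ((T.map₂ f.cell).app X)
    have h₁ := app_conj g.cell (Functor.congr_obj (T.map_comp (T.map F) B.act) X)
    have h₂ := app_conj g.cell (Functor.congr_obj (T.map_comp A.act F) X)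
    have h₃ := app_conj g.cell (Functor.congr_obj (T.mult_naturality F) X)
    have h₄ := app_conj B'.multIso.hom
      (show (T.map (T.map (F ⋙ G))).obj X = (T.map (T.map G)).obj ((T.map (T.map F)).obj X) by
        rw [T.map_comp, T.map_comp]; rfl)
    rw [map₂_compCell_app f g X
      (by rw [T.map_comp F G]; exact Functor.congr_obj (T.map_comp (T.map F) (T.map G ⋙ B'.act)) X)
      ((Functor.congr_obj (T.map_comp (T.map F) (B.act ⋙ G)) X).symm.trans
        (Functor.congr_obj (T.map_comp (T.map F ⋙ B.act) G) X))
      (Functor.congr_obj (T.map_comp (A.act ⋙ F) G) X).symm]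
    simp only [Functor.map_comp, eqToHom_map, compCell_app] at hf hg ⊢
    dsimp only [Functor.comp_obj, Functor.comp_map] at *
    simp only [Category.assoc, eqToHom_trans_assoc] at *
    exact comp_aux _ _ _ _ _ _ _ _ _ _ _ _ _ _ _ _ _ _ _ _ _ _ _ _ hn h₁ h₂ hf hg h₃ h₄



end LaxMorphism

namespace IsTransformation

open LaxMorphism

variable {T : TwoMonad.{v, u}} {C D E K : Cat.{v, u}} {A : PseudoAlgebra T C}
  {B : PseudoAlgebra T D} {B' : PseudoAlgebra T E} {B'' : PseudoAlgebra T K}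
  {F F' F'' : C ⥤ D} {G G' : D ⥤ E} {H : E ⥤ K}

theorem id (f : LaxMorphism A B F) : IsTransformation f f (𝟙 F) := fun X => by
  rw [T.map₂_id, NatTrans.id_app, NatTrans.id_app, CategoryTheory.Functor.map_id]
  exact (Category.comp_id _).trans (Category.id_comp _).symm

theorem vcomp {f : LaxMorphism A B F} {f' : LaxMorphism A B F'} {f'' : LaxMorphism A B F''}
    {θ : F ⟶ F'} {τ : F' ⟶ F''} (hθ : IsTransformation f f' θ) (hτ : IsTransformation f' f'' τ) :
    IsTransformation f f'' (θ ≫ τ) := fun X => by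
  rw [T.map₂_comp, NatTrans.comp_app, NatTrans.comp_app, Functor.map_comp, Category.assoc,
    ← hτ X, ← Category.assoc, hθ X, Category.assoc]

theorem inv {f : LaxMorphism A B F} {f' : LaxMorphism A B F'} (e : F ≅ F')
    (h : IsTransformation f f' e.hom) : IsTransformation f' f e.inv := fun X => by
  have h₁ : (T.map₂ e.inv).app X ≫ (T.map₂ e.hom).app X = 𝟙 _ := by
    rw [← NatTrans.comp_app, ← T.map₂_comp, e.inv_hom_id, T.map₂_id, NatTrans.id_app]
  have h₂ : B.act.map ((T.map₂ e.inv).app X) ≫ B.act.map ((T.map₂ e.hom).app X) = 𝟙 _ := by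
    rw [← Functor.map_comp, h₁, CategoryTheory.Functor.map_id]
  have h₃ := h X
  rw [← cancel_mono (e.hom.app (A.act.obj X)), Category.assoc, Category.assoc, h₃,
    reassoc_of% h₂, ← NatTrans.comp_app, e.inv_hom_id, NatTrans.id_app]
  exact Category.comp_id _

theorem whiskerLeft (f : LaxMorphism A B F) {g : LaxMorphism B B' G} {g' : LaxMorphism B B' G'}
    {θ : G ⟶ G'} (h : IsTransformation g g' θ) :
    IsTransformation (f.comp g) (f.comp g') (Functor.whiskerLeft F θ) := fun X => by
  have h₁ := h ((T.map F).obj X)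
  change (compCell f g).app X ≫ _ = _ ≫ (compCell f g').app X
  rw [compCell_app, compCell_app, T.map₂_whiskerLeft]
  simp only [Functor.map_comp, eqToHom_map, Category.assoc, eqToHom_trans_assoc,
    Functor.whiskerLeft_app]
  dsimp only [Functor.comp_obj]
  rw [θ.naturality, reassoc_of% h₁]
  simp

theorem whiskerRight {f : LaxMorphism A B F} {f' : LaxMorphism A B F'} {θ : F ⟶ F'}
    (h : IsTransformation f f' θ) (g : LaxMorphism B B' G) :
    IsTransformation (f.comp g) (f'.comp g) (Functor.whiskerRight θ G) := fun X => by
  have h₁ := congrArg G.map (h X)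
  have h₂ := g.cell.naturality ((T.map₂ θ).app X)
  change (compCell f g).app X ≫ _ = _ ≫ (compCell f' g).app X
  rw [compCell_app, compCell_app, T.map₂_whiskerRight]
  simp only [Functor.map_comp, eqToHom_map, Category.assoc, eqToHom_trans_assoc,
    Functor.whiskerRight_app] at h₁ ⊢
  dsimp only [Functor.comp_obj, Functor.comp_map] at h₁ h₂ ⊢
  rw [h₁, ← reassoc_of% h₂]
  simp

theorem associator (f : LaxMorphism A B F) (g : LaxMorphism B B' G) (h : LaxMorphism B' B'' H) :
    IsTransformation ((f.comp g).comp h) (f.comp (g.comp h)) (Functor.associator F G H).hom :=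
  fun X => by
  have h₁ := app_conj h.cell (Functor.congr_obj (T.map_comp F G) X)
  change (compCell (f.comp g) h).app X ≫ 𝟙 _ =
    B''.act.map ((T.map₂ (𝟙 (F ⋙ G ⋙ H))).app X) ≫ (compCell f (g.comp h)).app X
  rw [T.map₂_id, NatTrans.id_app, CategoryTheory.Functor.map_id]
  refine (Category.comp_id _).trans (Eq.trans ?_ (Category.id_comp _).symm)
  rw [compCell_app, compCell_app]
  change _ ≫ _ ≫ H.map ((compCell f g).app X) = _ ≫ (compCell g h).app _ ≫ _
  rw [compCell_app, compCell_app, h₁]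
  simp only [Functor.map_comp, eqToHom_map, Category.assoc, eqToHom_trans_assoc]
  simp

theorem leftUnitor (f : LaxMorphism A B F) :
    IsTransformation ((LaxMorphism.id A).comp f) f (Functor.leftUnitor F).hom := fun X => by
  have h₁ := app_conj f.cell (Functor.congr_obj (T.map_id C) X)
  change (compCell (LaxMorphism.id A) f).app X ≫ 𝟙 _ =
    B.act.map ((T.map₂ (𝟙 F)).app X) ≫ f.cell.app X
  rw [T.map₂_id, NatTrans.id_app, CategoryTheory.Functor.map_id]
  refine (Category.comp_id _).trans (Eq.trans ?_ (Category.id_comp _).symm)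
  rw [compCell_app, h₁]
  simp [LaxMorphism.id, eqToHom_map]

theorem rightUnitor (f : LaxMorphism A B F) :
    IsTransformation (f.comp (LaxMorphism.id B)) f (Functor.rightUnitor F).hom := fun X => by
  change (compCell f (LaxMorphism.id B)).app X ≫ 𝟙 _ =
    B.act.map ((T.map₂ (𝟙 F)).app X) ≫ f.cell.app X
  rw [T.map₂_id, NatTrans.id_app, CategoryTheory.Functor.map_id]
  refine (Category.comp_id _).trans (Eq.trans ?_ (Category.id_comp _).symm)
  rw [compCell_app]
  simp [LaxMorphism.id, eqToHom_map]

end IsTransformation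

/-- A category together with a pseudoalgebra structure. -/
structure PsAlg (T : TwoMonad.{v, u}) where
  carrier : Cat.{v, u}
  str : PseudoAlgebra T carrier

namespace PsAlg

variable {T : TwoMonad.{v, u}}

structure Hom (A B : PsAlg T) where
  functor : A.carrier ⥤ B.carrier
  lax : LaxMorphism A.str B.str functor

@[ext]
structure Hom₂ {A B : PsAlg T} (f g : Hom A B) where
  natTrans : f.functor ⟶ g.functor
  isTransformation : IsTransformation f.lax g.lax natTrans

instance (A B : PsAlg T) : Category (Hom A B) where
  Hom f g := Hom₂ f g
  id f := ⟨𝟙 f.functor, .id f.lax⟩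
  comp θ τ := ⟨θ.natTrans ≫ τ.natTrans, θ.isTransformation.vcomp τ.isTransformation⟩
  id_comp _ := Hom₂.ext (Category.id_comp _)
  comp_id _ := Hom₂.ext (Category.comp_id _)
  assoc _ _ _ := Hom₂.ext (Category.assoc _ _ _)

def isoMk {A B : PsAlg T} {f g : Hom A B} (e : f.functor ≅ g.functor)
    (h : IsTransformation f.lax g.lax e.hom) : f ≅ g where
  hom := ⟨e.hom, h⟩
  inv := ⟨e.inv, .inv e h⟩
  hom_inv_id := Hom₂.ext e.hom_inv_id
  inv_hom_id := Hom₂.ext e.inv_hom_id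

instance : CategoryStruct (PsAlg T) where
  Hom A B := Hom A B
  id A := ⟨𝟭 A.carrier, LaxMorphism.id A.str⟩
  comp f g := ⟨f.functor ⋙ g.functor, f.lax.comp g.lax⟩

/-- The 2-category of pseudoalgebras, lax morphisms and transformations. -/
instance : Bicategory (PsAlg T) where
  homCategory A B := inferInstanceAs (Category (Hom A B))
  whiskerLeft f _ _ θ := Hom₂.mk (Functor.whiskerLeft f.functor θ.natTrans)
    (.whiskerLeft f.lax θ.isTransformation)
  whiskerRight θ g := Hom₂.mk (Functor.whiskerRight θ.natTrans g.functor)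
    (.whiskerRight θ.isTransformation g.lax)
  associator f g h := isoMk (f := (f ≫ g) ≫ h) (g := f ≫ g ≫ h)
    (Functor.associator f.functor g.functor h.functor) (.associator f.lax g.lax h.lax)
  leftUnitor f := isoMk (f := 𝟙 _ ≫ f) (Functor.leftUnitor f.functor) (.leftUnitor f.lax)
  rightUnitor f := isoMk (f := f ≫ 𝟙 _) (Functor.rightUnitor f.functor) (.rightUnitor f.lax)
  whiskerLeft_id _ _ := Hom₂.ext (Functor.whiskerLeft_id' _)
  whiskerLeft_comp _ _ _ _ _ _ := Hom₂.ext (Functor.whiskerLeft_comp _ _ _)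
  id_whiskerLeft θ := Hom₂.ext (NatTrans.ext (funext fun X =>
    ((Category.id_comp _).trans (Category.comp_id (θ.natTrans.app X))).symm))
  comp_whiskerLeft f g _ _ θ := Hom₂.ext (NatTrans.ext (funext fun X =>
    ((Category.id_comp _).trans
      (Category.comp_id (θ.natTrans.app (g.functor.obj (f.functor.obj X))))).symm))
  id_whiskerRight _ _ := Hom₂.ext (Functor.whiskerRight_id' _)
  comp_whiskerRight _ _ _ := Hom₂.ext (Functor.whiskerRight_comp _ _ _)
  whiskerRight_id θ := Hom₂.ext (NatTrans.ext (funext fun X =>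
    ((Category.id_comp _).trans (Category.comp_id (θ.natTrans.app X))).symm))
  whiskerRight_comp θ g h := Hom₂.ext (NatTrans.ext (funext fun X =>
    ((Category.id_comp _).trans
      (Category.comp_id (h.functor.map (g.functor.map (θ.natTrans.app X))))).symm))
  whisker_assoc f _ _ θ h := Hom₂.ext (NatTrans.ext (funext fun X =>
    ((Category.id_comp _).trans
      (Category.comp_id (h.functor.map (θ.natTrans.app (f.functor.obj X))))).symm))
  whisker_exchange θ τ := Hom₂.ext (NatTrans.ext (funext fun X =>
    (τ.natTrans.naturality (θ.natTrans.app X)).symm))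
  pentagon _ _ _ _ := Hom₂.ext (Functor.pentagon _ _ _ _)
  triangle _ _ := Hom₂.ext (Functor.triangle _ _)

end PsAlg

end Distorted

namespace Distorted

open MonoidalCategory Functor.LaxMonoidal

/-- A distorted monoidal structure on a monoidal category. -/
class DistortedMonoidal (C : Type u) [Category.{v} C] [MonoidalCategory C] where
  unitDistortion : 𝟭 C ⟶ 𝟭 C
  distortion (X Y : C) : X ⊗ Y ⟶ Y ⊗ X
  naturality {X X' Y Y' : C} (f : X ⟶ X') (g : Y ⟶ Y') :
    distortion X Y ≫ (g ⊗ₘ f) = (f ⊗ₘ g) ≫ distortion X' Y'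
  distortion_unit (X : C) : distortion X (𝟙_ C) = (ρ_ X).hom ≫ (λ_ X).inv
  unit_distortion (X : C) : distortion (𝟙_ C) X = (λ_ X).hom ≫ (ρ_ X).inv
  unitDistortion_unit : unitDistortion.app (𝟙_ C) = 𝟙 (𝟙_ C)
  distortion_tensor_left (X Y Z : C) :
    distortion (X ⊗ Y) Z =
      (α_ X Y Z).hom ≫ (𝟙 X ⊗ₘ distortion Y Z) ≫ (α_ X Z Y).inv ≫
        (distortion X Z ⊗ₘ 𝟙 Y) ≫ (α_ Z X Y).hom
  distortion_tensor_right (X Y Z : C) :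
    distortion X (Y ⊗ Z) =
      (α_ X Y Z).inv ≫ (distortion X Y ⊗ₘ 𝟙 Z) ≫ (α_ Y X Z).hom ≫
        (𝟙 Y ⊗ₘ distortion X Z) ≫ (α_ Y Z X).inv
  unitDistortion_tensor (X Y : C) :
    unitDistortion.app (X ⊗ Y) = (unitDistortion.app X ⊗ₘ unitDistortion.app Y)

open DistortedMonoidal

/-- A distorted monoidal category. -/
structure DistMon where
  carrier : Cat.{v, u}
  [monoidal : MonoidalCategory carrier]
  [distorted : DistortedMonoidal carrier]

attribute [instance] DistMon.monoidal DistMon.distorted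

/-- A `σ`-lax monoidal structure on a functor: a lax monoidal structure that is compatible with the
unit distortions and the distortions. -/
@[ext]
structure SigmaLax (M N : DistMon.{v, u}) (F : M.carrier ⥤ N.carrier) where
  lax : F.LaxMonoidal
  map_unitDistortion (Z : M.carrier) :
    F.map ((unitDistortion (C := M.carrier)).app Z) =
      (unitDistortion (C := N.carrier)).app (F.obj Z)
  map_distortion (X Y : M.carrier) :
    μ F X Y ≫ F.map (distortion X Y) = distortion (F.obj X) (F.obj Y) ≫ μ F Y X

/-- A natural transformation between `σ`-lax monoidal functors is monoidal if it commutes with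
`μ` and `ε`. -/
def IsMonoidal {M N : DistMon.{v, u}} {F G : M.carrier ⥤ N.carrier} (φ : SigmaLax M N F)
    (ψ : SigmaLax M N G) (θ : F ⟶ G) : Prop :=
  letI := φ.lax
  letI := ψ.lax
  NatTrans.IsMonoidal θ

namespace SigmaLax

variable {M N P Q : DistMon.{v, u}}

def id (M : DistMon.{v, u}) : SigmaLax M M (𝟭 M.carrier) where
  lax := Functor.LaxMonoidal.id
  map_unitDistortion _ := rfl
  map_distortion _ _ := (Category.id_comp _).trans (Category.comp_id _).symm

def comp {F : M.carrier ⥤ N.carrier} {G : N.carrier ⥤ P.carrier} (φ : SigmaLax M N F)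
    (ψ : SigmaLax N P G) : SigmaLax M P (F ⋙ G) where
  lax := letI := φ.lax; letI := ψ.lax; Functor.LaxMonoidal.comp F G
  map_unitDistortion Z := by
    rw [Functor.comp_map, φ.map_unitDistortion, ψ.map_unitDistortion]; rfl
  map_distortion X Y := by
    let := φ.lax
    let := ψ.lax
    have h := congrArg G.map (φ.map_distortion X Y)
    rw [G.map_comp, G.map_comp] at h
    change (μ G _ _ ≫ G.map (μ F X Y)) ≫ G.map (F.map _) = _ ≫ μ G _ _ ≫ G.map (μ F Y X)
    rw [Category.assoc, h, ← Category.assoc, ψ.map_distortion, Category.assoc]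
    rfl

end SigmaLax

namespace IsMonoidal

variable {M N P Q : DistMon.{v, u}} {F F' F'' : M.carrier ⥤ N.carrier}
  {G G' : N.carrier ⥤ P.carrier} {H : P.carrier ⥤ Q.carrier}

theorem id (φ : SigmaLax M N F) : IsMonoidal φ φ (𝟙 F) :=
  letI := φ.lax; NatTrans.IsMonoidal.id (F₁ := F)

theorem vcomp {φ : SigmaLax M N F} {φ' : SigmaLax M N F'} {φ'' : SigmaLax M N F''}
    {θ : F ⟶ F'} {τ : F' ⟶ F''} (hθ : IsMonoidal φ φ' θ) (hτ : IsMonoidal φ' φ'' τ) :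
    IsMonoidal φ φ'' (θ ≫ τ) :=
  letI := φ.lax; letI := φ'.lax; letI := φ''.lax
  haveI : NatTrans.IsMonoidal θ := hθ
  haveI : NatTrans.IsMonoidal τ := hτ
  NatTrans.IsMonoidal.comp θ τ

theorem inv {φ : SigmaLax M N F} {φ' : SigmaLax M N F'} (e : F ≅ F')
    (h : IsMonoidal φ φ' e.hom) : IsMonoidal φ' φ e.inv :=
  letI := φ.lax; letI := φ'.lax
  haveI : NatTrans.IsMonoidal e.hom := h
  (inferInstance : NatTrans.IsMonoidal e.inv)

theorem whiskerLeft (φ : SigmaLax M N F) {ψ : SigmaLax N P G} {ψ' : SigmaLax N P G'}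
    {θ : G ⟶ G'} (h : IsMonoidal ψ ψ' θ) :
    IsMonoidal (φ.comp ψ) (φ.comp ψ') (Functor.whiskerLeft F θ) :=
  letI := φ.lax; letI := ψ.lax; letI := ψ'.lax
  haveI : NatTrans.IsMonoidal θ := h
  NatTrans.IsMonoidal.whiskerLeft (F₁ := F) θ

theorem whiskerRight {φ : SigmaLax M N F} {φ' : SigmaLax M N F'} {θ : F ⟶ F'}
    (h : IsMonoidal φ φ' θ) (ψ : SigmaLax N P G) :
    IsMonoidal (φ.comp ψ) (φ'.comp ψ) (Functor.whiskerRight θ G) :=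
  letI := φ.lax; letI := φ'.lax; letI := ψ.lax
  haveI : NatTrans.IsMonoidal θ := h
  NatTrans.IsMonoidal.whiskerRight θ (G₁ := G)

theorem associator (φ : SigmaLax M N F) (ψ : SigmaLax N P G) (χ : SigmaLax P Q H) :
    IsMonoidal ((φ.comp ψ).comp χ) (φ.comp (ψ.comp χ)) (Functor.associator F G H).hom :=
  letI := φ.lax; letI := ψ.lax; letI := χ.lax
  (inferInstance : NatTrans.IsMonoidal (Functor.associator F G H).hom)

theorem leftUnitor (φ : SigmaLax M N F) :
    IsMonoidal ((SigmaLax.id M).comp φ) φ (Functor.leftUnitor F).hom :=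
  letI := φ.lax
  (inferInstance : NatTrans.IsMonoidal (Functor.leftUnitor F).hom)

theorem rightUnitor (φ : SigmaLax M N F) :
    IsMonoidal (φ.comp (SigmaLax.id N)) φ (Functor.rightUnitor F).hom :=
  letI := φ.lax
  (inferInstance : NatTrans.IsMonoidal (Functor.rightUnitor F).hom)

end IsMonoidal

namespace DistMon

structure Hom (M N : DistMon.{v, u}) where
  functor : M.carrier ⥤ N.carrier
  lax : SigmaLax M N functor

@[ext]
structure Hom₂ {M N : DistMon.{v, u}} (f g : Hom M N) where
  natTrans : f.functor ⟶ g.functor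
  isMonoidal : IsMonoidal f.lax g.lax natTrans

instance (M N : DistMon.{v, u}) : Category (Hom M N) where
  Hom f g := Hom₂ f g
  id f := ⟨𝟙 f.functor, .id f.lax⟩
  comp θ τ := ⟨θ.natTrans ≫ τ.natTrans, θ.isMonoidal.vcomp τ.isMonoidal⟩
  id_comp _ := Hom₂.ext (Category.id_comp _)
  comp_id _ := Hom₂.ext (Category.comp_id _)
  assoc _ _ _ := Hom₂.ext (Category.assoc _ _ _)

def isoMk {M N : DistMon.{v, u}} {f g : Hom M N} (e : f.functor ≅ g.functor)
    (h : IsMonoidal f.lax g.lax e.hom) : f ≅ g where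
  hom := ⟨e.hom, h⟩
  inv := ⟨e.inv, .inv e h⟩
  hom_inv_id := Hom₂.ext e.hom_inv_id
  inv_hom_id := Hom₂.ext e.inv_hom_id

instance : CategoryStruct DistMon.{v, u} where
  Hom M N := Hom M N
  id M := ⟨𝟭 M.carrier, SigmaLax.id M⟩
  comp f g := ⟨f.functor ⋙ g.functor, f.lax.comp g.lax⟩

/-- The 2-category of distorted monoidal categories, `σ`-lax monoidal functors and monoidal
natural transformations. -/
instance : Bicategory DistMon.{v, u} where
  homCategory M N := inferInstanceAs (Category (Hom M N))
  whiskerLeft f _ _ θ := Hom₂.mk (Functor.whiskerLeft f.functor θ.natTrans)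
    (.whiskerLeft f.lax θ.isMonoidal)
  whiskerRight θ g := Hom₂.mk (Functor.whiskerRight θ.natTrans g.functor)
    (.whiskerRight θ.isMonoidal g.lax)
  associator f g h := isoMk (f := (f ≫ g) ≫ h) (g := f ≫ g ≫ h)
    (Functor.associator f.functor g.functor h.functor) (.associator f.lax g.lax h.lax)
  leftUnitor f := isoMk (f := 𝟙 _ ≫ f) (Functor.leftUnitor f.functor) (.leftUnitor f.lax)
  rightUnitor f := isoMk (f := f ≫ 𝟙 _) (Functor.rightUnitor f.functor) (.rightUnitor f.lax)
  whiskerLeft_id _ _ := Hom₂.ext (Functor.whiskerLeft_id' _)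
  whiskerLeft_comp _ _ _ _ _ _ := Hom₂.ext (Functor.whiskerLeft_comp _ _ _)
  id_whiskerLeft θ := Hom₂.ext (NatTrans.ext (funext fun X =>
    ((Category.id_comp _).trans (Category.comp_id (θ.natTrans.app X))).symm))
  comp_whiskerLeft f g _ _ θ := Hom₂.ext (NatTrans.ext (funext fun X =>
    ((Category.id_comp _).trans
      (Category.comp_id (θ.natTrans.app (g.functor.obj (f.functor.obj X))))).symm))
  id_whiskerRight _ _ := Hom₂.ext (Functor.whiskerRight_id' _)
  comp_whiskerRight _ _ _ := Hom₂.ext (Functor.whiskerRight_comp _ _ _)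
  whiskerRight_id θ := Hom₂.ext (NatTrans.ext (funext fun X =>
    ((Category.id_comp _).trans (Category.comp_id (θ.natTrans.app X))).symm))
  whiskerRight_comp θ g h := Hom₂.ext (NatTrans.ext (funext fun X =>
    ((Category.id_comp _).trans
      (Category.comp_id (h.functor.map (g.functor.map (θ.natTrans.app X))))).symm))
  whisker_assoc f _ _ θ h := Hom₂.ext (NatTrans.ext (funext fun X =>
    ((Category.id_comp _).trans
      (Category.comp_id (h.functor.map (θ.natTrans.app (f.functor.obj X))))).symm))
  whisker_exchange θ τ := Hom₂.ext (NatTrans.ext (funext fun X =>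
    (τ.natTrans.naturality (θ.natTrans.app X)).symm))
  pentagon _ _ _ _ := Hom₂.ext (Functor.pentagon _ _ _ _)
  triangle _ _ := Hom₂.ext (Functor.triangle _ _)

end DistMon

/-- A pseudofunctor is a biequivalence if it is essentially surjective on objects up to
equivalence and an equivalence on all hom-categories. -/
def IsBiequivalence {B : Type u} [Bicategory.{w, v} B] {B' : Type u'} [Bicategory.{w, v'} B']
    (Φ : Pseudofunctor B B') : Prop :=
  (∀ b' : B', ∃ b : B, Nonempty (Bicategory.Equivalence (Φ.obj b) b')) ∧
    ∀ a b : B, (Φ.mapFunctor a b).IsEquivalence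

/-- A 2-functor from distorted monoidal categories to pseudoalgebras that lies over `Cat`: it
does not change underlying categories, functors and natural transformations. -/
structure Correspondence (T : TwoMonad.{v, u}) where
  obj (M : DistMon.{v, u}) : PseudoAlgebra T M.carrier
  map {M N : DistMon.{v, u}} {F : M.carrier ⥤ N.carrier} (φ : SigmaLax M N F) :
    LaxMorphism (obj M) (obj N) F
  map₂ {M N : DistMon.{v, u}} {F G : M.carrier ⥤ N.carrier} {φ : SigmaLax M N F}
    {ψ : SigmaLax M N G} {θ : F ⟶ G} (h : IsMonoidal φ ψ θ) :
    IsTransformation (map φ) (map ψ) θ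
  map_id (M : DistMon.{v, u}) : map (SigmaLax.id M) = LaxMorphism.id (obj M)
  map_comp {M N P : DistMon.{v, u}} {F : M.carrier ⥤ N.carrier} {G : N.carrier ⥤ P.carrier}
    (φ : SigmaLax M N F) (ψ : SigmaLax N P G) : map (φ.comp ψ) = (map φ).comp (map ψ)

def PsAlg.isoOfEq {T : TwoMonad.{v, u}} {A B : PsAlg T} {F : A.carrier ⥤ B.carrier}
    {f g : LaxMorphism A.str B.str F} (h : f = g) : PsAlg.Hom.mk F f ≅ PsAlg.Hom.mk F g :=
  PsAlg.isoMk (Iso.refl F) (h ▸ .id f)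

/-- The underlying pseudofunctor, whose structure isomorphisms are identities. -/
def Correspondence.toPseudofunctor {T : TwoMonad.{v, u}} (Φ : Correspondence T) :
    Pseudofunctor DistMon.{v, u} (PsAlg T) where
  obj M := ⟨M.carrier, Φ.obj M⟩
  map f := ⟨f.functor, Φ.map f.lax⟩
  map₂ θ := PsAlg.Hom₂.mk θ.natTrans (Φ.map₂ θ.isMonoidal)
  map₂_id _ := rfl
  map₂_comp _ _ := rfl
  mapId M := PsAlg.isoOfEq (A := ⟨_, Φ.obj M⟩) (B := ⟨_, Φ.obj M⟩) (Φ.map_id M)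
  mapComp {M _ P} f g := PsAlg.isoOfEq (A := ⟨_, Φ.obj M⟩) (B := ⟨_, Φ.obj P⟩)
    (Φ.map_comp f.lax g.lax)
  map₂_whisker_left f _ _ θ := PsAlg.Hom₂.ext (NatTrans.ext (funext fun X =>
    ((Category.id_comp _).trans (Category.comp_id (θ.natTrans.app (f.functor.obj X)))).symm))
  map₂_whisker_right θ h := PsAlg.Hom₂.ext (NatTrans.ext (funext fun X =>
    ((Category.id_comp _).trans (Category.comp_id (h.functor.map (θ.natTrans.app X)))).symm))
  map₂_associator {_ _ _ Q} f g h := PsAlg.Hom₂.ext (NatTrans.ext (funext fun X => by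
    change 𝟙 _ = 𝟙 _ ≫ h.functor.map (𝟙 _) ≫ 𝟙 _ ≫ 𝟙 _ ≫ 𝟙 _
    simp))
  map₂_left_unitor f := PsAlg.Hom₂.ext (NatTrans.ext (funext fun X => by
    change 𝟙 _ = 𝟙 _ ≫ f.functor.map (𝟙 _) ≫ 𝟙 _
    simp))
  map₂_right_unitor f := PsAlg.Hom₂.ext (NatTrans.ext (funext fun X => by
    change 𝟙 _ = 𝟙 _ ≫ 𝟙 _ ≫ 𝟙 _
    simp))

end Distorted

namespace Distorted

open MonoidalCategory Functor.LaxMonoidal DistortedMonoidal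

namespace Words

variable {C : Type u} [Category.{v} C]

/-- The tensor product of two morphisms of `C`, between words of length two. -/
noncomputable def pair {X X' Y Y' : C} (f : X ⟶ X') (g : Y ⟶ Y') :
    (⟨[X, Y]⟩ : Words C) ⟶ ⟨[X', Y']⟩ :=
  (wrap C).map (Free.tens (Free.ofHom f) (Free.ofHom g))

/-- The operation symbol `σ`, on words of length one. -/
noncomputable def swap (X Y : C) : (⟨[X, Y]⟩ : Words C) ⟶ ⟨[Y, X]⟩ :=
  (wrap C).map (Free.sigma [X] [Y])

/-- The operation symbol `Λ`, on words of length one. -/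
noncomputable def twist (X : C) : (⟨[X]⟩ : Words C) ⟶ ⟨[X]⟩ :=
  (wrap C).map (Free.lam [X])

end Words

namespace PseudoAlgebra

variable {C : Cat.{v, u}} (A : PseudoAlgebra Tσ.{v, u} C)

/-- The unit isomorphism of a pseudoalgebra, at an object. -/
noncomputable def unitIsoApp (X : C) : X ≅ A.act.obj ⟨[X]⟩ := A.unitIso.app X

/-- The multiplication isomorphism, at a word of two words. -/
noncomputable def multIsoApp (a b : List C) :
    A.act.obj ⟨[A.act.obj ⟨a⟩, A.act.obj ⟨b⟩]⟩ ≅ A.act.obj ⟨a ++ b⟩ :=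
  A.multIso.app ⟨[⟨a⟩, ⟨b⟩]⟩ ≪≫ eqToIso (by
    change A.act.obj ⟨a ++ (b ++ [])⟩ = _
    rw [List.append_nil])

end PseudoAlgebra

/-- Specified isomorphisms through which a pseudoalgebra on the underlying category of `M`
interprets the tensor product, the unit object, `σ`, `Λ`, the associator and the unitors by those
of `M`. -/
structure Interpretation (M : DistMon.{v, u}) (A : PseudoAlgebra Tσ.{v, u} M.carrier) where
  tensor (X Y : M.carrier) : A.act.obj ⟨[X, Y]⟩ ≅ X ⊗ Y
  unit : A.act.obj ⟨[]⟩ ≅ 𝟙_ M.carrier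
  tensorHom {X X' Y Y' : M.carrier} (f : X ⟶ X') (g : Y ⟶ Y') :
    A.act.map (Words.pair f g) ≫ (tensor X' Y').hom = (tensor X Y).hom ≫ (f ⊗ₘ g)
  distortion (X Y : M.carrier) :
    A.act.map (Words.swap X Y) ≫ (tensor Y X).hom =
      (tensor X Y).hom ≫ DistortedMonoidal.distortion X Y
  unitDistortion (X : M.carrier) :
    (A.unitIsoApp X).hom ≫ A.act.map (Words.twist X) =
      (DistortedMonoidal.unitDistortion (C := M.carrier)).app X ≫ (A.unitIsoApp X).hom
  associator (X Y Z : M.carrier) :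
    (A.multIsoApp [X, Y] [Z]).inv ≫ (tensor _ _).hom ≫
        ((tensor X Y).hom ⊗ₘ (A.unitIsoApp Z).inv) ≫ (α_ X Y Z).hom =
      (A.multIsoApp [X] [Y, Z]).inv ≫ (tensor _ _).hom ≫
        ((A.unitIsoApp X).inv ⊗ₘ (tensor Y Z).hom)
  leftUnitor (X : M.carrier) :
    (A.multIsoApp [] [X]).inv ≫ (tensor _ _).hom ≫ (unit.hom ⊗ₘ (A.unitIsoApp X).inv) ≫
      (λ_ X).hom = (A.unitIsoApp X).inv
  rightUnitor (X : M.carrier) :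
    (A.multIsoApp [X] []).inv ≫ (tensor _ _).hom ≫ ((A.unitIsoApp X).inv ⊗ₘ unit.hom) ≫
      (ρ_ X).hom = (A.unitIsoApp X).inv

/-- A lax morphism of pseudoalgebras interprets the structure maps `μ` and `ε` of a `σ`-lax
monoidal functor. -/
structure Interprets {M N : DistMon.{v, u}} {A : PseudoAlgebra Tσ.{v, u} M.carrier}
    {B : PseudoAlgebra Tσ.{v, u} N.carrier} (I : Interpretation M A) (J : Interpretation N B)
    {F : M.carrier ⥤ N.carrier} (φ : SigmaLax M N F) (f : LaxMorphism A B F) : Prop where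
  tensor (X Y : M.carrier) :
    (J.tensor (F.obj X) (F.obj Y)).hom ≫ φ.lax.μ X Y =
      f.cell.app ⟨[X, Y]⟩ ≫ F.map (I.tensor X Y).hom
  unit : J.unit.hom ≫ φ.lax.ε = f.cell.app ⟨[]⟩ ≫ F.map I.unit.hom

end Distorted

/-! Everything rests on one rigidity principle for functors out of words. Let `G : Words C ⥤ V` go
to a distorted monoidal category and carry maps `G a ⊗ G b ⟶ G (a ++ b)` and `𝟙_ V ⟶ G []`
compatible with concatenation, `σ` and `Λ` (a `WordLax` structure, strong if these maps are
invertible). Call a family `G a ⟶ H a` multiplicative if it commutes with such structures. Words are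
concatenations of letters, and their morphisms are generated by those of `C`, `σ` and `Λ` under
composition and tensor product. So if the structure on `G` is strong, a multiplicative family is
determined by its values on words of length one (`WordLax.IsMultiplicative.unique`), is natural as
soon as it is natural there (`WordLax.IsMultiplicative.naturality`), and can be prescribed there
freely (`WordLax.isMultiplicative_extendApp`).

On objects, a distorted monoidal category evaluates words as right-bracketed tensor products;
`Evaluation.term_rel` says that this respects all relations between terms, and the resulting action
is strong. Its multiplication cell is the multiplicative extension of the only values on letters
that the left unit axiom allows. The right unit and associativity axioms each compare two
multiplicative families, so they need checking only on words of length one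
(`PseudoAlgebra.ofAction`).

On morphisms, a `σ`-lax structure on `F` makes both `b ∘ T F` and `F ∘ a` lax on words, and the cell
of the lax morphism is the multiplicative extension of the values which the unit axiom forces on
letters (`Model.toLax`). By uniqueness the assignment strictly preserves identities and composites,
and it carries monoidal transformations to transformations. Conversely the cell of a lax morphism at
`[X, Y]` and `[]` yields candidates for `μ` and `ε`. The multiplication axiom at a word of two words
says that the cell is multiplicative for them, and the monoidal axioms for `F` follow from those on
words after cancelling invertible maps (`WordLax.Transport`). Uniqueness makes the two passages
mutually inverse.

For essential surjectivity, a pseudoalgebra defines `X ⊗ Y` as `a[X, Y]` and the unit as `a[]`. Its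
multiplication gives invertible maps `a(u) ⊗ a(v) ≅ a(u ++ v)`; associator and unitors are defined
so that these are coherent. Pentagon, triangle and hexagons then become equations between morphisms
of words, where they hold strictly (`WordFrame`). The pseudoalgebra and the one rebuilt from its
distorted monoidal category are both a `Model` of that category, and any two models of one category
are equivalent through the identity functor. -/

namespace Distorted

/-! ### Strict monoidal calculus in `Words C`, and strict functors between words -/

namespace Words

variable {C : Type u} [Category.{v} C] {D : Type u'} [Category.{v'} D]
  {E : Type u''} [Category.{v''} E]

/-- The empty word. -/
abbrev nil : Words C := ⟨[]⟩

/-- The word of length one. -/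
abbrev single (X : C) : Words C := ⟨[X]⟩

/-- Concatenation of words. -/
abbrev append (a b : Words C) : Words C := ⟨a.toList ++ b.toList⟩

omit [Category.{v} C] in
theorem append_assoc (a b c : Words C) : append (append a b) c = append a (append b c) :=
  congrArg mk (List.append_assoc _ _ _)

omit [Category.{v} C] in
theorem append_nil (a : Words C) : append a nil = a :=
  congrArg mk (List.append_nil _)

/-- The tensor product of morphisms of words. -/
noncomputable def tens {a b c d : Words C} (f : a ⟶ b) (g : c ⟶ d) : append a c ⟶ append b d :=
  (wrap C).map (Free.tens ((unwrap C).map f) ((unwrap C).map g))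

/-- The distortion of words. -/
noncomputable def sigma (a b : Words C) : append a b ⟶ append b a :=
  (wrap C).map (Free.sigma a.toList b.toList)

/-- The unit distortion of words. -/
noncomputable def lam (a : Words C) : a ⟶ a := (wrap C).map (Free.lam a.toList)

theorem wrap_map_eqToHom {a b : List C} (h : a = b) :
    (wrap C).map (eqToHom (h : (a : Free C) = b)) =
      eqToHom (congrArg mk h : (⟨a⟩ : Words C) = ⟨b⟩) := by
  subst h; exact (wrap C).map_id _

theorem tens_id (a b : Words C) : tens (𝟙 a) (𝟙 b) = 𝟙 (append a b) := by
  unfold tens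
  rw [CategoryTheory.Functor.map_id, CategoryTheory.Functor.map_id]
  exact (congrArg (wrap C).map (Free.tens_id a.toList b.toList)).trans ((wrap C).map_id _)

theorem tens_comp {a b c a' b' c' : Words C} (f : a ⟶ b) (g : b ⟶ c) (f' : a' ⟶ b')
    (g' : b' ⟶ c') : tens (f ≫ g) (f' ≫ g') = tens f f' ≫ tens g g' := by
  unfold tens
  rw [Functor.map_comp, Functor.map_comp]
  exact (congrArg (wrap C).map (Free.tens_comp _ _ _ _)).trans ((wrap C).map_comp _ _)

theorem tens_eqToHom {a b c d : Words C} (h : a = b) (k : c = d) :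
    tens (eqToHom h) (eqToHom k) = eqToHom (congrArg₂ append h k) := by
  subst h k; exact tens_id _ _

theorem tens_id_eqToHom (a : Words C) {c d : Words C} (k : c = d) :
    tens (𝟙 a) (eqToHom k) = eqToHom (congrArg (append a) k) := by
  subst k; exact tens_id _ _

theorem tens_eqToHom_id {a b : Words C} (h : a = b) (c : Words C) :
    tens (eqToHom h) (𝟙 c) = eqToHom (congrArg (fun a => append a c) h) := by
  subst h; exact tens_id _ _

theorem sigma_congr {a b a' b' : Words C} (ha : a = a') (hb : b = b') :
    sigma a b = eqToHom (congrArg₂ append ha hb) ≫ sigma a' b' ≫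
      eqToHom (congrArg₂ append hb.symm ha.symm) := by
  subst ha hb; simp

theorem lam_congr {a a' : Words C} (ha : a = a') :
    lam a = eqToHom ha ≫ lam a' ≫ eqToHom ha.symm := by
  subst ha; simp

theorem tens_naturality_sigma {a b a' b' : Words C} (f : a ⟶ a') (g : b ⟶ b') :
    tens f g ≫ sigma a' b' = sigma a b ≫ tens g f := by
  exact ((wrap C).map_comp _ _).symm.trans
    ((congrArg (wrap C).map (Free.sigma_naturality _ _)).trans ((wrap C).map_comp _ _))

theorem sigma_nil (a : Words C) : sigma a nil = eqToHom (append_nil a) := by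
  unfold sigma
  rw [Free.sigma_nil, wrap_map_eqToHom]

theorem nil_sigma (a : Words C) : sigma nil a = eqToHom (append_nil a).symm := by
  unfold sigma
  rw [Free.nil_sigma, wrap_map_eqToHom]

theorem wrap_map_tens {a b c d : List C} (f : (a : Free C) ⟶ b) (g : (c : Free C) ⟶ d) :
    (wrap C).map (Free.tens f g) = tens ((wrap C).map f) ((wrap C).map g) := by
  unfold tens
  rw [unwrap_map_wrap_map, unwrap_map_wrap_map]
  rfl

theorem wrap_map_tens_id {a b : List C} (f : (a : Free C) ⟶ b) (c : List C) :
    (wrap C).map (Free.tens f (𝟙 (c : Free C))) = tens ((wrap C).map f) (𝟙 ⟨c⟩) := by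
  rw [wrap_map_tens]; congr 1

theorem wrap_map_id_tens (c : List C) {a b : List C} (f : (a : Free C) ⟶ b) :
    (wrap C).map (Free.tens (𝟙 (c : Free C)) f) = tens (𝟙 ⟨c⟩) ((wrap C).map f) := by
  rw [wrap_map_tens]; congr 1

theorem sigma_append_left (a b c : Words C) :
    sigma (append a b) c =
      eqToHom (append_assoc a b c) ≫ tens (𝟙 a) (sigma b c) ≫
        eqToHom (append_assoc a c b).symm ≫ tens (sigma a c) (𝟙 b) ≫
          eqToHom (append_assoc c a b) := by
  refine (congrArg (wrap C).map (Free.sigma_append_left a.toList b.toList c.toList)).trans ?_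
  rw [Functor.map_comp, Functor.map_comp, Functor.map_comp, Functor.map_comp, wrap_map_eqToHom,
    wrap_map_eqToHom, wrap_map_eqToHom, wrap_map_tens_id, wrap_map_id_tens]
  rfl

theorem sigma_append_right (a b c : Words C) :
    sigma a (append b c) =
      eqToHom (append_assoc a b c).symm ≫ tens (sigma a b) (𝟙 c) ≫
        eqToHom (append_assoc b a c) ≫ tens (𝟙 b) (sigma a c) ≫
          eqToHom (append_assoc b c a).symm := by
  refine (congrArg (wrap C).map (Free.sigma_append_right a.toList b.toList c.toList)).trans ?_
  rw [Functor.map_comp, Functor.map_comp, Functor.map_comp, Functor.map_comp, wrap_map_eqToHom,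
    wrap_map_eqToHom, wrap_map_eqToHom, wrap_map_tens_id, wrap_map_id_tens]
  rfl

theorem lam_nil : lam (nil : Words C) = 𝟙 _ :=
  (congrArg (wrap C).map Free.lam_nil).trans ((wrap C).map_id _)

theorem lam_naturality {a b : Words C} (f : a ⟶ b) : f ≫ lam b = lam a ≫ f := by
  have h := congrArg (wrap C).map (Free.lam_naturality ((unwrap C).map f))
  rw [Functor.map_comp, wrap_map_unwrap_map] at h
  exact h.trans (((wrap C).map_comp _ _).trans
    (congrArg (fun z => lam a ≫ z) (wrap_map_unwrap_map f)))

theorem lam_append (a b : Words C) : lam (append a b) = tens (lam a) (lam b) := by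
  exact (congrArg (wrap C).map (Free.lam_append _ _)).trans (wrap_map_tens _ _)

/-- Every morphism of words is the `wrap`-image of a morphism of `Free C`, so the induction over
terms carries over and the shrinking of the hom-sets stays hidden. -/
theorem hom_induction {motive : ∀ {a b : Words C}, (a ⟶ b) → Prop}
    (id : ∀ a : Words C, motive (𝟙 a))
    (comp : ∀ {a b c : Words C} (f : a ⟶ b) (g : b ⟶ c), motive f → motive g → motive (f ≫ g))
    (tens : ∀ {a b c d : Words C} (f : a ⟶ b) (g : c ⟶ d), motive f → motive g →
      motive (tens f g))
    (of : ∀ {X Y : C} (f : X ⟶ Y), motive ((of C).map f))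
    (sigma : ∀ a b : Words C, motive (sigma a b))
    (lam : ∀ a : Words C, motive (lam a))
    {a b : Words C} (f : a ⟶ b) : motive f := by
  rw [← wrap_map_unwrap_map f]
  generalize (unwrap C).map f = g
  change (a.toList : Free C) ⟶ b.toList at g
  -- The induction changes the endpoints, so they are generalized from `a.toList` and `b.toList` to
  -- arbitrary lists.
  have key : ∀ {a b : List C} (g : (a : Free C) ⟶ b), motive ((wrap C).map g) := by
    intro a b g
    induction g using Free.hom_induction with
    | id a => exact (congrArg motive ((wrap C).map_id (a : Free C))).mpr (id ⟨a⟩)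
    | comp f g hf hg =>
      rw [Functor.map_comp]; exact comp _ _ hf hg
    | tens f g hf hg => rw [wrap_map_tens]; exact tens _ _ hf hg
    | ofHom f => exact of f
    | sigma a b => exact sigma ⟨a⟩ ⟨b⟩
    | lam a => exact lam ⟨a⟩
  exact key g

/-- A functor between categories of words that strictly preserves the distorted monoidal
structure. -/
structure IsStrict (P : Words C ⥤ Words D) : Prop where
  nil : P.obj nil = nil
  append (a b : Words C) : P.obj (append a b) = append (P.obj a) (P.obj b)
  tens {a b c d : Words C} (f : a ⟶ b) (g : c ⟶ d) :
    P.map (tens f g) = eqToHom (append a c) ≫ Words.tens (P.map f) (P.map g) ≫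
      eqToHom (append b d).symm
  sigma (a b : Words C) :
    P.map (sigma a b) = eqToHom (append a b) ≫ Words.sigma (P.obj a) (P.obj b) ≫
      eqToHom (append b a).symm
  lam (a : Words C) : P.map (lam a) = Words.lam (P.obj a)

theorem ext_map_wrap_map (K : C ⥤ Words D) {a b : List C} (f : (a : Free C) ⟶ b) :
    (ext K).map ((wrap C).map f) = (wrap D).map (Free.liftMap (K ⋙ unwrap D) f) :=
  congrArg (fun z => (wrap D).map (Free.liftMap (K ⋙ unwrap D) z)) (unwrap_map_wrap_map f)

/-- `Free.liftMap` is defined by recursion on terms and sends each operation to itself, up to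
transport. Since `map F` and `mult` are both of the form `ext K`, this covers every functor that
occurs in the axioms of pseudoalgebras and lax morphisms. -/
theorem IsStrict.ext (K : C ⥤ Words D) : IsStrict (ext K) where
  nil := rfl
  append a b := congrArg Words.mk (Free.liftObj_append (K ⋙ unwrap D).obj a.toList b.toList)
  tens {a b c d} f g := by
    refine (ext_map_wrap_map K _).trans ?_
    refine (congrArg (wrap D).map (Free.liftMap_tens _ _ _)).trans ?_
    rw [Functor.map_comp, Functor.map_comp, wrap_map_eqToHom, wrap_map_eqToHom, wrap_map_tens]
    rfl
  sigma a b := by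
    refine (ext_map_wrap_map K _).trans ?_
    refine (congrArg (wrap D).map (Free.liftMap_sigma _ _ _)).trans ?_
    rw [Functor.map_comp, Functor.map_comp, wrap_map_eqToHom, wrap_map_eqToHom]
    rfl
  lam a := by
    exact ext_map_wrap_map K _

theorem IsStrict.map (F : C ⥤ D) : IsStrict (map F) := .ext _

theorem IsStrict.mult : IsStrict (mult C) := .ext _

theorem IsStrict.comp {P : Words C ⥤ Words D} {Q : Words D ⥤ Words E} (hP : IsStrict P)
    (hQ : IsStrict Q) : IsStrict (P ⋙ Q) where
  nil := (congrArg Q.obj hP.nil).trans hQ.nil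
  append a b := (congrArg Q.obj (hP.append a b)).trans (hQ.append _ _)
  tens f g := by
    rw [Functor.comp_map, hP.tens, Functor.map_comp, Functor.map_comp, hQ.tens, eqToHom_map,
      eqToHom_map]
    simp
  sigma a b := by
    rw [Functor.comp_map, hP.sigma, Functor.map_comp, Functor.map_comp, hQ.sigma, eqToHom_map,
      eqToHom_map]
    simp
  lam a := by rw [Functor.comp_map, hP.lam, hQ.lam]; rfl

/-- With `ext₂_nil`, this is what makes the action of `T` on 2-cells multiplicative; see
`WordLax.isMultiplicative_ext₂`. -/
theorem ext₂_append {K K' : C ⥤ Words D} (θ : K ⟶ K') (a b : Words C) :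
    (ext₂ θ).app (append a b) = eqToHom ((IsStrict.ext K).append a b) ≫
      tens ((ext₂ θ).app a) ((ext₂ θ).app b) ≫ eqToHom ((IsStrict.ext K').append a b).symm := by
  have h := congrArg (wrap D).map
    (Free.lift₂App_append (Functor.whiskerRight θ (unwrap D)) a.toList b.toList)
  refine h.trans ?_
  rw [Functor.map_comp, Functor.map_comp, wrap_map_eqToHom, wrap_map_eqToHom, wrap_map_tens]
  rfl

theorem ext₂_nil {K K' : C ⥤ Words D} (θ : K ⟶ K') : (ext₂ θ).app nil = 𝟙 nil :=
  (wrap D).map_id _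

theorem map₂_single {F G : C ⥤ D} (θ : F ⟶ G) (X : C) :
    (map₂ θ).app (single X) = (of D).map (θ.app X) := by
  have h := ext₂_of_app (Functor.whiskerRight θ (of D)) X
  exact h.trans (conj_rfl_words _)
where
  conj_rfl_words {a b : Words D} (f : a ⟶ b) {h : a = a} {k : b = b} :
    eqToHom h ≫ f ≫ eqToHom k = f := by simp

theorem pair_eq_tens {X X' Y Y' : C} (f : X ⟶ X') (g : Y ⟶ Y') :
    pair f g = tens ((of C).map f) ((of C).map g) := wrap_map_tens _ _

end Words

end Distorted

/-! ### Lax structures on functors out of words, and multiplicative families -/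

namespace Distorted

open MonoidalCategory DistortedMonoidal

variable {C : Type u} [Category.{v} C] {D : Type u'} [Category.{v'} D]
  {V : Type u''} [Category.{v''} V] [MonoidalCategory V] [DistortedMonoidal V]

/-- A lax distorted monoidal structure on a functor out of a category of words. -/
@[ext]
structure WordLax (G : Words C ⥤ V) where
  μ (a b : Words C) : G.obj a ⊗ G.obj b ⟶ G.obj (.append a b)
  ε : 𝟙_ V ⟶ G.obj .nil
  μ_natural {a b c d : Words C} (f : a ⟶ b) (g : c ⟶ d) :
    (G.map f ⊗ₘ G.map g) ≫ μ b d = μ a c ≫ G.map (Words.tens f g)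
  associativity (a b c : Words C) :
    (μ a b ⊗ₘ 𝟙 _) ≫ μ (.append a b) c ≫ G.map (eqToHom (Words.append_assoc a b c)) =
      (α_ _ _ _).hom ≫ (𝟙 _ ⊗ₘ μ b c) ≫ μ a (.append b c)
  left_unitality (a : Words C) : (ε ⊗ₘ 𝟙 _) ≫ μ .nil a = (λ_ (G.obj a)).hom
  right_unitality (a : Words C) :
    (𝟙 _ ⊗ₘ ε) ≫ μ a .nil ≫ G.map (eqToHom (Words.append_nil a)) = (ρ_ (G.obj a)).hom
  map_sigma (a b : Words C) : μ a b ≫ G.map (Words.sigma a b) = distortion _ _ ≫ μ b a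
  map_lam (a : Words C) :
    G.map (Words.lam a) = (unitDistortion (C := V)).app (G.obj a)

namespace WordLax

variable {G H K : Words C ⥤ V}

/-- The structure maps are invertible. -/
class IsStrong (p : WordLax G) : Prop where
  μ_isIso (a b : Words C) : IsIso (p.μ a b)
  ε_isIso : IsIso p.ε

attribute [instance] IsStrong.μ_isIso IsStrong.ε_isIso

section Pairing

variable (p : WordLax G) {X X' Y Y' Z : V} {a a' b b' c : Words C}

/-- The morphism from a tensor product to the value at a concatenation which is induced by two
morphisms to values at words. -/
def pairing (e : X ⟶ G.obj a) (f : Y ⟶ G.obj b) : X ⊗ Y ⟶ G.obj (.append a b) :=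
  (e ⊗ₘ f) ≫ p.μ a b

theorem tensor_pairing (h : X' ⟶ X) (k : Y' ⟶ Y) (e : X ⟶ G.obj a) (f : Y ⟶ G.obj b) :
    (h ⊗ₘ k) ≫ p.pairing e f = p.pairing (h ≫ e) (k ≫ f) := by
  simp [pairing]

theorem pairing_map (e : X ⟶ G.obj a) (f : Y ⟶ G.obj b) (u : a ⟶ a') (v : b ⟶ b') :
    p.pairing (e ≫ G.map u) (f ≫ G.map v) = p.pairing e f ≫ G.map (Words.tens u v) := by
  rw [pairing, ← tensorHom_comp_tensorHom, Category.assoc, p.μ_natural, pairing, Category.assoc]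

theorem pairing_map_left (e : X ⟶ G.obj a) (f : Y ⟶ G.obj b) (u : a ⟶ a') :
    p.pairing (e ≫ G.map u) f = p.pairing e f ≫ G.map (Words.tens u (𝟙 b)) := by
  rw [← pairing_map, CategoryTheory.Functor.map_id, Category.comp_id]

theorem pairing_map_right (e : X ⟶ G.obj a) (f : Y ⟶ G.obj b) (v : b ⟶ b') :
    p.pairing e (f ≫ G.map v) = p.pairing e f ≫ G.map (Words.tens (𝟙 a) v) := by
  rw [← pairing_map, CategoryTheory.Functor.map_id, Category.comp_id]

/-- The pairing rules turn coherence in `V` into computation with words: a structure map of `V` in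
front of a pairing is traded for the corresponding strict map behind it. Here the associator becomes
a mere transport. -/
theorem associator_pairing (e : X ⟶ G.obj a) (f : Y ⟶ G.obj b) (g : Z ⟶ G.obj c) :
    (α_ X Y Z).hom ≫ p.pairing e (p.pairing f g) =
      p.pairing (p.pairing e f) g ≫ G.map (eqToHom (Words.append_assoc a b c)) := by
  have h₁ : p.pairing e (p.pairing f g) =
      (e ⊗ₘ (f ⊗ₘ g)) ≫ (𝟙 _ ⊗ₘ p.μ b c) ≫ p.μ a (.append b c) := by
    rw [tensorHom_comp_tensorHom_assoc, Category.comp_id]; rfl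
  have h₂ : p.pairing (p.pairing e f) g =
      ((e ⊗ₘ f) ⊗ₘ g) ≫ (p.μ a b ⊗ₘ 𝟙 _) ≫ p.μ (.append a b) c := by
    rw [tensorHom_comp_tensorHom_assoc, Category.comp_id]; rfl
  rw [h₁, h₂, Category.assoc, Category.assoc, p.associativity, associator_naturality_assoc]

theorem leftUnitor_pairing (e : X ⟶ G.obj a) : (λ_ X).hom ≫ e = p.pairing p.ε e := by
  have h : p.pairing p.ε e = (𝟙 _ ⊗ₘ e) ≫ (p.ε ⊗ₘ 𝟙 _) ≫ p.μ .nil a := by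
    rw [tensorHom_comp_tensorHom_assoc, Category.comp_id, Category.id_comp]; rfl
  rw [h, p.left_unitality, id_tensorHom]
  exact (leftUnitor_naturality e).symm

theorem rightUnitor_pairing (e : X ⟶ G.obj a) :
    (ρ_ X).hom ≫ e = p.pairing e p.ε ≫ G.map (eqToHom (Words.append_nil a)) := by
  have h : p.pairing e p.ε = (e ⊗ₘ 𝟙 _) ≫ (𝟙 _ ⊗ₘ p.ε) ≫ p.μ a .nil := by
    rw [tensorHom_comp_tensorHom_assoc, Category.comp_id, Category.id_comp]; rfl
  rw [h, Category.assoc, Category.assoc, p.right_unitality, tensorHom_id, rightUnitor_naturality]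

theorem distortion_pairing (e : X ⟶ G.obj a) (f : Y ⟶ G.obj b) :
    distortion X Y ≫ p.pairing f e = p.pairing e f ≫ G.map (Words.sigma a b) := by
  rw [pairing, pairing, Category.assoc, p.map_sigma, ← Category.assoc,
    DistortedMonoidal.naturality, Category.assoc]

include p in
theorem unitDistortion_pairing (e : X ⟶ G.obj a) :
    (unitDistortion (C := V)).app X ≫ e = e ≫ G.map (Words.lam a) := by
  rw [p.map_lam]
  exact (unitDistortion.naturality e).symm

instance [p.IsStrong] (e : X ⟶ G.obj a) (f : Y ⟶ G.obj b) [IsIso e] [IsIso f] :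
    IsIso (p.pairing e f) := by
  unfold pairing; infer_instance

end Pairing

/-- A family of morphisms that commutes with the structure maps. -/
structure IsMultiplicative (p : WordLax G) (q : WordLax H) (θ : ∀ a, G.obj a ⟶ H.obj a) :
    Prop where
  unit : p.ε ≫ θ .nil = q.ε
  tensor (a b : Words C) : p.μ a b ≫ θ (.append a b) = (θ a ⊗ₘ θ b) ≫ q.μ a b

-- Naturality along an equality is automatic. Multiplicative families can therefore be handled
-- without assuming them natural, which matters because naturality is deduced later from
-- multiplicativity.
omit [MonoidalCategory V] [DistortedMonoidal V] in
theorem app_eqToHom (θ : ∀ a, G.obj a ⟶ H.obj a) {a b : Words C} (h : a = b) :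
    G.map (eqToHom h) ≫ θ b = θ a ≫ H.map (eqToHom h) := by
  subst h; simp

namespace IsMultiplicative

variable {p : WordLax G} {q : WordLax H} {r : WordLax K} {θ θ' : ∀ a, G.obj a ⟶ H.obj a}

theorem pairing (h : IsMultiplicative p q θ) {X Y : V} {a b : Words C} (e : X ⟶ G.obj a)
    (f : Y ⟶ G.obj b) : p.pairing e f ≫ θ (.append a b) = q.pairing (e ≫ θ a) (f ≫ θ b) := by
  rw [WordLax.pairing, Category.assoc, h.tensor, tensorHom_comp_tensorHom_assoc]
  rfl

theorem id (p : WordLax G) : IsMultiplicative p p (fun _ => 𝟙 _) := by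
  constructor <;> simp

theorem comp (h : IsMultiplicative p q θ) {τ : ∀ a, H.obj a ⟶ K.obj a}
    (k : IsMultiplicative q r τ) : IsMultiplicative p r (fun a => θ a ≫ τ a) where
  unit := by rw [reassoc_of% h.unit, k.unit]
  tensor a b := by
    rw [reassoc_of% h.tensor, k.tensor, tensorHom_comp_tensorHom_assoc]

/-- Multiplicative families are determined by their components at words of length one. -/
theorem unique [p.IsStrong] (h : IsMultiplicative p q θ) (k : IsMultiplicative p q θ')
    (hk : ∀ X : C, θ (.single X) = θ' (.single X)) (a : Words C) : θ a = θ' a := by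
  obtain ⟨a⟩ := a
  induction a with
  | nil => rw [← cancel_epi p.ε, h.unit, k.unit]
  | cons X a ih =>
    -- The concatenation of `[X]` and `a` is `X :: a` by computation, so these laws speak about the
    -- two components being compared.
    have h₁ := h.tensor (.single X) ⟨a⟩
    have h₂ := k.tensor (.single X) ⟨a⟩
    rw [hk, ih, ← h₂] at h₁
    exact (cancel_epi _).mp h₁

/-- A multiplicative family which is natural on words of length one is natural. -/
theorem naturality [p.IsStrong] (h : IsMultiplicative p q θ)
    (hθ : ∀ {X Y : C} (f : X ⟶ Y), G.map ((Words.of C).map f) ≫ θ (.single Y) =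
      θ (.single X) ≫ H.map ((Words.of C).map f))
    {a b : Words C} (f : a ⟶ b) : G.map f ≫ θ b = θ a ≫ H.map f := by
  induction f using Words.hom_induction with
  | id a => simp
  | comp f g hf hg => simp [hg, reassoc_of% hf]
  | @tens a b c d f g hf hg =>
    rw [← cancel_epi (p.μ a c), reassoc_of% h.tensor, ← q.μ_natural, ← reassoc_of% p.μ_natural,
      h.tensor, tensorHom_comp_tensorHom_assoc, tensorHom_comp_tensorHom_assoc, hf, hg]
  | of f => exact hθ f
  | sigma a b =>
    rw [← cancel_epi (p.μ a b), reassoc_of% h.tensor, q.map_sigma, reassoc_of% p.map_sigma,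
      h.tensor, ← Category.assoc, DistortedMonoidal.naturality, Category.assoc]
  | lam a =>
    rw [p.map_lam, q.map_lam]
    exact (unitDistortion.naturality _).symm

end IsMultiplicative

section Extension

variable (p : WordLax G) (q : WordLax H) [p.IsStrong]
  (θ : ∀ X : C, G.obj (.single X) ⟶ H.obj (.single X))

/-- The extension of a family of morphisms from words of length one to all words. -/
noncomputable def extendApp : ∀ a : List C, G.obj ⟨a⟩ ⟶ H.obj ⟨a⟩
  | [] => inv p.ε ≫ q.ε
  | X :: a => inv (p.μ (.single X) ⟨a⟩) ≫ (θ X ⊗ₘ extendApp a) ≫ q.μ (.single X) ⟨a⟩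

theorem μ_extendApp_cons (X : C) (a : List C) :
    p.μ (.single X) ⟨a⟩ ≫ extendApp p q θ (X :: a) =
      (θ X ⊗ₘ extendApp p q θ a) ≫ q.μ (.single X) ⟨a⟩ :=
  IsIso.hom_inv_id_assoc _ _

/-- By construction the value at `[X]` is `θ X` tensored with the value at `[]`. The right unit laws
of `p` and `q` remove the second factor. -/
theorem extendApp_single (X : C) : extendApp p q θ [X] = θ X := by
  have hp := p.right_unitality (.single X)
  have hq := q.right_unitality (.single X)
  -- `[X] ++ []` computes to `[X]`, so the transport in both unit laws is an identity.
  rw [eqToHom_refl, CategoryTheory.Functor.map_id, Category.comp_id] at hp hq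
  have h := μ_extendApp_cons p q θ X []
  have hε : p.ε ≫ extendApp p q θ [] = q.ε := IsIso.hom_inv_id_assoc _ _
  rw [← cancel_epi (ρ_ (G.obj (.single X))).hom, ← hp, Category.assoc]
  refine (congrArg (fun z => (𝟙 _ ⊗ₘ p.ε) ≫ z) h).trans ?_
  rw [tensorHom_comp_tensorHom_assoc, hε, Category.id_comp, hp]
  refine Eq.trans ?_ (rightUnitor_naturality (θ X))
  rw [← hq, ← tensorHom_id, tensorHom_comp_tensorHom_assoc, Category.comp_id, Category.id_comp]

/-- `extendApp` peels off the first letter, so multiplicativity for a first factor `X :: a` reduces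
to that for `a` by associativity of `p` and `q` at `[X]`, `a`, `b`. The empty first factor is the
left unit law. -/
theorem isMultiplicative_extendApp :
    IsMultiplicative p q (fun a => extendApp p q θ a.toList) where
  unit := IsIso.hom_inv_id_assoc _ _
  tensor := by
    rintro ⟨a⟩ ⟨b⟩
    have hε : p.ε ≫ extendApp p q θ [] = q.ε := IsIso.hom_inv_id_assoc _ _
    induction a with
    | nil =>
      rw [← cancel_epi (p.ε ⊗ₘ 𝟙 _), reassoc_of% p.left_unitality, tensorHom_comp_tensorHom_assoc,
        hε, Category.id_comp]
      exact q.leftUnitor_pairing _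
    | cons X a ih =>
      have hp := p.associativity (.single X) ⟨a⟩ ⟨b⟩
      have hq := q.associator_pairing (θ X) (extendApp p q θ a) (extendApp p q θ b)
      rw [eqToHom_refl, CategoryTheory.Functor.map_id, Category.comp_id] at hp hq
      rw [← cancel_epi (p.μ (.single X) ⟨a⟩ ⊗ₘ 𝟙 _)]
      refine (Category.assoc _ _ _).symm.trans ?_
      refine (congrArg (fun z => z ≫ _) hp).trans ?_
      simp only [Category.assoc]
      have h₁ : p.μ (.single X) (.append ⟨a⟩ ⟨b⟩) ≫ extendApp p q θ (X :: (a ++ b)) = _ :=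
        μ_extendApp_cons p q θ X (a ++ b)
      refine (congrArg (fun z => _ ≫ _ ≫ z) h₁).trans ?_
      rw [tensorHom_comp_tensorHom_assoc, ih, Category.id_comp]
      refine hq.trans ?_
      rw [tensorHom_comp_tensorHom_assoc, μ_extendApp_cons, Category.id_comp]
      rfl

/-- The natural transformation which extends a transformation on words of length one. -/
noncomputable def extend (hθ : ∀ {X Y : C} (f : X ⟶ Y),
    G.map ((Words.of C).map f) ≫ θ Y = θ X ≫ H.map ((Words.of C).map f)) : G ⟶ H where
  app a := extendApp p q θ a.toList
  naturality _ _ f := (isMultiplicative_extendApp p q θ).naturality (fun f => by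
    rw [extendApp_single, extendApp_single, hθ]) f

instance isIso_extendApp [q.IsStrong] [∀ X, IsIso (θ X)] (a : List C) :
    IsIso (extendApp p q θ a) := by
  induction a with
  | nil => unfold extendApp; infer_instance
  | cons X a ih => unfold extendApp; infer_instance

end Extension

end WordLax

end Distorted

/-! ### Restriction along strict functors, and composition with `σ`-lax functors -/

namespace Distorted

open MonoidalCategory DistortedMonoidal

namespace WordLax

section Precomp

variable {B : Type w} [Category.{v} B] {C : Type u} [Category.{v} C] {D : Type u'} [Category.{v'} D]
  {V : Type u''} [Category.{v''} V] [MonoidalCategory V] [DistortedMonoidal V]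
  {G H : Words D ⥤ V} {P Q : Words C ⥤ Words D}

/-- Restriction along a strict functor. -/
noncomputable def precomp (p : WordLax G) (hP : Words.IsStrict P) : WordLax (P ⋙ G) where
  μ a b := p.μ (P.obj a) (P.obj b) ≫ G.map (eqToHom (hP.append a b).symm)
  ε := p.ε ≫ G.map (eqToHom hP.nil.symm)
  μ_natural f g := by
    change (G.map (P.map f) ⊗ₘ G.map (P.map g)) ≫ _ = _ ≫ G.map (P.map _)
    rw [reassoc_of% p.μ_natural, hP.tens, Category.assoc, ← G.map_comp, ← G.map_comp]
    simp
  associativity a b c := by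
    change (_ ⊗ₘ _) ≫ (_ ≫ _) ≫ G.map (P.map _) = _
    -- The inner structure map ends in a transport. It is moved past the outer one, so that apart
    -- from associativity of `p` only transports between equal words remain.
    have h₁ := (p.pairing_map_left (p.μ (P.obj a) (P.obj b)) (𝟙 (G.obj (P.obj c)))
      (eqToHom (hP.append a b).symm)).trans (Category.assoc _ _ _)
    have h₂ := (p.pairing_map_right (𝟙 (G.obj (P.obj a))) (p.μ (P.obj b) (P.obj c))
      (eqToHom (hP.append b c).symm)).trans (Category.assoc _ _ _)
    rw [pairing, Words.tens_eqToHom_id] at h₁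
    rw [pairing, Words.tens_id_eqToHom] at h₂
    have h₃ := p.associativity (P.obj a) (P.obj b) (P.obj c)
    rw [Category.assoc]
    refine ((reassoc_of% h₁) _).trans (Eq.trans ?_ (congrArg (fun z => (α_ _ _ _).hom ≫ z)
      ((reassoc_of% h₂) _)).symm)
    rw [← reassoc_of% h₃, eqToHom_map P]
    simp only [← G.map_comp, eqToHom_trans]
  left_unitality a := by
    have h := (p.pairing_map_left p.ε (𝟙 (G.obj (P.obj a))) (eqToHom hP.nil.symm)).trans
      (Category.assoc _ _ _)
    rw [pairing, Words.tens_eqToHom_id] at h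
    change (p.ε ≫ _ ⊗ₘ 𝟙 (G.obj (P.obj a))) ≫ _ ≫ _ = _
    refine ((reassoc_of% h) _).trans (Eq.trans ?_ (p.left_unitality (P.obj a)))
    rw [← G.map_comp, eqToHom_trans]
    exact congrArg (fun z => _ ≫ z) ((congrArg (fun z => _ ≫ z) (G.map_id _)).trans
      (Category.comp_id _))
  right_unitality a := by
    have h := (p.pairing_map_right (𝟙 (G.obj (P.obj a))) p.ε (eqToHom hP.nil.symm)).trans
      (Category.assoc _ _ _)
    rw [pairing, Words.tens_id_eqToHom] at h
    change (𝟙 (G.obj (P.obj a)) ⊗ₘ p.ε ≫ _) ≫ (_ ≫ _) ≫ G.map (P.map _) = _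
    rw [Category.assoc]
    refine ((reassoc_of% h) _).trans (Eq.trans ?_ (p.right_unitality (P.obj a)))
    rw [eqToHom_map P]
    simp only [← G.map_comp, eqToHom_trans]
  map_sigma a b := by
    change _ ≫ G.map (P.map _) = _
    have h := p.map_sigma (P.obj a) (P.obj b)
    refine Eq.trans ?_ ((reassoc_of% h) _)
    rw [hP.sigma, Category.assoc, ← G.map_comp, ← G.map_comp]
    simp
  map_lam a := by
    change G.map (P.map _) = _
    rw [hP.lam, p.map_lam]
    rfl

instance (p : WordLax G) [p.IsStrong] (hP : Words.IsStrict P) : (p.precomp hP).IsStrong where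
  μ_isIso a b := by unfold precomp; infer_instance
  ε_isIso := by unfold precomp; infer_instance

/-- The two structures differ only in how a transport is factored. Because they are equal on the
nose, multiplicative families obtained by successive restrictions can be composed directly. -/
theorem precomp_precomp (p : WordLax G) (hP : Words.IsStrict P) {R : Words B ⥤ Words C}
    (hR : Words.IsStrict R) : (p.precomp hP).precomp hR = p.precomp (hR.comp hP) := by
  ext a b
  · change (_ ≫ _) ≫ G.map (P.map _) = _
    rw [Category.assoc, ← G.map_comp, eqToHom_map, eqToHom_trans]
    rfl
  · change (_ ≫ _) ≫ G.map (P.map _) = _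
    rw [Category.assoc, ← G.map_comp, eqToHom_map, eqToHom_trans]
    rfl

variable {p : WordLax G} {q : WordLax H}

theorem IsMultiplicative.precomp {θ : ∀ a, G.obj a ⟶ H.obj a} (h : IsMultiplicative p q θ)
    (hP : Words.IsStrict P) :
    IsMultiplicative (p.precomp hP) (q.precomp hP) (fun a => θ (P.obj a)) where
  unit := by
    change (_ ≫ _) ≫ _ = _ ≫ _
    rw [Category.assoc, app_eqToHom, reassoc_of% h.unit]
  tensor a b := by
    change (_ ≫ _) ≫ _ = _ ≫ _ ≫ _
    rw [Category.assoc, app_eqToHom, reassoc_of% h.tensor]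

/-- This handles every strict comparison in the axioms (functoriality of `T`, naturality, unit and
associativity of `mult`). Agreement on objects suffices, since no naturality is asked of the family.
-/
theorem isMultiplicative_eqToHom (p : WordLax G) (hP : Words.IsStrict P) (hQ : Words.IsStrict Q)
    (h : ∀ a, P.obj a = Q.obj a) :
    IsMultiplicative (p.precomp hP) (p.precomp hQ) (fun a => G.map (eqToHom (h a))) where
  unit := by
    change (_ ≫ _) ≫ _ = _ ≫ _
    rw [Category.assoc, ← G.map_comp, eqToHom_trans]
  tensor a b := by
    change (_ ≫ _) ≫ _ = _ ≫ _ ≫ _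
    rw [Category.assoc, ← G.map_comp, eqToHom_trans, reassoc_of% p.μ_natural, Words.tens_eqToHom,
      ← G.map_comp, eqToHom_trans]

/-- No condition on `θ` is needed, as the extension to words acts letter by letter. Factors such as
`act.map ((T.map₂ cell).app X)` are thus multiplicative for any cell. -/
theorem isMultiplicative_ext₂ (p : WordLax G) {K K' : C ⥤ Words D} (θ : K ⟶ K') :
    IsMultiplicative (p.precomp (.ext K)) (p.precomp (.ext K'))
      (fun a => G.map ((Words.ext₂ θ).app a)) where
  unit := by
    change (p.ε ≫ _) ≫ G.map ((Words.ext₂ θ).app .nil) = p.ε ≫ _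
    rw [Words.ext₂_nil]
    exact (congrArg (fun z => (p.ε ≫ _) ≫ z) (G.map_id _)).trans (Category.comp_id _)
  tensor a b := by
    change (p.μ _ _ ≫ _) ≫ _ = _ ≫ p.μ _ _ ≫ _
    rw [Category.assoc, ← G.map_comp, reassoc_of% p.μ_natural, ← G.map_comp, Words.ext₂_append]
    simp

end Precomp

section Postcomp

variable {B : Type u'} [Category.{v'} B] {C : Type u''} [Category.{v''} C]
  {M N K : DistMon.{v, u}} {F F' : M.carrier ⥤ N.carrier} {F₁ : N.carrier ⥤ K.carrier}
  {G H : Words C ⥤ M.carrier}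

/-- Composition with a `σ`-lax monoidal functor. -/
noncomputable def postcomp (p : WordLax G) (φ : SigmaLax M N F) : WordLax (G ⋙ F) where
  μ a b := φ.lax.μ _ _ ≫ F.map (p.μ a b)
  ε := φ.lax.ε ≫ F.map p.ε
  μ_natural f g := by
    let := φ.lax
    change (F.map (G.map f) ⊗ₘ F.map (G.map g)) ≫ Functor.LaxMonoidal.μ F _ _ ≫ _ =
      (Functor.LaxMonoidal.μ F _ _ ≫ _) ≫ F.map (G.map _)
    rw [Functor.LaxMonoidal.μ_natural_assoc, Category.assoc, ← F.map_comp, p.μ_natural,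
      F.map_comp]
  associativity a b c := by
    let := φ.lax
    have h := congrArg F.map (p.associativity a b c)
    simp only [tensorHom_id, id_tensorHom, Functor.map_comp] at h
    change (Functor.LaxMonoidal.μ F _ _ ≫ _ ⊗ₘ 𝟙 (F.obj (G.obj c))) ≫
      (Functor.LaxMonoidal.μ F _ _ ≫ _) ≫ F.map (G.map _) = _ ≫
      (𝟙 (F.obj (G.obj a)) ⊗ₘ Functor.LaxMonoidal.μ F _ _ ≫ _) ≫ Functor.LaxMonoidal.μ F _ _ ≫ _
    rw [tensorHom_id, id_tensorHom, comp_whiskerRight, MonoidalCategory.whiskerLeft_comp]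
    simp only [Category.assoc]
    rw [Functor.LaxMonoidal.μ_natural_left_assoc, h, Functor.LaxMonoidal.associativity_assoc,
      Functor.LaxMonoidal.μ_natural_right_assoc]
    rfl
  left_unitality a := by
    let := φ.lax
    have h := congrArg F.map (p.left_unitality a)
    rw [tensorHom_id, F.map_comp] at h
    change (Functor.LaxMonoidal.ε F ≫ _ ⊗ₘ 𝟙 (F.obj (G.obj a))) ≫
      Functor.LaxMonoidal.μ F _ _ ≫ _ = (λ_ (F.obj (G.obj a))).hom
    rw [tensorHom_id, comp_whiskerRight, Category.assoc,
      Functor.LaxMonoidal.μ_natural_left_assoc, Functor.LaxMonoidal.left_unitality]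
    exact congrArg (fun z => _ ≫ _ ≫ z) h
  right_unitality a := by
    let := φ.lax
    have h := congrArg F.map (p.right_unitality a)
    rw [id_tensorHom, F.map_comp, F.map_comp] at h
    change (𝟙 (F.obj (G.obj a)) ⊗ₘ Functor.LaxMonoidal.ε F ≫ _) ≫
      (Functor.LaxMonoidal.μ F _ _ ≫ _) ≫ F.map (G.map _) = (ρ_ (F.obj (G.obj a))).hom
    rw [id_tensorHom, MonoidalCategory.whiskerLeft_comp, Category.assoc, Category.assoc,
      Functor.LaxMonoidal.μ_natural_right_assoc, Functor.LaxMonoidal.right_unitality, h]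
  map_sigma a b := by
    change (_ ≫ _) ≫ F.map (G.map _) = distortion (F.obj (G.obj a)) _ ≫ _ ≫ _
    have := φ.map_distortion (G.obj a) (G.obj b)
    change φ.lax.μ _ _ ≫ _ = _ ≫ φ.lax.μ _ _ at this
    rw [Category.assoc, ← F.map_comp, p.map_sigma, F.map_comp, reassoc_of% this]
  map_lam a := by
    change F.map (G.map _) = _
    rw [p.map_lam, φ.map_unitDistortion]
    rfl

theorem postcomp_precomp (p : WordLax G) (φ : SigmaLax M N F) {P : Words B ⥤ Words C}
    (hP : Words.IsStrict P) : (p.postcomp φ).precomp hP = (p.precomp hP).postcomp φ := by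
  ext a b
  · change (_ ≫ _) ≫ F.map (G.map _) = _ ≫ F.map (_ ≫ _)
    rw [F.map_comp, Category.assoc]
    rfl
  · change (_ ≫ _) ≫ F.map (G.map _) = _ ≫ F.map (_ ≫ _)
    rw [F.map_comp, Category.assoc]

theorem postcomp_id (p : WordLax G) : p.postcomp (SigmaLax.id M) = p := by
  ext a b
  · exact Category.id_comp _
  · exact Category.id_comp _

theorem postcomp_comp (p : WordLax G) (φ : SigmaLax M N F) (ψ : SigmaLax N K F₁) :
    p.postcomp (φ.comp ψ) = (p.postcomp φ).postcomp ψ := by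
  ext a b
  · change (_ ≫ F₁.map _) ≫ F₁.map (F.map _) = _ ≫ F₁.map (_ ≫ _)
    rw [F₁.map_comp, Category.assoc]
    rfl
  · change (_ ≫ F₁.map _) ≫ F₁.map (F.map _) = _ ≫ F₁.map (_ ≫ _)
    rw [F₁.map_comp, Category.assoc]

theorem IsMultiplicative.postcomp {p : WordLax G} {q : WordLax H} {θ : ∀ a, G.obj a ⟶ H.obj a}
    (h : IsMultiplicative p q θ) (φ : SigmaLax M N F) :
    IsMultiplicative (p.postcomp φ) (q.postcomp φ) (fun a => F.map (θ a)) where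
  unit := by
    change (_ ≫ _) ≫ _ = _ ≫ _
    rw [Category.assoc, ← F.map_comp, h.unit]
  tensor a b := by
    let := φ.lax
    change (Functor.LaxMonoidal.μ F _ _ ≫ _) ≫ _ = _ ≫ Functor.LaxMonoidal.μ F _ _ ≫ _
    rw [Category.assoc, ← F.map_comp, h.tensor, Functor.LaxMonoidal.μ_natural_assoc, F.map_comp]

theorem isMultiplicative_of_isMonoidal (p : WordLax G) {φ : SigmaLax M N F}
    {ψ : SigmaLax M N F'} {θ : F ⟶ F'} (h : IsMonoidal φ ψ θ) :
    IsMultiplicative (p.postcomp φ) (p.postcomp ψ) (fun a => θ.app (G.obj a)) where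
  unit := by
    let := φ.lax
    let := ψ.lax
    have : NatTrans.IsMonoidal θ := h
    change (_ ≫ _) ≫ _ = _ ≫ _
    rw [Category.assoc, θ.naturality, ← Category.assoc]
    exact congrArg (fun z => z ≫ _) (NatTrans.IsMonoidal.unit (τ := θ))
  tensor a b := by
    let := φ.lax
    let := ψ.lax
    have : NatTrans.IsMonoidal θ := h
    change (_ ≫ _) ≫ _ = _ ≫ _ ≫ _
    rw [Category.assoc, θ.naturality, ← Category.assoc, ← Category.assoc]
    exact congrArg (fun z => z ≫ _) (NatTrans.IsMonoidal.tensor (τ := θ) _ _)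

end Postcomp

end WordLax

end Distorted

/-! ### The pseudoalgebra of a strong action -/

namespace Distorted

open MonoidalCategory DistortedMonoidal

namespace Words

variable {C : Type u} [Category.{v} C] {D : Type u'} [Category.{v'} D]

theorem IsStrict.id : IsStrict (𝟭 (Words C)) where
  nil := rfl
  append _ _ := rfl
  tens _ _ := by simp
  sigma _ _ := by simp
  lam _ := rfl

theorem map_map_of (F : C ⥤ D) {X Y : C} (f : X ⟶ Y) :
    (map F).map ((of C).map f) = (of D).map (F.map f) :=
  (Functor.congr_hom (of_comp_ext (F ⋙ of D)) f).trans
    ((Category.id_comp _).trans (Category.comp_id _))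

theorem mult_map_of {a b : Words C} (f : a ⟶ b) :
    (mult C).map ((of (Words C)).map f) =
      eqToHom (append_nil a) ≫ f ≫ eqToHom (append_nil b).symm :=
  Functor.congr_hom (of_comp_ext (𝟭 (Words C))) f

end Words

theorem WordLax.precomp_id {D : Type u'} [Category.{v'} D]
    {V : Type u''} [Category.{v''} V] [MonoidalCategory V] [DistortedMonoidal V]
    {G : Words D ⥤ V} (p : WordLax G) : p.precomp Words.IsStrict.id = p := by
  ext a b
  · exact (congrArg (fun z => _ ≫ z) (G.map_id _)).trans (Category.comp_id _)
  · exact (congrArg (fun z => _ ≫ z) (G.map_id _)).trans (Category.comp_id _)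

namespace PseudoAlgebra

/-- Like the next two lemmas, this is stated for variable objects, so that the equalities can be
eliminated by substitution; for the concrete words of the application that is impossible. -/
theorem map_eqToHom_comp_assoc {W : Type u'} [Category.{v'} W] {V : Type u''} [Category.{v''} V]
    (G : W ⥤ V) {x : V} {a c d e : W} (m : x ⟶ G.obj a) (j : G.obj a ⟶ G.obj c) (h : a = a)
    (h' : c = d) (h'' : d = e) :
    m ≫ G.map (eqToHom h) ≫ (j ≫ G.map (eqToHom h')) ≫ G.map (eqToHom h'') =
      m ≫ j ≫ G.map (eqToHom (h'.trans h'')) := by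
  subst h' h''; simp

theorem map_comp_eqToHom_eq {W : Type u'} [Category.{v'} W] {V : Type u''} [Category.{v''} V]
    (G : W ⥤ V) {a a' b b' : W} (f : a ⟶ b) (h : a = a') (h' : b = b') :
    G.map f ≫ G.map (eqToHom h') =
      G.map (eqToHom h) ≫ G.map (eqToHom h.symm ≫ f ≫ eqToHom h') := by
  subst h h'; simp

theorem map_eqToHom_trans {W : Type u'} [Category.{v'} W] {V : Type u''} [Category.{v''} V]
    (G : W ⥤ V) {a b c : W} (h : a = b) (h' : b = c) (h'' : a = c) :
    G.map (eqToHom h) ≫ G.map (eqToHom h') = G.map (eqToHom h'') := by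
  rw [← G.map_comp, eqToHom_trans]

section OfAction

variable {C : Cat.{v, u}} [MonoidalCategory C] [DistortedMonoidal C] {act : Words C ⥤ C}
  (p : WordLax act) [p.IsStrong] (ι : 𝟭 C ≅ Words.of C ⋙ act)

/-- The multiplication cell at a word of length one. -/
noncomputable def multSingle (a : Words C) :
    (Words.map act ⋙ act).obj (.single a) ⟶ (Words.mult C ⋙ act).obj (.single a) :=
  -- The left unit axiom leaves no choice here. The transport is needed because the multiplication
  -- evaluates `[a]` to `a ++ []`.
  ι.inv.app (act.obj a) ≫ act.map (eqToHom (Words.append_nil a).symm)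

instance isIso_multSingle (a : Words C) : IsIso (multSingle ι a) := by
  exact @IsIso.comp_isIso _ _ _ _ _ _ _ (NatIso.inv_app_isIso ι _)
    (Functor.map_isIso act (eqToHom (Words.append_nil a).symm))

omit [MonoidalCategory C] [DistortedMonoidal C] in
theorem multSingle_naturality {a b : Words C} (f : a ⟶ b) :
    (Words.map act ⋙ act).map ((Words.of (Words C)).map f) ≫ multSingle ι b =
      multSingle ι a ≫ (Words.mult C ⋙ act).map ((Words.of (Words C)).map f) := by
  have h := ι.inv.naturality (act.map f)
  change act.map ((Words.of C).map (act.map f)) ≫ _ = _ ≫ act.map f at h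
  change act.map ((Words.map act).map _) ≫ _ ≫ _ = (_ ≫ _) ≫ act.map ((Words.mult C).map _)
  have h₁ := congrArg act.map (Words.map_map_of act f)
  have h₂ := congrArg act.map (Words.mult_map_of f)
  refine (congrArg (fun z => z ≫ _) h₁).trans (Eq.trans ?_ (congrArg (fun z => _ ≫ z) h₂.symm))
  refine ((reassoc_of% h) _).trans (Eq.trans ?_ (Category.assoc _ _ _).symm)
  exact congrArg (fun z => _ ≫ z) (map_comp_eqToHom_eq act f _ _)

/-- The multiplication cell. -/
noncomputable def multHom : Words.map act ⋙ act ⟶ Words.mult C ⋙ act :=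
  WordLax.extend (p.precomp (.map act)) (p.precomp .mult) (multSingle ι) (multSingle_naturality ι)

theorem multHom_single (a : Words C) : (multHom p ι).app (.single a) = multSingle ι a :=
  WordLax.extendApp_single _ _ _ a

theorem isMultiplicative_multHom : WordLax.IsMultiplicative (p.precomp (.map act))
    (p.precomp .mult) (fun W => (multHom p ι).app W) :=
  WordLax.isMultiplicative_extendApp _ _ _

/-- Source and target structures are strong and the values on letters are invertible, so every
component of the extension is invertible. -/
noncomputable def multIsoOfAction : Words.map act ⋙ act ≅ Words.mult C ⋙ act :=
  have (W : Words (Words C)) : IsIso ((multHom p ι).app W) :=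
    WordLax.isIso_extendApp (p.precomp (.map act)) (p.precomp .mult) (multSingle ι) W.toList
  have := NatIso.isIso_of_isIso_app (multHom p ι)
  asIso (multHom p ι)

/-- The pseudoalgebra given by an action functor which is a strong distorted monoidal functor and
by a unit isomorphism. -/
noncomputable def ofAction : PseudoAlgebra Tσ.{v, u} C where
  act := act
  unitIso := ι
  multIso := multIsoOfAction p ι
  unit_left X := by
    -- This axiom sees the multiplication only at words of length one, where its value is
    -- prescribed.
    have h := multHom_single p ι X
    change _ ≫ _ ≫ (multHom p ι).app (.single X) ≫ _ = _
    refine (congrArg (fun z => _ ≫ _ ≫ z ≫ _) h).trans ?_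
    refine (map_eqToHom_comp_assoc act _ _ rfl _ _).trans ?_
    exact (congrArg (fun z => _ ≫ _ ≫ z) (act.map_id _)).trans
      ((congrArg (fun z => _ ≫ z) (Category.comp_id _)).trans (ι.hom_inv_id_app _))
  unit_right X := by
    -- Each of the five factors of the axiom is multiplicative, and so is the identity on the other
    -- side; uniqueness leaves only words of length one.
    have h₁ := p.isMultiplicative_eqToHom (P := 𝟭 (Words C)) (Q := Words.map (𝟭 C)) .id (.map _)
      (Functor.congr_obj (Tσ.map_id C).symm)
    have h₂ := p.isMultiplicative_ext₂ (Functor.whiskerRight ι.hom (Words.of C))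
    have h₃ := p.isMultiplicative_eqToHom (P := Words.map (Words.of C ⋙ act))
      (Q := Words.map (Words.of C) ⋙ Words.map act) (.map _) (.comp (.map _) (.map _))
      (Functor.congr_obj (Words.map_comp _ _))
    have h₄ := (isMultiplicative_multHom p ι).precomp (.map (Words.of C))
    have h₅ := p.isMultiplicative_eqToHom (P := Words.map (Words.of C) ⋙ Words.mult C)
      (Q := 𝟭 (Words C)) (.comp (.map _) .mult) .id
      (Functor.congr_obj Words.map_unit_mult)
    rw [WordLax.precomp_precomp, WordLax.precomp_precomp] at h₄
    have h := h₁.comp (h₂.comp (h₃.comp (h₄.comp h₅)))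
    rw [WordLax.precomp_id] at h
    refine h.unique (.id p) (fun Y => ?_) X
    have e := congrArg act.map (Words.map₂_single ι.hom Y)
    have e' := multHom_single p ι (.single Y)
    refine (congrArg (fun z => act.map (eqToHom rfl) ≫ z ≫ _) e).trans ?_
    refine (congrArg (fun z => _ ≫ _ ≫ act.map (eqToHom rfl) ≫ z ≫ _) e').trans ?_
    refine (congrArg (fun z => _ ≫ z) (map_eqToHom_comp_assoc act _ _ rfl _ _)).trans ?_
    -- At `[Y]` what remains is `act` applied to `ι`, followed by the inverse of `ι`; naturality
    -- turns this into a cancelling pair.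
    have n := (ι.inv.naturality (ι.hom.app Y)).trans (ι.inv_hom_id_app Y)
    refine (congrArg (fun z => z ≫ _) (act.map_id _)).trans ((Category.id_comp _).trans ?_)
    refine (congrArg (fun z => _ ≫ _ ≫ z) (act.map_id _)).trans ?_
    exact (congrArg (fun z => _ ≫ z) (Category.comp_id _)).trans n
  mult_assoc X := by
    have h₁ := p.isMultiplicative_ext₂ (Functor.whiskerRight (multHom p ι) (Words.of C))
    have h₂ := p.isMultiplicative_eqToHom (P := Words.map (Words.mult C ⋙ act))
      (Q := Words.map (Words.mult C) ⋙ Words.map act) (.map _) (.comp (.map _) (.map _))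
      (Functor.congr_obj (Words.map_comp _ _))
    have h₃ := (isMultiplicative_multHom p ι).precomp (.map (Words.mult C))
    have h₄ := p.isMultiplicative_eqToHom (P := Words.map (Words.mult C) ⋙ Words.mult C)
      (Q := Words.mult (Words C) ⋙ Words.mult C) (.comp (.map _) .mult) (.comp .mult .mult)
      (Functor.congr_obj Words.mult_assoc)
    have k₁ := p.isMultiplicative_eqToHom (P := Words.map (Words.map act ⋙ act))
      (Q := Words.map (Words.map act) ⋙ Words.map act) (.map _) (.comp (.map _) (.map _))
      (Functor.congr_obj (Words.map_comp _ _))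
    have k₂ := (isMultiplicative_multHom p ι).precomp (.map (Words.map act))
    have k₃ := p.isMultiplicative_eqToHom (P := Words.map (Words.map act) ⋙ Words.mult C)
      (Q := Words.mult (Words C) ⋙ Words.map act) (.comp (.map _) .mult) (.comp .mult (.map _))
      (Functor.congr_obj (Words.mult_naturality act))
    have k₄ := (isMultiplicative_multHom p ι).precomp (.mult (C := Words C))
    rw [WordLax.precomp_precomp, WordLax.precomp_precomp] at h₃ k₂ k₄
    refine (h₁.comp (h₂.comp (h₃.comp h₄))).unique (k₁.comp (k₂.comp (k₃.comp k₄)))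
      (fun U => ?_) X
    have e := congrArg act.map (Words.map₂_single (multHom p ι) U)
    have e₁ := multHom_single p ι ((Words.mult C).obj U)
    have e₂ := multHom_single p ι ((Words.map act).obj U)
    refine (congrArg (fun z => z ≫ _) e).trans ?_
    refine (congrArg (fun z => _ ≫ act.map (eqToHom rfl) ≫ z ≫ _) e₁).trans ?_
    refine (map_eqToHom_comp_assoc act _ _ rfl _ _).trans ?_
    refine Eq.trans ?_ (congrArg (fun z => act.map (eqToHom rfl) ≫ z ≫ _) e₂.symm)
    -- At `[U]` both sides reduce to the inverse of `ι` followed by the multiplication at `U`. On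
    -- the left this is naturality of `ι.inv`; on the right the multiplication sits at `U ++ []` and
    -- is transported to `U`.
    have n := ι.inv.naturality ((multHom p ι).app U)
    change act.map ((Words.of C).map _) ≫ _ = _ ≫ (multHom p ι).app U at n
    have n' := WordLax.app_eqToHom (fun a => (multHom p ι).app a) (Words.append_nil U).symm
    refine ((reassoc_of% n) _).trans ?_
    refine Eq.trans ?_ (congrArg (fun z => z ≫ _) (act.map_id _)).symm
    refine Eq.trans ?_ (Category.id_comp _).symm
    refine Eq.trans ?_ (Category.assoc _ _ _).symm
    refine congrArg (fun z => _ ≫ z) ?_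
    have m₁ := congrArg act.map (eqToHom_map (Words.mult C) (Words.append_nil U).symm)
    have m₂ := congrArg act.map (eqToHom_map (Words.map act) (Words.append_nil U).symm)
    refine (congrArg (fun z => _ ≫ z) m₁).symm.trans (n'.symm.trans ?_)
    refine (congrArg (fun z => z ≫ _) m₂).trans ?_
    refine Eq.trans ?_ (Category.assoc _ _ _)
    refine congrArg (fun z => z ≫ _) ?_
    exact (map_eqToHom_trans act _ _ _).symm

end OfAction

end PseudoAlgebra

end Distorted

/-! ### Evaluation of words in a distorted monoidal category -/

namespace Distorted

open MonoidalCategory DistortedMonoidal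

namespace Evaluation

variable {V : Type u} [Category.{v} V] [MonoidalCategory V]

/-- The tensor product of a list of objects, bracketed to the right. -/
def obj : List V → V
  | [] => 𝟙_ V
  | X :: a => X ⊗ obj a

/-- The comparison of the tensor product of a concatenation. -/
def μIso : ∀ a b : List V, obj a ⊗ obj b ≅ obj (a ++ b)
  | [], b => λ_ (obj b)
  | X :: a, b => α_ X (obj a) (obj b) ≪≫ whiskerLeftIso X (μIso a b)

def μ (a b : List V) : obj a ⊗ obj b ⟶ obj (a ++ b) := (μIso a b).hom

instance (a b : List V) : IsIso (μ a b) := by unfold μ; infer_instance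

/-- Indexing by equalities of lists rather than of objects makes transports compose and extend by `X
::` as the lists do. -/
def cast {a b : List V} (h : a = b) : obj a ⟶ obj b := eqToHom (congrArg obj h)

instance {a b : List V} (h : a = b) : IsIso (cast h) := by unfold cast; infer_instance

@[simp]
theorem cast_refl {a : List V} (h : a = a) : cast h = 𝟙 (obj a) := rfl

@[simp]
theorem cast_trans {a b c : List V} (h : a = b) (k : b = c) :
    cast h ≫ cast k = cast (h.trans k) := by
  subst h k; simp

theorem cast_cons (X : V) {a b : List V} (h : a = b) :
    cast (congrArg (X :: ·) h) = X ◁ cast h := by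
  subst h; exact (MonoidalCategory.whiskerLeft_id _ _).symm

/-- The instance of coherence that the evaluation needs, by induction on `a`: for the empty list it
is the compatibility of the left unitor with the associator, and the inductive step is the pentagon.
-/
theorem μ_associativity (a b c : List V) :
    (μ a b ⊗ₘ 𝟙 (obj c)) ≫ μ (a ++ b) c ≫ cast (List.append_assoc a b c) =
      (α_ _ _ _).hom ≫ (𝟙 (obj a) ⊗ₘ μ b c) ≫ μ a (b ++ c) := by
  rw [tensorHom_id, id_tensorHom]
  induction a with
  | nil =>
    refine (congrArg (fun z => _ ≫ z) (Category.comp_id _)).trans ?_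
    have h : (λ_ (obj b)).hom ▷ obj c ≫ μ b c =
        (α_ (𝟙_ V) (obj b) (obj c)).hom ≫ 𝟙_ V ◁ μ b c ≫ (λ_ (obj (b ++ c))).hom := by simp
    exact h
  | cons X a ih =>
    have h : cast (List.append_assoc (X :: a) b c) = X ◁ cast (List.append_assoc a b c) :=
      cast_cons X _
    rw [h]
    change ((α_ X (obj a) (obj b)).hom ≫ X ◁ μ a b) ▷ obj c ≫
      ((α_ X (obj (a ++ b)) (obj c)).hom ≫ X ◁ μ (a ++ b) c) ≫ _ =
      (α_ (X ⊗ obj a) (obj b) (obj c)).hom ≫ (X ⊗ obj a) ◁ μ b c ≫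
        (α_ X (obj a) (obj (b ++ c))).hom ≫ X ◁ μ a (b ++ c)
    have ih' := congrArg (fun z => X ◁ z) ih
    simp only [MonoidalCategory.whiskerLeft_comp] at ih'
    simp [ih']

theorem μ_associativity_inv (a b c : List V) :
    (𝟙 (obj a) ⊗ₘ μ b c) ≫ μ a (b ++ c) ≫ cast (List.append_assoc a b c).symm =
      (α_ _ _ _).inv ≫ (μ a b ⊗ₘ 𝟙 (obj c)) ≫ μ (a ++ b) c := by
  rw [Iso.eq_inv_comp, ← reassoc_of% μ_associativity]
  simp

theorem μ_right_unitality (a : List V) :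
    μ a [] ≫ cast (List.append_nil a) = (ρ_ (obj a)).hom := by
  induction a with
  | nil => exact (Category.comp_id _).trans unitors_equal
  | cons X a ih =>
    have h : cast (List.append_nil (X :: a)) = X ◁ cast (List.append_nil a) := cast_cons X _
    rw [h]
    change ((α_ X (obj a) (𝟙_ V)).hom ≫ X ◁ μ a []) ≫ _ = (ρ_ (X ⊗ obj a)).hom
    have h' : X ◁ μ a [] ≫ X ◁ cast (List.append_nil a) = X ◁ (ρ_ (obj a)).hom :=
      (MonoidalCategory.whiskerLeft_comp X _ _).symm.trans (congrArg (fun z => X ◁ z) ih)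
    exact (Category.assoc _ _ _).trans ((congrArg (fun z => (α_ X (obj a) (𝟙_ V)).hom ≫ z) h').trans
      (rightUnitor_tensor_hom _ _).symm)

/-- Operations on terms act between concatenated lists, so those of `V` are conjugated by the
comparison `μ`; likewise for `sigma` below. -/
noncomputable def tens {a b c d : List V} (f : obj a ⟶ obj b) (g : obj c ⟶ obj d) :
    obj (a ++ c) ⟶ obj (b ++ d) := inv (μ a c) ≫ (f ⊗ₘ g) ≫ μ b d

theorem μ_tens {a b c d : List V} (f : obj a ⟶ obj b) (g : obj c ⟶ obj d) :
    μ a c ≫ tens f g = (f ⊗ₘ g) ≫ μ b d := by simp [tens]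

variable [DistortedMonoidal V]

noncomputable def sigma (a b : List V) : obj (a ++ b) ⟶ obj (b ++ a) :=
  inv (μ a b) ≫ distortion _ _ ≫ μ b a

theorem μ_sigma (a b : List V) : μ a b ≫ sigma a b = distortion _ _ ≫ μ b a := by
  simp [sigma]

/-- The evaluation of terms. -/
noncomputable def term : ∀ {a b : List V}, Term a b → (obj a ⟶ obj b)
  | _, _, .id a => 𝟙 (obj a)
  | _, _, .comp f g => term f ≫ term g
  | _, _, .tensor f g => tens (term f) (term g)
  -- The list `[X]` evaluates to `X ⊗ 𝟙_ V` and not to `X`; the right unitor makes up for this in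
  -- `unitIso`.
  | _, _, .of f => f ⊗ₘ 𝟙 (𝟙_ V)
  | _, _, .sigma a b => sigma a b
  | _, _, .lam a => (unitDistortion (C := V)).app (obj a)

theorem term_cast {a b : List V} (h : a = b) : term (Term.cast h) = cast h := by
  subst h; rfl

theorem id_tensor_μ_sigma (a b c : List V) :
    (𝟙 (obj a) ⊗ₘ μ b c) ≫ (𝟙 (obj a) ⊗ₘ sigma b c) =
      (𝟙 (obj a) ⊗ₘ distortion _ _) ≫ (𝟙 (obj a) ⊗ₘ μ c b) := by
  rw [tensorHom_comp_tensorHom, tensorHom_comp_tensorHom, μ_sigma]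

theorem μ_sigma_tensor_id (a b c : List V) :
    (μ a b ⊗ₘ 𝟙 (obj c)) ≫ (sigma a b ⊗ₘ 𝟙 (obj c)) =
      (distortion _ _ ⊗ₘ 𝟙 (obj c)) ≫ (μ b a ⊗ₘ 𝟙 (obj c)) := by
  rw [tensorHom_comp_tensorHom, tensorHom_comp_tensorHom, μ_sigma]

-- Maps out of a threefold concatenation may be tested on the threefold tensor product, since `μ` is
-- invertible. The two bracketings serve the two hexagons.
omit [DistortedMonoidal V] in
theorem cancel_id_μ_μ {a b c : List V} {X : V} {f g : obj (a ++ (b ++ c)) ⟶ X}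
    (h : (𝟙 (obj a) ⊗ₘ μ b c) ≫ μ a (b ++ c) ≫ f = (𝟙 (obj a) ⊗ₘ μ b c) ≫ μ a (b ++ c) ≫ g) :
    f = g := by
  simpa only [cancel_epi] using h

omit [DistortedMonoidal V] in
theorem cancel_μ_μ {a b c : List V} {X : V} {f g : obj ((a ++ b) ++ c) ⟶ X}
    (h : (μ a b ⊗ₘ 𝟙 (obj c)) ≫ μ (a ++ b) c ≫ f = (μ a b ⊗ₘ 𝟙 (obj c)) ≫ μ (a ++ b) c ≫ g) :
    f = g := by
  simpa only [cancel_epi] using h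

/-- Precomposed with the invertible `μ` where concatenations occur, each relation becomes the
matching axiom of `V`: the coherence laws of `μ` exchange the transports in the relation for
associators and unitors. -/
theorem term_rel {a b : List V} {f g : Term a b} (h : Term.Rel f g) : term f = term g := by
  induction h with
  | refl => rfl
  | symm _ ih => exact ih.symm
  | trans _ _ h₁ h₂ => exact h₁.trans h₂
  | comp_congr _ _ h₁ h₂ => simp only [term, h₁, h₂]
  | tensor_congr _ _ h₁ h₂ => simp only [term, h₁, h₂]
  | id_comp => exact Category.id_comp _
  | comp_id => exact Category.comp_id _
  | assoc => exact Category.assoc _ _ _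
  | of_id X => exact id_tensorHom_id _ _
  | of_comp f g =>
    have h := (tensorHom_comp_tensorHom f (𝟙 (𝟙_ V)) g (𝟙 (𝟙_ V))).symm
    rw [Category.comp_id] at h
    exact h
  | tensor_id a b => simp [term, tens]
  | tensor_comp f g f' g' => simp [term, tens]
  | tensor_assoc f g h =>
    simp only [term, term_cast]
    refine cancel_μ_μ ?_
    rw [reassoc_of% μ_associativity, reassoc_of% μ_tens, μ_tens, tensorHom_comp_tensorHom_assoc,
      tensorHom_comp_tensorHom_assoc, μ_tens, μ_tens, Category.id_comp, Category.id_comp]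
    have h₁ := tensorHom_comp_tensorHom (term f ⊗ₘ term g) (term h) (μ _ _) (𝟙 _)
    have h₂ := tensorHom_comp_tensorHom (term f) (term g ⊗ₘ term h) (𝟙 _) (μ _ _)
    rw [Category.comp_id] at h₁ h₂
    rw [← h₁, ← h₂, Category.assoc, Category.assoc, μ_associativity, associator_naturality_assoc]
  | unit_tensor f =>
    simp only [term, term_cast]
    rw [← cancel_epi (μ _ _), reassoc_of% μ_tens, id_tensorHom]
    refine (congrArg (fun z => _ ≫ z) (Category.comp_id _)).trans ?_
    refine Eq.trans ?_ (congrArg (fun z => _ ≫ z) (Category.id_comp _).symm)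
    exact leftUnitor_naturality _
  | tensor_unit f =>
    simp only [term, term_cast]
    rw [← cancel_epi (μ _ _), reassoc_of% μ_tens, μ_right_unitality, ← Category.assoc,
      μ_right_unitality, tensorHom_id]
    exact rightUnitor_naturality _
  | sigma_naturality f g =>
    simp only [term]
    rw [← cancel_epi (μ _ _)]
    simp only [reassoc_of% μ_tens, reassoc_of% μ_sigma, μ_sigma, μ_tens]
    rw [← Category.assoc, ← Category.assoc, DistortedMonoidal.naturality]
  | sigma_unit a =>
    simp only [term, term_cast]
    rw [← cancel_epi (μ _ _), μ_sigma, ← Category.assoc, μ_right_unitality]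
    refine (congrArg (fun z => z ≫ _) (distortion_unit (obj a))).trans ?_
    exact (Category.assoc _ _ _).trans (congrArg (fun z => _ ≫ z) (Iso.inv_hom_id _))
  | unit_sigma a =>
    simp only [term, term_cast]
    rw [← cancel_epi (μ _ _), μ_sigma]
    refine (congrArg (fun z => z ≫ _) (unit_distortion (obj a))).trans ?_
    have h : (ρ_ (obj a)).inv ≫ μ a [] = cast (List.append_nil a).symm := by
      rw [← cancel_mono (cast (List.append_nil a)), cast_trans]
      exact (Category.assoc _ _ _).trans ((congrArg (fun z => (ρ_ (obj a)).inv ≫ z)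
        (μ_right_unitality a)).trans (Iso.inv_hom_id _))
    refine (Category.assoc _ _ _).trans ((congrArg (fun z => _ ≫ z) h).trans ?_)
    exact congrArg (fun z => _ ≫ z) (Category.id_comp _).symm
  | lam_unit => exact unitDistortion_unit
  | hexagon_left a b c =>
    simp only [term, term_cast]
    refine cancel_μ_μ ?_
    rw [reassoc_of% μ_associativity, reassoc_of% μ_tens, reassoc_of% id_tensor_μ_sigma, reassoc_of% μ_associativity_inv,
      reassoc_of% μ_tens, reassoc_of% μ_sigma_tensor_id, μ_associativity, μ_sigma,
      ← Category.assoc (μ a b ⊗ₘ _), ← DistortedMonoidal.naturality, distortion_tensor_left]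
    simp only [Category.assoc]
  | hexagon_right a b c =>
    simp only [term, term_cast]
    refine cancel_id_μ_μ ?_
    rw [reassoc_of% μ_associativity_inv, reassoc_of% μ_tens, reassoc_of% μ_sigma_tensor_id, reassoc_of% μ_associativity,
      reassoc_of% μ_tens, reassoc_of% id_tensor_μ_sigma, μ_associativity_inv, μ_sigma,
      ← Category.assoc (_ ⊗ₘ μ b c), ← DistortedMonoidal.naturality, distortion_tensor_right]
    simp only [Category.assoc]
  | lam_naturality f => exact unitDistortion.naturality _
  | lam_tensor a b =>
    simp only [term]
    rw [← cancel_epi (μ _ _), μ_tens, ← unitDistortion_tensor]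
    exact unitDistortion.naturality _

noncomputable def map {a b : List V} (f : (a : Free V) ⟶ b) : obj a ⟶ obj b :=
  Quotient.liftOn f term (fun _ _ h => term_rel h)

/-- The evaluation functor of a distorted monoidal category. -/
noncomputable def functor : Free V ⥤ V where
  obj a := obj a
  map f := map f
  map_id _ := rfl
  map_comp f g := by
    induction f using Quotient.inductionOn
    induction g using Quotient.inductionOn
    rfl

theorem functor_map_tens {a b c d : List V} (f : (a : Free V) ⟶ b) (g : (c : Free V) ⟶ d) :
    functor.map (Free.tens f g) = tens (functor.map f) (functor.map g) := by
  induction f using Quotient.inductionOn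
  induction g using Quotient.inductionOn
  rfl

/-- The action of words on a distorted monoidal category. -/
noncomputable def act : Words V ⥤ V := Words.unwrap V ⋙ functor

theorem act_map_wrap_map {a b : List V} (f : (a : Free V) ⟶ b) :
    act.map ((Words.wrap V).map f) = functor.map f :=
  congrArg functor.map (Words.unwrap_map_wrap_map f)

theorem act_map_eqToHom {a b : Words V} (h : a = b) :
    act.map (eqToHom h) = cast (congrArg Words.toList h) := by
  subst h; exact act.map_id _

/-- The strong distorted monoidal structure of the action of words. -/
noncomputable def wordLax : WordLax (act (V := V)) where
  μ a b := μ a.toList b.toList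
  ε := 𝟙 (𝟙_ V)
  μ_natural f g := (μ_tens _ _).symm.trans (congrArg (fun z => _ ≫ z)
    ((act_map_wrap_map _).trans (functor_map_tens _ _)).symm)
  associativity a b c := by
    rw [act_map_eqToHom]
    exact μ_associativity a.toList b.toList c.toList
  left_unitality a := by
    exact (congrArg (fun z => z ≫ _) (id_tensorHom_id _ _)).trans (Category.id_comp _)
  right_unitality a := by
    rw [act_map_eqToHom]
    exact (congrArg (fun z => z ≫ _) (id_tensorHom_id _ _)).trans
      ((Category.id_comp _).trans (μ_right_unitality a.toList))
  map_sigma a b := (congrArg (fun z => _ ≫ z) (act_map_wrap_map _)).trans (μ_sigma _ _)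
  map_lam a := act_map_wrap_map _

instance : (wordLax (V := V)).IsStrong where
  μ_isIso a b := inferInstanceAs (IsIso (μ a.toList b.toList))
  ε_isIso := inferInstanceAs (IsIso (𝟙 (𝟙_ V)))

/-- The unit isomorphism of the action of words. -/
noncomputable def unitIso : 𝟭 V ≅ Words.of V ⋙ act :=
  NatIso.ofComponents (fun X => (ρ_ X).symm) (fun {X Y} f => by
    have h : (Words.of V ⋙ act).map f = f ⊗ₘ 𝟙 (𝟙_ V) := act_map_wrap_map _
    rw [h, tensorHom_id]
    exact (rightUnitor_inv_naturality f))

end Evaluation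

end Distorted

/-! ### Components of pseudoalgebras, models, and the lax morphism of a `σ`-lax functor -/

namespace Distorted

open MonoidalCategory DistortedMonoidal

/-- A morphism of a category as a morphism between words of length one. -/
noncomputable def Words.ofHom {C : Type u} [Category.{v} C] {X Y : C} (f : X ⟶ Y) :
    Words.single X ⟶ Words.single Y :=
  (Words.of C).map f

theorem Words.map_map_tens_ofHom {C : Type u} [Category.{v} C] {D : Type u'} [Category.{v'} D]
    (F : C ⥤ D) {X X' Y Y' : C} (f : X ⟶ X') (g : Y ⟶ Y') :
    (map F).map (tens (ofHom f) (ofHom g)) = tens (ofHom (F.map f)) (ofHom (F.map g)) := by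
  refine ((IsStrict.map F).tens _ _).trans ?_
  refine (Category.id_comp _).trans ((Category.comp_id _).trans ?_)
  exact congrArg₂ tens (map_map_of F f) (map_map_of F g)

theorem Words.map₂_append_single {C : Type u} [Category.{v} C] {D : Type u'} [Category.{v'} D]
    {F G : C ⥤ D} (θ : F ⟶ G) (X Y : C) :
    (map₂ θ).app (append (single X) (single Y)) =
      tens (ofHom (θ.app X)) (ofHom (θ.app Y)) := by
  refine (ext₂_append _ _ _).trans ?_
  refine (Category.id_comp _).trans ((Category.comp_id _).trans ?_)
  exact congrArg₂ tens (map₂_single θ X) (map₂_single θ Y)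

theorem eq_of_comp_eq_id {V : Type u''} [Category.{v''} V] {a b c : V} (i : a ⟶ b) (j : b ⟶ a)
    (k : b ⟶ c) {l : c ⟶ a} {l' : a ⟶ c} (h : j ≫ i = 𝟙 b) (h' : l ≫ l' = 𝟙 c)
    (hk : i ≫ k ≫ l = 𝟙 a) : k = j ≫ l' := by
  have h₁ := congrArg (fun z => j ≫ z ≫ l') hk
  simp only [Category.assoc, h', reassoc_of% h] at h₁
  simpa using h₁

namespace PseudoAlgebra

variable {C : Cat.{v, u}} (A : PseudoAlgebra Tσ.{v, u} C)

/-- The action of a pseudoalgebra, as a functor on words. -/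
def action : Words C ⥤ C := A.act

/-- The unit isomorphism of a pseudoalgebra. -/
def unitWords : 𝟭 C ≅ Words.of C ⋙ A.action := A.unitIso

/-- The multiplication isomorphism of a pseudoalgebra. -/
def multWords : Words.map A.action ⋙ A.action ≅ Words.mult C ⋙ A.action := A.multIso

/-- The unit isomorphism at an object. -/
def unitHom (X : C) : X ⟶ A.action.obj (.single X) := A.unitWords.hom.app X

/-- The inverse of the unit isomorphism at an object. -/
def unitInv (X : C) : A.action.obj (.single X) ⟶ X := A.unitWords.inv.app X

/-- The multiplication isomorphism at a word. -/
def multApp (W : Words (Words C)) :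
    A.action.obj ((Words.map A.action).obj W) ⟶ A.action.obj ((Words.mult C).obj W) :=
  A.multWords.hom.app W

@[simp]
theorem unitHom_unitInv (X : C) : A.unitHom X ≫ A.unitInv X = 𝟙 X :=
  A.unitWords.hom_inv_id_app X

@[simp]
theorem unitHom_unitInv_assoc {X Z : C} (f : X ⟶ Z) : A.unitHom X ≫ A.unitInv X ≫ f = f :=
  A.unitWords.hom_inv_id_app_assoc X f

@[simp]
theorem unitInv_unitHom (X : C) : A.unitInv X ≫ A.unitHom X = 𝟙 _ :=
  A.unitWords.inv_hom_id_app X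

@[simp]
theorem unitInv_unitHom_assoc {X Z : C} (f : A.action.obj (.single X) ⟶ Z) :
    A.unitInv X ≫ A.unitHom X ≫ f = f :=
  A.unitWords.inv_hom_id_app_assoc X f

instance (X : C) : IsIso (A.unitHom X) :=
  ⟨A.unitInv X, A.unitHom_unitInv X, A.unitInv_unitHom X⟩

theorem unitHom_naturality {X Y : C} (f : X ⟶ Y) :
    A.unitHom X ≫ A.action.map (Words.ofHom f) = f ≫ A.unitHom Y :=
  (A.unitWords.hom.naturality f).symm

theorem unitInv_naturality {X Y : C} (f : X ⟶ Y) :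
    A.action.map (Words.ofHom f) ≫ A.unitInv Y = A.unitInv X ≫ f :=
  A.unitWords.inv.naturality f

theorem unitInv_naturality_assoc {X Y Z : C} (f : X ⟶ Y) (g : Y ⟶ Z) :
    A.action.map (Words.ofHom f) ≫ A.unitInv Y ≫ g = A.unitInv X ≫ f ≫ g :=
  (reassoc_of% A.unitInv_naturality f) g

theorem multApp_naturality {W W' : Words (Words C)} (f : W ⟶ W') :
    A.action.map ((Words.map A.action).map f) ≫ A.multApp W' =
      A.multApp W ≫ A.action.map ((Words.mult C).map f) :=
  A.multWords.hom.naturality f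

/-- The left unit axiom solved for the multiplication: at a word of length one it is determined by
the unit. -/
theorem multApp_single (a : Words C) : A.multApp (.single a) =
    A.unitInv (A.action.obj a) ≫ A.action.map (eqToHom (Words.append_nil a).symm) := by
  have h : A.unitHom (A.action.obj a) ≫ A.action.map (eqToHom rfl) ≫ A.multApp (.single a) ≫
    A.action.map (eqToHom (Words.append_nil a)) = 𝟙 _ := A.unit_left a
  have h' : A.unitHom (A.action.obj a) ≫ A.multApp (.single a) ≫
      A.action.map (eqToHom (Words.append_nil a)) = 𝟙 _ := by
    refine Eq.trans ?_ h
    exact congrArg (fun z => _ ≫ z) ((congrArg (fun z => z ≫ _) (A.action.map_id _)).trans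
      (Category.id_comp _)).symm
  exact eq_of_comp_eq_id _ _ _ (A.unitInv_unitHom _)
    ((map_eqToHom_trans A.action _ _ rfl).trans (A.action.map_id _)) h'

/-- The multiplication isomorphism at a word of two words. -/
noncomputable def multTwo (a b : Words C) :
    A.action.obj (.append (.single (A.action.obj a)) (.single (A.action.obj b))) ≅
      A.action.obj (.append a b) := A.multIsoApp a.toList b.toList

theorem multTwo_hom (a b : Words C) : (A.multTwo a b).hom =
    A.multApp (.append (.single a) (.single b)) ≫ A.action.map (eqToHom
      (congrArg (Words.append a) (Words.append_nil b))) :=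
  congrArg (fun z => A.multApp (.append (.single a) (.single b)) ≫ z)
    (eqToHom_map A.action (congrArg (Words.append a) (Words.append_nil b))).symm

end PseudoAlgebra

namespace LaxMorphism

variable {C D : Cat.{v, u}} {A : PseudoAlgebra Tσ.{v, u} C} {B : PseudoAlgebra Tσ.{v, u} D}
  {F : C ⥤ D}

/-- The cell of a lax morphism at a word. -/
def cellApp (f : LaxMorphism A B F) (a : Words C) :
    B.action.obj ((Words.map F).obj a) ⟶ F.obj (A.action.obj a) := f.cell.app a

theorem ext_cellApp {f g : LaxMorphism A B F} (h : ∀ a, f.cellApp a = g.cellApp a) : f = g :=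
  LaxMorphism.ext (NatTrans.ext (funext h))

theorem cellApp_naturality (f : LaxMorphism A B F) {a b : Words C} (g : a ⟶ b) :
    B.action.map ((Words.map F).map g) ≫ f.cellApp b =
      f.cellApp a ≫ F.map (A.action.map g) := f.cell.naturality g

theorem unitHom_cellApp (f : LaxMorphism A B F) (X : C) :
    B.unitHom (F.obj X) ≫ f.cellApp (.single X) = F.map (A.unitHom X) := by
  have h : B.unitHom (F.obj X) ≫ B.action.map (eqToHom rfl) ≫ f.cellApp (.single X) =
    F.map (A.unitHom X) := f.unit X
  refine Eq.trans ?_ h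
  exact congrArg (fun z => _ ≫ z) ((congrArg (fun z => z ≫ _) (B.action.map_id _)).trans
    (Category.id_comp _)).symm

/-- The unit axiom solved for the cell. All lax morphism structures on `F` therefore agree on words
of length one, which is the hypothesis that uniqueness of multiplicative families asks for. -/
theorem cellApp_single (f : LaxMorphism A B F) (X : C) :
    f.cellApp (.single X) = B.unitInv (F.obj X) ≫ F.map (A.unitHom X) := by
  rw [← f.unitHom_cellApp]
  exact (B.unitInv_unitHom_assoc _).symm

end LaxMorphism

/-- A strong distorted monoidal structure on the action of a pseudoalgebra such that the
multiplication is multiplicative. -/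
structure Model (M : DistMon.{v, u}) (A : PseudoAlgebra Tσ.{v, u} M.carrier) where
  lax : WordLax A.action
  [isStrong : lax.IsStrong]
  mult : WordLax.IsMultiplicative (lax.precomp (.map A.action)) (lax.precomp .mult) A.multApp

attribute [instance] Model.isStrong

/-- The pseudoalgebra of a distorted monoidal category. -/
noncomputable def DistMon.pseudoAlgebra (M : DistMon.{v, u}) :
    PseudoAlgebra Tσ.{v, u} M.carrier :=
  .ofAction Evaluation.wordLax Evaluation.unitIso

/-- One of the two sources of models, the other being `PseudoAlgebra.toModel`. Lax morphisms are
compared with `σ`-lax structures for arbitrary models, so that both can be used in the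
biequivalence. -/
noncomputable def DistMon.model (M : DistMon.{v, u}) : Model M M.pseudoAlgebra where
  lax := Evaluation.wordLax (V := M.carrier)
  isStrong := inferInstanceAs (Evaluation.wordLax (V := M.carrier)).IsStrong
  mult := PseudoAlgebra.isMultiplicative_multHom Evaluation.wordLax Evaluation.unitIso

namespace Model

variable {M N K : DistMon.{v, u}} {A : PseudoAlgebra Tσ.{v, u} M.carrier}
  {B : PseudoAlgebra Tσ.{v, u} N.carrier} {E : PseudoAlgebra Tσ.{v, u} K.carrier}

section ToLax

variable (m : Model M A) (n : Model N B) {F G : M.carrier ⥤ N.carrier} (φ : SigmaLax M N F)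
  (ψ : SigmaLax M N G)

/-- The cell at a word of length one. -/
noncomputable def cellSingle (A : PseudoAlgebra Tσ.{v, u} M.carrier) (B : PseudoAlgebra Tσ.{v, u} N.carrier)
    (F : M.carrier ⥤ N.carrier) (X : M.carrier) :
    (Words.map F ⋙ B.action).obj (.single X) ⟶ (A.action ⋙ F).obj (.single X) :=
  B.unitInv (F.obj X) ≫ F.map (A.unitHom X)

theorem cellSingle_naturality {X Y : M.carrier} (f : X ⟶ Y) :
    (Words.map F ⋙ B.action).map ((Words.of M.carrier).map f) ≫ cellSingle A B F Y =
      cellSingle A B F X ≫ (A.action ⋙ F).map ((Words.of M.carrier).map f) := by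
  have h := congrArg B.action.map (Words.map_map_of F f)
  refine (congrArg (fun z => z ≫ _) h).trans ?_
  refine (B.unitInv_naturality_assoc (F.map f) _).trans ?_
  refine Eq.trans ?_ (Category.assoc _ _ _).symm
  refine congrArg (fun z => _ ≫ z) ?_
  exact (F.map_comp _ _).symm.trans ((congrArg F.map (A.unitHom_naturality f)).symm.trans
    (F.map_comp _ _))

/-- The multiplication axiom of a lax morphism at `[a]`, with functors and objects made variable so
that the transports can be substituted away. In the application `h₁` is naturality of the inverse
unit of `B`, `h₂` cancels the unit of `A`, and `h₃` moves the cell along `a = a ++ []`. -/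
theorem mult_aux {W : Type u} [Category.{v} W] {W' : Type u'} [Category.{v'} W']
    {V V' : Type u''} [Category.{v''} V] [Category.{v''} V'] (P : W' ⥤ W) (B : W ⥤ V)
    (A : W' ⥤ V') (F : V' ⥤ V) {a a' : W'} {w w' x : W} {y : V'} (p : B.obj w ⟶ B.obj x)
    (i : B.obj x ⟶ F.obj (A.obj a)) (s : A.obj a ⟶ y) (j : y ⟶ A.obj a)
    (i₀ : B.obj w ⟶ B.obj (P.obj a)) (c : B.obj (P.obj a) ⟶ F.obj (A.obj a))
    (c' : B.obj (P.obj a') ⟶ F.obj (A.obj a')) (h : a = a') (e : x = x) (e' : w = w)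
    (q₁ : P.obj a = w') (q₂ : w' = P.obj a') (h₁ : p ≫ i = i₀ ≫ c) (h₂ : s ≫ j = 𝟙 _)
    (h₃ : (P ⋙ B).map (eqToHom h) ≫ c' = c ≫ (A ⋙ F).map (eqToHom h)) :
    p ≫ B.map (eqToHom e) ≫ (i ≫ F.map s) ≫ F.map (j ≫ A.map (eqToHom h)) =
      B.map (eqToHom e') ≫ (i₀ ≫ B.map (eqToHom q₁)) ≫ B.map (eqToHom q₂) ≫ c' := by
  subst h q₁
  simp only [eqToHom_refl, CategoryTheory.Functor.map_id, Category.id_comp, Category.comp_id]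
    at h₃ ⊢
  rw [h₃.trans (Category.comp_id c), Category.assoc, ← F.map_comp, h₂, F.map_id, Category.comp_id,
    h₁]

/-- The cell of the lax morphism given by a `σ`-lax monoidal functor. -/
noncomputable def cell : Words.map F ⋙ B.action ⟶ A.action ⋙ F :=
  WordLax.extend (n.lax.precomp (.map F)) (m.lax.postcomp φ) (cellSingle A B F)
    cellSingle_naturality

theorem cell_single (X : M.carrier) : (cell m n φ).app (.single X) = cellSingle A B F X :=
  WordLax.extendApp_single _ _ _ X

theorem isMultiplicative_cell : WordLax.IsMultiplicative (n.lax.precomp (.map F))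
    (m.lax.postcomp φ) (fun a => (cell m n φ).app a) :=
  WordLax.isMultiplicative_extendApp _ _ _

/-- The lax morphism given by a `σ`-lax monoidal functor. -/
noncomputable def toLax : LaxMorphism A B F where
  cell := cell m n φ
  unit X := by
    have h := cell_single m n φ X
    refine (congrArg (fun z => B.unitHom (F.obj X) ≫ B.action.map (eqToHom rfl) ≫ z) h).trans ?_
    refine (congrArg (fun z => _ ≫ z) ((congrArg (fun z => z ≫ _) (B.action.map_id _)).trans
      (Category.id_comp _))).trans ?_
    exact B.unitHom_unitInv_assoc _
  mult X := by
    -- Each side of the axiom is a composite of four multiplicative families indexed by words of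
    -- words, so comparison at words `[a]` suffices.
    have hc := isMultiplicative_cell m n φ
    have h₁ := n.lax.isMultiplicative_ext₂ (Functor.whiskerRight (cell m n φ) (Words.of N.carrier))
    have h₂ := n.lax.isMultiplicative_eqToHom (P := Words.map (A.action ⋙ F))
      (Q := Words.map A.action ⋙ Words.map F) (.map _) (.comp (.map _) (.map _))
      (Functor.congr_obj (Words.map_comp _ _))
    have h₃ := hc.precomp (.map A.action)
    have h₄ := m.mult.postcomp φ
    have k₁ := n.lax.isMultiplicative_eqToHom (P := Words.map (Words.map F ⋙ B.action))
      (Q := Words.map (Words.map F) ⋙ Words.map B.action) (.map _) (.comp (.map _) (.map _))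
      (Functor.congr_obj (Words.map_comp _ _))
    have k₂ := n.mult.precomp (.map (Words.map F))
    have k₃ := n.lax.isMultiplicative_eqToHom (P := Words.map (Words.map F) ⋙ Words.mult N.carrier)
      (Q := Words.mult M.carrier ⋙ Words.map F) (.comp (.map _) .mult) (.comp .mult (.map _))
      (Functor.congr_obj (Words.mult_naturality F))
    have k₄ := hc.precomp (.mult (C := M.carrier))
    rw [WordLax.postcomp_precomp, WordLax.precomp_precomp] at h₃ k₄
    rw [WordLax.precomp_precomp, WordLax.precomp_precomp] at k₂
    refine (h₁.comp (h₂.comp (h₃.comp h₄))).unique (k₁.comp (k₂.comp (k₃.comp k₄)))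
      (fun a => ?_) X
    have e := congrArg B.action.map (Words.map₂_single (cell m n φ) a)
    have e₁ := cell_single m n φ (A.action.obj a)
    have e₂ := congrArg F.map (A.multApp_single a)
    have e₃ := B.multApp_single ((Words.map F).obj a)
    have e₄ := WordLax.app_eqToHom (fun a => (cell m n φ).app a) (Words.append_nil a).symm
    have e₅ := B.unitInv_naturality ((cell m n φ).app a)
    refine (congrArg (fun z => z ≫ _) e).trans ?_
    refine (congrArg (fun z => _ ≫ B.action.map (eqToHom rfl) ≫ z ≫ _) e₁).trans ?_
    refine (congrArg (fun z => _ ≫ B.action.map (eqToHom rfl) ≫ _ ≫ z) e₂).trans ?_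
    refine Eq.trans ?_ (congrArg (fun z => B.action.map (eqToHom rfl) ≫ z ≫ _) e₃).symm
    refine mult_aux (Words.map F) B.action A.action F _ _ _ _ _ _ _ _ _ _ _ _ e₅
      (A.unitHom_unitInv _) e₄

end ToLax

end Model

end Distorted

/-! ### Functoriality of `toLax`, and the interpretation of the operations -/

namespace Distorted

open MonoidalCategory DistortedMonoidal

theorem WordLax.IsMultiplicative.congr {C : Type u'} [Category.{v'} C] {V : Type u''}
    [Category.{v''} V] [MonoidalCategory V] [DistortedMonoidal V] {G H : Words C ⥤ V}
    {p : WordLax G} {q : WordLax H} {θ θ' : ∀ a, G.obj a ⟶ H.obj a}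
    (h : IsMultiplicative p q θ) (e : ∀ a, θ a = θ' a) : IsMultiplicative p q θ' :=
  (funext e : θ = θ') ▸ h

theorem WordLax.precomp_pairing_single {C : Type u} [Category.{v} C] {D : Type u'}
    [Category.{v'} D] {V : Type u''} [Category.{v''} V] [MonoidalCategory V] [DistortedMonoidal V]
    {G : Words D ⥤ V} (p : WordLax G) (F : C ⥤ D) {X Y : C} {S T : V}
    (e : S ⟶ G.obj (.single (F.obj X))) (f : T ⟶ G.obj (.single (F.obj Y))) :
    (p.precomp (.map F)).pairing (a := .single X) (b := .single Y) e f = p.pairing e f := by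
  have h : (p.precomp (.map F)).μ (.single X) (.single Y) =
      p.μ (.single (F.obj X)) (.single (F.obj Y)) :=
    (congrArg (fun z => p.μ (.single (F.obj X)) (.single (F.obj Y)) ≫ z) (G.map_id _)).trans
      (Category.comp_id _)
  exact congrArg (fun z => (e ⊗ₘ f) ≫ z) h

namespace WordLax

variable {C : Type u'} [Category.{v'} C] {V : Type u''} [Category.{v''} V] [MonoidalCategory V]
  [DistortedMonoidal V] {G : Words C ⥤ V} (p : WordLax G) [p.IsStrong] {X Y Z : V}
  {a b c : Words C} (e : X ≅ G.obj a) (f : Y ≅ G.obj b) (g : Z ≅ G.obj c)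

/-- `associator_pairing` with all pairings inverted, the direction in which `Interpretation` states
its coherence conditions. -/
theorem inv_pairing_associator :
    inv (p.μ (.append a b) c) ≫ (inv (p.pairing e.hom f.hom) ⊗ₘ g.inv) ≫ (α_ X Y Z).hom =
      G.map (eqToHom (Words.append_assoc a b c)) ≫ inv (p.μ a (.append b c)) ≫
        (e.inv ⊗ₘ inv (p.pairing f.hom g.hom)) := by
  have h := p.associator_pairing e.hom f.hom g.hom
  rw [← cancel_epi (p.pairing (p.pairing e.hom f.hom) g.hom), ← reassoc_of% h]
  simp [pairing]

theorem inv_leftUnitor_pairing :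
    inv (p.μ .nil a) ≫ (inv p.ε ⊗ₘ e.inv) ≫ (λ_ X).hom = e.inv := by
  have h := p.leftUnitor_pairing e.hom
  rw [← cancel_mono e.hom, Category.assoc, Category.assoc, h, pairing,
    tensorHom_comp_tensorHom_assoc]
  simp

theorem inv_rightUnitor_pairing :
    inv (p.μ a .nil) ≫ (e.inv ⊗ₘ inv p.ε) ≫ (ρ_ X).hom =
      G.map (eqToHom (Words.append_nil a)) ≫ e.inv := by
  have h := p.rightUnitor_pairing e.hom
  rw [← cancel_mono e.hom, Category.assoc, Category.assoc, h, pairing, Category.assoc,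
    tensorHom_comp_tensorHom_assoc]
  simp

end WordLax

namespace LaxMorphism

variable {C D : Cat.{v, u}} {A : PseudoAlgebra Tσ.{v, u} C} {B : PseudoAlgebra Tσ.{v, u} D}
  {F : C ⥤ D}

/-- The cell of a lax morphism at a word of length two. -/
def cellPair (f : LaxMorphism A B F) (X Y : C) :
    B.action.obj (.append (.single (F.obj X)) (.single (F.obj Y))) ⟶
      F.obj (A.action.obj (.append (.single X) (.single Y))) :=
  f.cellApp (.append (.single X) (.single Y))

/-- The cell of a lax morphism at the empty word. -/
def cellNil (f : LaxMorphism A B F) : B.action.obj .nil ⟶ F.obj (A.action.obj .nil) :=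
  f.cellApp .nil

end LaxMorphism

namespace Model

variable {M N K : DistMon.{v, u}} {A : PseudoAlgebra Tσ.{v, u} M.carrier}
  {B : PseudoAlgebra Tσ.{v, u} N.carrier} {E : PseudoAlgebra Tσ.{v, u} K.carrier}

section Functoriality

variable (m : Model M A) (n : Model N B) (k : Model K E) {F G : M.carrier ⥤ N.carrier}
  {F₁ : N.carrier ⥤ K.carrier} (φ : SigmaLax M N F) (φ' : SigmaLax M N G) (ψ : SigmaLax N K F₁)

theorem isMultiplicative_toLax : WordLax.IsMultiplicative (n.lax.precomp (.map F))
    (m.lax.postcomp φ) (toLax m n φ).cellApp :=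
  isMultiplicative_cell m n φ

/-- On letters the unit axiom already fixes `f`, so multiplicativity of its cell is all that has to
be checked. Strict functoriality and surjectivity of `toLax` both follow from this. -/
theorem toLax_unique (f : LaxMorphism A B F) (h : WordLax.IsMultiplicative
    (n.lax.precomp (.map F)) (m.lax.postcomp φ) f.cellApp) : toLax m n φ = f :=
  LaxMorphism.ext_cellApp ((isMultiplicative_toLax m n φ).unique h fun X =>
    ((toLax m n φ).cellApp_single X).trans (f.cellApp_single X).symm)

theorem toLax_id : toLax m m (SigmaLax.id M) = LaxMorphism.id A := by
  refine toLax_unique m m _ _ ?_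
  have h := m.lax.isMultiplicative_eqToHom (P := Words.map (𝟭 M.carrier)) (Q := 𝟭 _)
    (.map _) .id (Functor.congr_obj (Tσ.map_id M.carrier))
  rw [WordLax.precomp_id] at h
  rw [WordLax.postcomp_id]
  refine h.congr fun a => ?_
  exact (congrArg A.action.map (eqToHom_app (Tσ.map_id M.carrier) a)).symm

theorem toLax_comp :
    toLax m k (φ.comp ψ) = (toLax m n φ).comp (toLax n k ψ) := by
  refine toLax_unique m k _ _ ?_
  have h₁ := k.lax.isMultiplicative_eqToHom (P := Words.map (F ⋙ F₁))
    (Q := Words.map F ⋙ Words.map F₁) (.map _) (.comp (.map _) (.map _))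
    (Functor.congr_obj (Words.map_comp _ _))
  have h₂ := (isMultiplicative_toLax n k ψ).precomp (.map F)
  have h₃ := (isMultiplicative_toLax m n φ).postcomp ψ
  rw [WordLax.postcomp_precomp, WordLax.precomp_precomp] at h₂
  rw [WordLax.postcomp_comp]
  refine (h₁.comp (h₂.comp h₃)).congr fun a => ?_
  refine Eq.trans ?_ (LaxMorphism.compCell_app (toLax m n φ) (toLax n k ψ) a).symm
  exact congrArg (fun z => z ≫ _) (eqToHom_map E.action _)

/-- Both composites of the square are multiplicative; monoidality of `θ` is used for one of them. At
`[X]` the square reduces to naturality of `θ` and of the inverse unit of `B`. -/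
theorem isTransformation_of_isMonoidal {φ : SigmaLax M N F} {φ' : SigmaLax M N G} {θ : F ⟶ G}
    (h : IsMonoidal φ φ' θ) : IsTransformation (toLax m n φ) (toLax m n φ') θ := by
  have h₁ := (isMultiplicative_toLax m n φ).comp (m.lax.isMultiplicative_of_isMonoidal h)
  have h₂ := (n.lax.isMultiplicative_ext₂ (Functor.whiskerRight θ (Words.of N.carrier))).comp
    (isMultiplicative_toLax m n φ')
  refine h₁.unique h₂ fun X => ?_
  have e := congrArg B.action.map (Words.map₂_single θ X)
  refine Eq.trans ?_ (congrArg (fun z => z ≫ _) e).symm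
  refine (congrArg (fun z => z ≫ _) ((toLax m n φ).cellApp_single X)).trans ?_
  refine Eq.trans ?_ (congrArg (fun z => _ ≫ z) ((toLax m n φ').cellApp_single X)).symm
  refine Eq.trans ?_ (B.unitInv_naturality_assoc (θ.app X) _).symm
  exact (Category.assoc _ _ _).trans (congrArg (fun z => _ ≫ z) (θ.naturality _))

end Functoriality

section Interpretation

variable (m : Model M A) (n : Model N B) {F G : M.carrier ⥤ N.carrier}

/-- The tensor product in terms of the action. -/
noncomputable def tensorTo (X Y : M.carrier) : X ⊗ Y ⟶ A.action.obj (.append (.single X) (.single Y)) :=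
  m.lax.pairing (A.unitHom X) (A.unitHom Y)

instance (X Y : M.carrier) : IsIso (m.tensorTo X Y) := by unfold tensorTo; infer_instance

theorem tensorTo_naturality {X X' Y Y' : M.carrier} (f : X ⟶ X') (g : Y ⟶ Y') :
    m.tensorTo X Y ≫ A.action.map (Words.tens (Words.ofHom f) (Words.ofHom g)) =
      (f ⊗ₘ g) ≫ m.tensorTo X' Y' := by
  rw [tensorTo, tensorTo, ← WordLax.pairing_map, A.unitHom_naturality, A.unitHom_naturality,
    WordLax.tensor_pairing]

/-- The multiplication at a word of two words. -/
theorem tensorTo_multApp (a b : Words M.carrier) :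
    m.tensorTo (A.action.obj a) (A.action.obj b) ≫
      A.multApp (.append (.single a) (.single b)) =
    m.lax.μ a b ≫ A.action.map (eqToHom
      (congrArg (Words.append a) (Words.append_nil b).symm)) := by
  -- Multiplicativity of the multiplication at `[a]` and `[b]` is tested on the units. By
  -- `multApp_single` unit and multiplication compose to a transport on each factor, which leaves
  -- `m.lax.μ a b`.
  have h := m.mult.pairing (a := .single a) (b := .single b) (A.unitHom (A.action.obj a))
    (A.unitHom (A.action.obj b))
  have e : ∀ c, A.unitHom (A.action.obj c) ≫ A.multApp (.single c) =
      A.action.map (eqToHom (Words.append_nil c).symm) := fun c =>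
    (congrArg (fun z => _ ≫ z) (A.multApp_single c)).trans (A.unitHom_unitInv_assoc _)
  have h' := h.trans (congrArg₂ (fun x y => (m.lax.precomp .mult).pairing x y) (e a) (e b))
  have h₁ := (m.lax.precomp_pairing_single A.action (A.unitHom (A.action.obj a))
    (A.unitHom (A.action.obj b))).symm
  refine (congrArg (fun z => z ≫ _) h₁).trans (h'.trans ?_)
  refine (Category.assoc _ _ _).symm.trans ?_
  refine (congrArg (fun z => z ≫ _) (m.lax.μ_natural _ _)).trans ?_
  refine (Category.assoc _ _ _).trans (congrArg (fun z => _ ≫ z) ?_)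
  refine (congrArg (fun z => A.action.map z ≫ _) (Words.tens_eqToHom _ _)).trans ?_
  exact PseudoAlgebra.map_eqToHom_trans A.action _ _ _

/-- Multiplicativity of the cell at `[X]` and `[Y]`, tested on the units. As `tensorTo` is
invertible, `μ` and the cell at `[X, Y]` determine each other; `ε_postcomp_eq` does the same for `ε`
and the cell at `[]`. -/
theorem μ_postcomp_eq (φ : SigmaLax M N F) (X Y : M.carrier) :
    φ.lax.μ X Y ≫ F.map (m.tensorTo X Y) =
      n.tensorTo (F.obj X) (F.obj Y) ≫ (toLax m n φ).cellPair X Y := by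
  have h := (isMultiplicative_toLax m n φ).pairing (a := .single X) (b := .single Y)
    (B.unitHom (F.obj X)) (B.unitHom (F.obj Y))
  have h₁ := (n.lax.precomp_pairing_single F (B.unitHom (F.obj X)) (B.unitHom (F.obj Y))).symm
  have h₂ := congrArg₂ (fun x y => (m.lax.postcomp φ).pairing (a := .single X) (b := .single Y) x y)
    ((toLax m n φ).unitHom_cellApp X) ((toLax m n φ).unitHom_cellApp Y)
  refine Eq.trans ?_ (((congrArg (fun z => z ≫ _) h₁).trans h).trans h₂).symm
  let := φ.lax
  change Functor.LaxMonoidal.μ F X Y ≫ F.map (m.tensorTo X Y) =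
    (F.map (A.unitHom X) ⊗ₘ F.map (A.unitHom Y)) ≫ Functor.LaxMonoidal.μ F _ _ ≫
      F.map (m.lax.μ (.single X) (.single Y))
  rw [Functor.LaxMonoidal.μ_natural_assoc, ← F.map_comp]
  rfl

theorem ε_postcomp_eq (φ : SigmaLax M N F) :
    φ.lax.ε ≫ F.map m.lax.ε = n.lax.ε ≫ (toLax m n φ).cellNil := by
  have h := (isMultiplicative_toLax m n φ).unit
  have h₁ : (n.lax.precomp (.map F)).ε = n.lax.ε :=
    (congrArg (fun z => n.lax.ε ≫ z) (B.action.map_id _)).trans (Category.comp_id _)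
  exact h.symm.trans (congrArg (fun z => z ≫ (toLax m n φ).cellNil) h₁)

/-- Only the components of the transformation square at `[]` and `[X, Y]` enter. They translate into
the two monoidality conditions once the invertible comparisons of the model are cancelled. -/
theorem isMonoidal_of_isTransformation {φ : SigmaLax M N F} {φ' : SigmaLax M N G} {θ : F ⟶ G}
    (h : IsTransformation (toLax m n φ) (toLax m n φ') θ) : IsMonoidal φ φ' θ := by
  let := φ.lax
  let := φ'.lax
  have h₁ : (toLax m n φ).cellNil ≫ θ.app (A.action.obj .nil) = (toLax m n φ').cellNil := by
    refine (h .nil).trans ?_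
    refine (congrArg (fun z => B.action.map z ≫ _) (Words.ext₂_nil _)).trans ?_
    exact (congrArg (fun z => z ≫ _) (B.action.map_id _)).trans (Category.id_comp _)
  have h₂ : ∀ X Y, (toLax m n φ).cellPair X Y ≫ θ.app _ =
      B.action.map (Words.tens (Words.ofHom (θ.app X)) (Words.ofHom (θ.app Y))) ≫
        (toLax m n φ').cellPair X Y := by
    intro X Y
    exact (h (.append (.single X) (.single Y))).trans
      (congrArg (fun z => B.action.map z ≫ _) (Words.map₂_append_single θ X Y))
  constructor
  · change φ.lax.ε ≫ θ.app (𝟙_ M.carrier) = φ'.lax.ε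
    rw [← cancel_mono (G.map m.lax.ε), Category.assoc, ← θ.naturality, ← Category.assoc,
      m.ε_postcomp_eq n, m.ε_postcomp_eq n, Category.assoc, h₁]
  · intro X Y
    rw [← cancel_mono (G.map (m.tensorTo X Y)), Category.assoc, ← θ.naturality, ← Category.assoc,
      m.μ_postcomp_eq n, Category.assoc, Category.assoc, m.μ_postcomp_eq n, h₂,
      ← reassoc_of% n.tensorTo_naturality]

/-- `μ` and `ε` are recovered from the cell at words of length two and zero, and the other fields of
a `σ`-lax structure are propositions. -/
theorem toLax_injective : Function.Injective (toLax m n (F := F)) := by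
  intro φ φ' h
  have hμ : φ.lax.μ = φ'.lax.μ := by
    funext X Y
    rw [← cancel_mono (F.map (m.tensorTo X Y)), m.μ_postcomp_eq n, m.μ_postcomp_eq n, h]
  have hε : φ.lax.ε = φ'.lax.ε := by
    rw [← cancel_mono (F.map m.lax.ε), m.ε_postcomp_eq n, m.ε_postcomp_eq n, h]
  exact SigmaLax.ext (Functor.LaxMonoidal.ext hε hμ)

/-- The tensor product in terms of the action, as an isomorphism. -/
noncomputable def tensorIso (X Y : M.carrier) :
    A.action.obj (.append (.single X) (.single Y)) ≅ X ⊗ Y := (asIso (m.tensorTo X Y)).symm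

/-- The unit object in terms of the action, as an isomorphism. -/
noncomputable def unitIso : A.action.obj .nil ≅ 𝟙_ M.carrier := (asIso m.lax.ε).symm

/-- This ties the structure maps of the model to the multiplication of the pseudoalgebra. Coherence
conditions stated through the latter thereby become statements about pairings. -/
theorem tensorTo_multTwo (a b : Words M.carrier) :
    m.tensorTo (A.action.obj a) (A.action.obj b) ≫ (A.multTwo a b).hom = m.lax.μ a b := by
  rw [A.multTwo_hom]
  have h := congrArg (fun z => z ≫ A.action.map (eqToHom
      (congrArg (Words.append a) (Words.append_nil b)))) (m.tensorTo_multApp a b)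
  refine (Category.assoc _ _ _).symm.trans (h.trans ?_)
  refine (Category.assoc _ _ _).trans ?_
  exact (congrArg (fun z => _ ≫ z) ((PseudoAlgebra.map_eqToHom_trans A.action _ _ rfl).trans
    (A.action.map_id _))).trans (Category.comp_id _)

theorem multTwo_inv_tensorIso_hom (a b : Words M.carrier) :
    (A.multTwo a b).inv ≫ (m.tensorIso (A.action.obj a) (A.action.obj b)).hom =
      inv (m.lax.μ a b) := by
  rw [Iso.inv_comp_eq, IsIso.eq_comp_inv, ← m.tensorTo_multTwo a b]
  exact IsIso.inv_hom_id_assoc _ _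

theorem interpretation_associator (X Y Z : M.carrier) :
    (A.multTwo (.append (.single X) (.single Y)) (.single Z)).inv ≫ (m.tensorIso _ _).hom ≫
        ((m.tensorIso X Y).hom ⊗ₘ A.unitInv Z) ≫ (α_ X Y Z).hom =
      (A.multTwo (.single X) (.append (.single Y) (.single Z))).inv ≫ (m.tensorIso _ _).hom ≫
        (A.unitInv X ⊗ₘ (m.tensorIso Y Z).hom) := by
  have h₁ := m.multTwo_inv_tensorIso_hom (.append (.single X) (.single Y)) (.single Z)
  have h₂ := m.multTwo_inv_tensorIso_hom (.single X) (.append (.single Y) (.single Z))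
  have h := m.lax.inv_pairing_associator (A.unitWords.app X) (A.unitWords.app Y)
    (A.unitWords.app Z)
  rw [reassoc_of% h₁, reassoc_of% h₂]
  refine h.trans ?_
  -- For three letters both bracketings compute to the same word, so the remaining transport is an
  -- identity.
  exact (congrArg (fun z => z ≫ _) (A.action.map_id _)).trans (Category.id_comp _)

theorem interpretation_leftUnitor (X : M.carrier) :
    (A.multTwo .nil (.single X)).inv ≫ (m.tensorIso _ _).hom ≫
      (m.unitIso.hom ⊗ₘ A.unitInv X) ≫ (λ_ X).hom = A.unitInv X := by
  rw [reassoc_of% (m.multTwo_inv_tensorIso_hom .nil (.single X))]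
  exact m.lax.inv_leftUnitor_pairing (A.unitWords.app X)

theorem interpretation_rightUnitor (X : M.carrier) :
    (A.multTwo (.single X) .nil).inv ≫ (m.tensorIso _ _).hom ≫
      (A.unitInv X ⊗ₘ m.unitIso.hom) ≫ (ρ_ X).hom = A.unitInv X := by
  rw [reassoc_of% (m.multTwo_inv_tensorIso_hom (.single X) .nil)]
  refine (m.lax.inv_rightUnitor_pairing (A.unitWords.app X)).trans ?_
  exact (congrArg (fun z => z ≫ _) (A.action.map_id _)).trans (Category.id_comp _)

/-- The interpretation of the operations by a model. -/
noncomputable def interpretation : Interpretation M A where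
  tensor X Y := m.tensorIso X Y
  unit := m.unitIso
  tensorHom {X X' Y Y'} f g := by
    change A.action.map (Words.pair f g) ≫ inv (m.tensorTo X' Y') = inv (m.tensorTo X Y) ≫ _
    rw [IsIso.comp_inv_eq, Category.assoc, IsIso.eq_inv_comp, Words.pair_eq_tens]
    exact m.tensorTo_naturality f g
  distortion X Y := by
    change A.action.map (Words.sigma (.single X) (.single Y)) ≫ inv (m.tensorTo Y X) =
      inv (m.tensorTo X Y) ≫ _
    rw [IsIso.comp_inv_eq, Category.assoc, IsIso.eq_inv_comp]
    exact (m.lax.distortion_pairing _ _).symm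
  unitDistortion X := (m.lax.unitDistortion_pairing (A.unitHom X)).symm
  associator := m.interpretation_associator
  leftUnitor := m.interpretation_leftUnitor
  rightUnitor := m.interpretation_rightUnitor

theorem interprets (φ : SigmaLax M N F) :
    Interprets m.interpretation n.interpretation φ (toLax m n φ) where
  tensor X Y := by
    change inv (n.tensorTo _ _) ≫ φ.lax.μ X Y = (toLax m n φ).cellPair X Y ≫
      F.map (inv (m.tensorTo X Y))
    rw [IsIso.inv_comp_eq, ← Category.assoc, ← m.μ_postcomp_eq n, Category.assoc, ← F.map_comp]
    simp
  unit := by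
    change inv n.lax.ε ≫ φ.lax.ε = (toLax m n φ).cellNil ≫ F.map (inv m.lax.ε)
    rw [IsIso.inv_comp_eq, ← Category.assoc, ← m.ε_postcomp_eq n, Category.assoc, ← F.map_comp]
    simp

end Interpretation

end Model

end Distorted

/-! ### From lax morphisms back to `σ`-lax structures -/

namespace Distorted

open MonoidalCategory DistortedMonoidal

namespace WordLax

variable {M N : DistMon.{v, u}} {F : M.carrier ⥤ N.carrier} {G : Words M.carrier ⥤ N.carrier}
  {H : Words M.carrier ⥤ M.carrier}

/-- A transformation into a composite functor that is multiplicative for given structure maps on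
the second factor and defined on enough objects. -/
structure Transport (p : WordLax G) (q : WordLax H) (θ : G ⟶ H ⋙ F) where
  μ (X Y : M.carrier) : F.obj X ⊗ F.obj Y ⟶ F.obj (X ⊗ Y)
  ε : 𝟙_ N.carrier ⟶ F.obj (𝟙_ M.carrier)
  μ_natural {X X' Y Y' : M.carrier} (f : X ⟶ X') (g : Y ⟶ Y') :
    (F.map f ⊗ₘ F.map g) ≫ μ X' Y' = μ X Y ≫ F.map (f ⊗ₘ g)
  unit : p.ε ≫ θ.app .nil = ε ≫ F.map q.ε
  tensor (a b : Words M.carrier) : p.μ a b ≫ θ.app (.append a b) =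
    (θ.app a ⊗ₘ θ.app b) ≫ μ (H.obj a) (H.obj b) ≫ F.map (q.μ a b)
  single (X : M.carrier) : X ≅ H.obj (.single X)
  lift (X : M.carrier) : F.obj X ⟶ G.obj (.single X)
  lift_app (X : M.carrier) : lift X ≫ θ.app (.single X) = F.map (single X).hom

namespace Transport

variable {p : WordLax G} {q : WordLax H} {θ : G ⟶ H ⋙ F} (t : Transport p q θ)

/-- Lifts through `θ` can be paired: `lift` starts on letters and this lemma continues to tensor
products. An axiom for `F` can thus be checked on the `G` side, where `p` already satisfies it. -/
theorem pairing_app {S T : N.carrier} {X Y : M.carrier} {a b : Words M.carrier}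
    {x : S ⟶ G.obj a} {y : T ⟶ G.obj b} {r : S ⟶ F.obj X} {s : T ⟶ F.obj Y} {e : X ⟶ H.obj a}
    {f : Y ⟶ H.obj b} (hx : x ≫ θ.app a = r ≫ F.map e) (hy : y ≫ θ.app b = s ≫ F.map f) :
    p.pairing x y ≫ θ.app (.append a b) =
      ((r ⊗ₘ s) ≫ t.μ X Y) ≫ F.map (q.pairing e f) := by
  rw [pairing, pairing, Category.assoc, t.tensor, F.map_comp, Category.assoc, ← reassoc_of%
    t.μ_natural]
  refine (reassoc_of% (tensorHom_comp_tensorHom x y (θ.app a) (θ.app b))) _ |>.trans ?_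
  rw [hx, hy, tensorHom_comp_tensorHom_assoc]

theorem lift_app' (X : M.carrier) :
    t.lift X ≫ θ.app (.single X) = 𝟙 (F.obj X) ≫ F.map (t.single X).hom :=
  (t.lift_app X).trans (Category.id_comp _).symm

/-- After composition with `F` of a threefold pairing, invertible because `q` is strong, both sides
are `θ` applied to nested pairings of `p`. There `q` has turned the associator of `M` into a
transport, and associativity of `p` with naturality of `θ` concludes. -/
theorem associativity [q.IsStrong] (X Y Z : M.carrier) :
    ((t.μ X Y ⊗ₘ 𝟙 (F.obj Z)) ≫ t.μ (X ⊗ Y) Z) ≫ F.map (α_ X Y Z).hom =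
      (α_ _ _ _).hom ≫ (𝟙 (F.obj X) ⊗ₘ t.μ Y Z) ≫ t.μ X (Y ⊗ Z) := by
  have hXY := t.pairing_app (t.lift_app' X) (t.lift_app' Y)
  have hYZ := t.pairing_app (t.lift_app' Y) (t.lift_app' Z)
  rw [id_tensorHom_id, Category.id_comp] at hXY hYZ
  have h₁ := t.pairing_app hXY (t.lift_app' Z)
  have h₂ := t.pairing_app (t.lift_app' X) hYZ
  have hp := p.associator_pairing (t.lift X) (t.lift Y) (t.lift Z)
  have hq := q.associator_pairing (t.single X).hom (t.single Y).hom (t.single Z).hom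
  rw [← cancel_mono (F.map (q.pairing (t.single X).hom (q.pairing (t.single Y).hom
    (t.single Z).hom))), Category.assoc, ← F.map_comp, hq, F.map_comp]
  simp only [Category.assoc] at h₁ h₂ ⊢
  rw [← reassoc_of% h₁, ← h₂, reassoc_of% hp, θ.naturality]
  rfl

theorem left_unitality (X : M.carrier) :
    ((t.ε ⊗ₘ 𝟙 (F.obj X)) ≫ t.μ (𝟙_ M.carrier) X) ≫ F.map (λ_ X).hom = (λ_ (F.obj X)).hom := by
  have h := t.pairing_app t.unit (t.lift_app' X)
  rw [← p.leftUnitor_pairing, ← q.leftUnitor_pairing] at h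
  rw [← cancel_mono (F.map (t.single X).hom), Category.assoc, ← F.map_comp, ← h, Category.assoc]
  exact congrArg (fun z => _ ≫ z) (t.lift_app X)

theorem right_unitality (X : M.carrier) :
    ((𝟙 (F.obj X) ⊗ₘ t.ε) ≫ t.μ X (𝟙_ M.carrier)) ≫ F.map (ρ_ X).hom = (ρ_ (F.obj X)).hom := by
  have h := t.pairing_app (t.lift_app' X) t.unit
  rw [← cancel_mono (F.map (t.single X).hom), Category.assoc, ← F.map_comp,
    q.rightUnitor_pairing, F.map_comp]
  simp only [Category.assoc] at h ⊢
  rw [← reassoc_of% h, ← t.lift_app,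
    reassoc_of% p.rightUnitor_pairing, θ.naturality]
  rfl

theorem map_distortion [q.IsStrong] (X Y : M.carrier) :
    t.μ X Y ≫ F.map (distortion X Y) = distortion (F.obj X) (F.obj Y) ≫ t.μ Y X := by
  have h₁ := t.pairing_app (t.lift_app' X) (t.lift_app' Y)
  have h₂ := t.pairing_app (t.lift_app' Y) (t.lift_app' X)
  rw [id_tensorHom_id, Category.id_comp] at h₁ h₂
  rw [← cancel_mono (F.map (q.pairing (t.single Y).hom (t.single X).hom)), Category.assoc,
    Category.assoc, ← F.map_comp, q.distortion_pairing, F.map_comp, ← reassoc_of% h₁, ← h₂,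
    reassoc_of% p.distortion_pairing, θ.naturality]
  rfl

include t in
theorem map_unitDistortion (X : M.carrier) :
    F.map ((unitDistortion (C := M.carrier)).app X) =
      (unitDistortion (C := N.carrier)).app (F.obj X) := by
  rw [← cancel_mono (F.map (t.single X).hom), ← F.map_comp, q.unitDistortion_pairing, F.map_comp,
    ← t.lift_app, reassoc_of% (p.unitDistortion_pairing (t.lift X)),
    θ.naturality, reassoc_of% t.lift_app]
  rfl

/-- The `σ`-lax monoidal structure of the second factor. -/
def sigmaLax [q.IsStrong] : SigmaLax M N F where
  lax :=
    { ε := t.ε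
      μ := t.μ
      μ_natural_left f Z := by
        rw [← tensorHom_id, ← F.map_id, t.μ_natural, tensorHom_id]
      μ_natural_right Z f := by
        rw [← id_tensorHom, ← F.map_id, t.μ_natural, id_tensorHom]
      associativity X Y Z := by
        rw [← tensorHom_id, ← id_tensorHom, ← t.associativity, Category.assoc]
      left_unitality X := by
        rw [← t.left_unitality, tensorHom_id, Category.assoc]
      right_unitality X := by
        rw [← t.right_unitality, id_tensorHom, Category.assoc] }
  map_unitDistortion X := t.map_unitDistortion X
  map_distortion X Y := t.map_distortion X Y

theorem isMultiplicative [q.IsStrong] : IsMultiplicative p (q.postcomp t.sigmaLax) θ.app where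
  unit := t.unit
  tensor := t.tensor

end Transport

end WordLax

namespace Model

variable {M N : DistMon.{v, u}} {A : PseudoAlgebra Tσ.{v, u} M.carrier}
  {B : PseudoAlgebra Tσ.{v, u} N.carrier} (m : Model M A) (n : Model N B)
  {F : M.carrier ⥤ N.carrier} (f : LaxMorphism A B F)

/-- The structure map of the monoidal functor given by a lax morphism. -/
noncomputable def fromLaxμ (X Y : M.carrier) : F.obj X ⊗ F.obj Y ⟶ F.obj (X ⊗ Y) :=
  n.tensorTo (F.obj X) (F.obj Y) ≫ f.cellPair X Y ≫ F.map (m.tensorIso X Y).hom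

theorem tensorIso_naturality {X X' Y Y' : M.carrier} (g : X ⟶ X') (h : Y ⟶ Y') :
    A.action.map (Words.tens (Words.ofHom g) (Words.ofHom h)) ≫ (m.tensorIso X' Y').hom =
      (m.tensorIso X Y).hom ≫ (g ⊗ₘ h) := by
  have e := m.tensorTo_naturality g h
  change _ ≫ inv (m.tensorTo X' Y') = inv (m.tensorTo X Y) ≫ _
  rw [IsIso.comp_inv_eq, Category.assoc, IsIso.eq_inv_comp]
  exact e

theorem cellPair_naturality {X X' Y Y' : M.carrier} (g : X ⟶ X') (h : Y ⟶ Y') :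
    B.action.map (Words.tens (Words.ofHom (F.map g)) (Words.ofHom (F.map h))) ≫
        f.cellPair X' Y' =
      f.cellPair X Y ≫ F.map (A.action.map (Words.tens (Words.ofHom g) (Words.ofHom h))) := by
  exact (congrArg (fun z => B.action.map z ≫ _)
    (Words.map_map_tens_ofHom F g h).symm).trans
    (f.cellApp_naturality (Words.tens (Words.ofHom g) (Words.ofHom h)))

theorem fromLaxμ_natural {X X' Y Y' : M.carrier} (g : X ⟶ X') (h : Y ⟶ Y') :
    (F.map g ⊗ₘ F.map h) ≫ m.fromLaxμ n f X' Y' = m.fromLaxμ n f X Y ≫ F.map (g ⊗ₘ h) := by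
  rw [fromLaxμ, fromLaxμ, ← reassoc_of% n.tensorTo_naturality,
    reassoc_of% cellPair_naturality f g h]
  simp only [Category.assoc]
  rw [← F.map_comp, ← F.map_comp, m.tensorIso_naturality]

/-- The multiplication axiom of a lax morphism and the associativity axiom of a pseudoalgebra have
the same shape at a word of two words, and this serves both. `hs` is naturality along a transport
and `hr` compares transports. -/
theorem mult_aux_two {V : Type u} [Category.{v} V] {a b c d e g h k l : V} {x x' : a ⟶ b}
    {i : b ⟶ b} {p : b ⟶ c} {q : c ⟶ d} {i' : a ⟶ a} {y : a ⟶ e} {r : e ⟶ g} {s : g ⟶ d}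
    {t : d ⟶ h} {r' : g ⟶ k} {s' : k ⟶ h} {r₁ : e ⟶ l} {r₂ : l ⟶ k}
    (hm : x ≫ i ≫ p ≫ q = i' ≫ y ≫ r ≫ s) (hx : x = x') (hi : i = 𝟙 b) (hi' : i' = 𝟙 a)
    (hs : r' ≫ s' = s ≫ t) (hr : r ≫ r' = r₁ ≫ r₂) :
    x' ≫ p ≫ (q ≫ t) = (y ≫ r₁) ≫ r₂ ≫ s' := by
  subst hx hi hi'
  rw [Category.id_comp, Category.id_comp] at hm
  rw [reassoc_of% hm, ← hs, reassoc_of% hr, Category.assoc]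

/-- The multiplication axiom of a lax morphism, at a word of two words. -/
theorem cellPair_multTwo (a b : Words M.carrier) :
    B.action.map (Words.tens (Words.ofHom (f.cellApp a)) (Words.ofHom (f.cellApp b))) ≫
        f.cellPair (A.action.obj a) (A.action.obj b) ≫ F.map (A.multTwo a b).hom =
      (B.multTwo ((Words.map F).obj a) ((Words.map F).obj b)).hom ≫
        B.action.map (eqToHom ((Words.IsStrict.map F).append a b).symm) ≫
          f.cellApp (.append a b) := by
  have h := f.mult (.append (.single a) (.single b))
  have h₁ := (congrArg (fun z => F.map z) (A.multTwo_hom a b)).trans (F.map_comp _ _)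
  have h₂ := B.multTwo_hom ((Words.map F).obj a) ((Words.map F).obj b)
  refine (congrArg (fun z => _ ≫ _ ≫ z) h₁).trans
    (Eq.trans ?_ (congrArg (fun z => z ≫ _) h₂).symm)
  have e := Words.map₂_append_single (C := Words M.carrier) f.cell a b
  refine mult_aux_two h (congrArg B.action.map e) (B.action.map_id _) (B.action.map_id _)
    (f.cellApp_naturality (eqToHom (congrArg (Words.append a) (Words.append_nil b)))) ?_
  refine (congrArg (fun z => _ ≫ B.action.map z) (eqToHom_map (Words.map F) _)).trans ?_
  exact (PseudoAlgebra.map_eqToHom_trans B.action _ _ _).trans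
    (PseudoAlgebra.map_eqToHom_trans B.action _ _ ((congrArg (Words.append _)
      (Words.append_nil _)).trans ((Words.IsStrict.map F).append a b).symm)).symm

/-- The multiplication axiom at `[a, b]` becomes multiplicativity of the cell, for the very
structure maps read off from its components at words of length two. -/
theorem fromLaxμ_tensor (a b : Words M.carrier) :
    (n.lax.precomp (.map F)).μ a b ≫ f.cellApp (.append a b) =
      (f.cellApp a ⊗ₘ f.cellApp b) ≫ m.fromLaxμ n f (A.action.obj a) (A.action.obj b) ≫
        F.map (m.lax.μ a b) := by
  have h := congrArg (fun z => n.tensorTo _ _ ≫ z) (cellPair_multTwo f a b)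
  have h₁ := n.tensorTo_naturality (f.cellApp a) (f.cellApp b)
  have h₂ := n.tensorTo_multTwo ((Words.map F).obj a) ((Words.map F).obj b)
  have h₃ : (m.tensorIso (A.action.obj a) (A.action.obj b)).hom ≫ m.lax.μ a b =
      (A.multTwo a b).hom := by
    rw [← m.tensorTo_multTwo]; exact IsIso.inv_hom_id_assoc _ _
  rw [fromLaxμ]
  simp only [Category.assoc]
  rw [← F.map_comp, h₃]
  rw [reassoc_of% h₁, reassoc_of% h₂] at h
  exact (Category.assoc _ _ _).trans h.symm

/-- The data by which a lax morphism determines a `σ`-lax monoidal structure. -/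
noncomputable def transport : WordLax.Transport (n.lax.precomp (.map F)) m.lax
    (f.cell : Words.map F ⋙ B.action ⟶ A.action ⋙ F) where
  μ := m.fromLaxμ n f
  ε := n.lax.ε ≫ f.cellNil ≫ F.map m.unitIso.hom
  μ_natural := m.fromLaxμ_natural n f
  unit := by
    have h₁ : (n.lax.precomp (.map F)).ε = n.lax.ε :=
      (congrArg (fun z => n.lax.ε ≫ z) (B.action.map_id _)).trans (Category.comp_id _)
    refine (congrArg (fun z => z ≫ f.cellNil) h₁).trans ?_
    rw [Category.assoc, Category.assoc, ← F.map_comp]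
    have h₂ : m.unitIso.hom ≫ m.lax.ε = 𝟙 _ := IsIso.inv_hom_id _
    rw [h₂, F.map_id, Category.comp_id]
  tensor := m.fromLaxμ_tensor n f
  single X := A.unitWords.app X
  lift X := B.unitHom (F.obj X)
  lift_app X := f.unitHom_cellApp X

/-- The cell of `f` is multiplicative for the structure extracted from it, so it is the cell that
this structure generates. -/
theorem toLax_sigmaLax : toLax m n (m.transport n f).sigmaLax = f :=
  toLax_unique m n _ f (m.transport n f).isMultiplicative

theorem toLax_bijective : Function.Bijective (toLax m n (F := F)) :=
  ⟨m.toLax_injective n, fun f => ⟨_, m.toLax_sigmaLax n f⟩⟩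

end Model

end Distorted

/-! ### Coherence of a tensor product pulled back from words -/

namespace Distorted

open MonoidalCategory

/-- Invertible structure maps on a functor out of words, and the laws by which they determine the
coherence of a tensor product. -/
structure WordFrame {V : Type u} [Category.{v} V] [MonoidalCategoryStruct V] (G : Words V ⥤ V) where
  single (X : V) : X ≅ G.obj (.single X)
  μ (a b : Words V) : G.obj a ⊗ G.obj b ≅ G.obj (.append a b)
  ε : 𝟙_ V ≅ G.obj .nil
  distortion (X Y : V) : X ⊗ Y ⟶ Y ⊗ X
  unitDistortion (X : V) : X ⟶ X
  id_tensor_id (X Y : V) : 𝟙 X ⊗ₘ 𝟙 Y = 𝟙 (X ⊗ Y)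
  tensor_comp {X X' X'' Y Y' Y'' : V} (f : X ⟶ X') (g : Y ⟶ Y') (f' : X' ⟶ X'') (g' : Y' ⟶ Y'') :
    (f ⊗ₘ g) ≫ (f' ⊗ₘ g') = (f ≫ f') ⊗ₘ (g ≫ g')
  id_tensor (X : V) {Y Y' : V} (f : Y ⟶ Y') : 𝟙 X ⊗ₘ f = X ◁ f
  tensor_id {X X' : V} (f : X ⟶ X') (Y : V) : f ⊗ₘ 𝟙 Y = f ▷ Y
  associator_naturality {X X' Y Y' Z Z' : V} (f : X ⟶ X') (g : Y ⟶ Y') (h : Z ⟶ Z') :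
    ((f ⊗ₘ g) ⊗ₘ h) ≫ (α_ X' Y' Z').hom = (α_ X Y Z).hom ≫ (f ⊗ₘ (g ⊗ₘ h))
  leftUnitor_naturality {X X' : V} (f : X ⟶ X') :
    (𝟙 (𝟙_ V) ⊗ₘ f) ≫ (λ_ X').hom = (λ_ X).hom ≫ f
  rightUnitor_naturality {X X' : V} (f : X ⟶ X') :
    (f ⊗ₘ 𝟙 (𝟙_ V)) ≫ (ρ_ X').hom = (ρ_ X).hom ≫ f
  distortion_naturality {X X' Y Y' : V} (f : X ⟶ X') (g : Y ⟶ Y') :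
    distortion X Y ≫ (g ⊗ₘ f) = (f ⊗ₘ g) ≫ distortion X' Y'
  unitDistortion_naturality {X X' : V} (f : X ⟶ X') :
    f ≫ unitDistortion X' = unitDistortion X ≫ f
  μ_natural {a b c d : Words V} (f : a ⟶ b) (g : c ⟶ d) :
    (G.map f ⊗ₘ G.map g) ≫ (μ b d).hom = (μ a c).hom ≫ G.map (Words.tens f g)
  associativity (a b c : Words V) :
    ((μ a b).hom ⊗ₘ 𝟙 _) ≫ (μ (.append a b) c).hom ≫ G.map (eqToHom (Words.append_assoc a b c)) =
      (α_ _ _ _).hom ≫ (𝟙 _ ⊗ₘ (μ b c).hom) ≫ (μ a (.append b c)).hom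
  left_unitality (a : Words V) : (ε.hom ⊗ₘ 𝟙 _) ≫ (μ .nil a).hom = (λ_ (G.obj a)).hom
  right_unitality (a : Words V) :
    (𝟙 _ ⊗ₘ ε.hom) ≫ (μ a .nil).hom ≫ G.map (eqToHom (Words.append_nil a)) = (ρ_ (G.obj a)).hom
  map_sigma (a b : Words V) :
    (μ a b).hom ≫ G.map (Words.sigma a b) = distortion _ _ ≫ (μ b a).hom
  map_lam (a : Words V) : G.map (Words.lam a) = unitDistortion (G.obj a)

namespace WordFrame

section

variable {V : Type u} [Category.{v} V] [MonoidalCategoryStruct V] {G : Words V ⥤ V}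
  (p : WordFrame G) {X X' Y Y' Z W : V} {a a' b b' c : Words V}

/-- The morphism from a tensor product to the value at a concatenation which is induced by two
morphisms to values at words. -/
def pairing (e : X ⟶ G.obj a) (f : Y ⟶ G.obj b) : X ⊗ Y ⟶ G.obj (.append a b) :=
  (e ⊗ₘ f) ≫ (p.μ a b).hom

theorem tensor_pairing (h : X' ⟶ X) (k : Y' ⟶ Y) (e : X ⟶ G.obj a) (f : Y ⟶ G.obj b) :
    (h ⊗ₘ k) ≫ p.pairing e f = p.pairing (h ≫ e) (k ≫ f) := by
  rw [pairing, ← Category.assoc, p.tensor_comp, pairing]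

theorem pairing_map (e : X ⟶ G.obj a) (f : Y ⟶ G.obj b) (u : a ⟶ a') (v : b ⟶ b') :
    p.pairing (e ≫ G.map u) (f ≫ G.map v) = p.pairing e f ≫ G.map (Words.tens u v) := by
  rw [pairing, ← p.tensor_comp, Category.assoc, p.μ_natural, pairing, Category.assoc]

theorem pairing_map_left (e : X ⟶ G.obj a) (f : Y ⟶ G.obj b) (u : a ⟶ a') :
    p.pairing (e ≫ G.map u) f = p.pairing e f ≫ G.map (Words.tens u (𝟙 b)) := by
  rw [← pairing_map, CategoryTheory.Functor.map_id, Category.comp_id]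

theorem pairing_map_right (e : X ⟶ G.obj a) (f : Y ⟶ G.obj b) (v : b ⟶ b') :
    p.pairing e (f ≫ G.map v) = p.pairing e f ≫ G.map (Words.tens (𝟙 a) v) := by
  rw [← pairing_map, CategoryTheory.Functor.map_id, Category.comp_id]

theorem associator_pairing (e : X ⟶ G.obj a) (f : Y ⟶ G.obj b) (g : Z ⟶ G.obj c) :
    (α_ X Y Z).hom ≫ p.pairing e (p.pairing f g) =
      p.pairing (p.pairing e f) g ≫ G.map (eqToHom (Words.append_assoc a b c)) := by
  have h₁ : p.pairing e (p.pairing f g) =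
      (e ⊗ₘ (f ⊗ₘ g)) ≫ (𝟙 _ ⊗ₘ (p.μ b c).hom) ≫ (p.μ a (.append b c)).hom := by
    rw [← Category.assoc, p.tensor_comp, Category.comp_id]; rfl
  have h₂ : p.pairing (p.pairing e f) g =
      ((e ⊗ₘ f) ⊗ₘ g) ≫ ((p.μ a b).hom ⊗ₘ 𝟙 _) ≫ (p.μ (.append a b) c).hom := by
    rw [← Category.assoc, p.tensor_comp, Category.comp_id]; rfl
  rw [h₁, h₂, Category.assoc, Category.assoc, p.associativity, reassoc_of% p.associator_naturality]

theorem leftUnitor_pairing (e : X ⟶ G.obj a) : (λ_ X).hom ≫ e = p.pairing p.ε.hom e := by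
  have h : p.pairing p.ε.hom e = (𝟙 _ ⊗ₘ e) ≫ (p.ε.hom ⊗ₘ 𝟙 _) ≫ (p.μ .nil a).hom := by
    rw [← Category.assoc, p.tensor_comp, Category.comp_id, Category.id_comp]; rfl
  rw [h, p.left_unitality]
  exact (p.leftUnitor_naturality e).symm

theorem rightUnitor_pairing (e : X ⟶ G.obj a) :
    (ρ_ X).hom ≫ e = p.pairing e p.ε.hom ≫ G.map (eqToHom (Words.append_nil a)) := by
  have h : p.pairing e p.ε.hom = (e ⊗ₘ 𝟙 _) ≫ (𝟙 _ ⊗ₘ p.ε.hom) ≫ (p.μ a .nil).hom := by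
    rw [← Category.assoc, p.tensor_comp, Category.comp_id, Category.id_comp]; rfl
  rw [h, Category.assoc, Category.assoc, p.right_unitality, p.rightUnitor_naturality]

theorem distortion_pairing (e : X ⟶ G.obj a) (f : Y ⟶ G.obj b) :
    p.distortion X Y ≫ p.pairing f e = p.pairing e f ≫ G.map (Words.sigma a b) := by
  rw [pairing, pairing, Category.assoc, p.map_sigma, ← Category.assoc, p.distortion_naturality,
    Category.assoc]

theorem unitDistortion_pairing (e : X ⟶ G.obj a) :
    p.unitDistortion X ≫ e = e ≫ G.map (Words.lam a) := by
  rw [p.map_lam, p.unitDistortion_naturality]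

-- A `MonoidalCategoryStruct` carries no laws, so bifunctoriality has to be taken from the frame.
include p in
theorem isIso_tensor (e : X ≅ X') (f : Y ≅ Y') : IsIso (e.hom ⊗ₘ f.hom) :=
  ⟨e.inv ⊗ₘ f.inv, by simp [p.tensor_comp, p.id_tensor_id], by
    simp [p.tensor_comp, p.id_tensor_id]⟩

theorem isIso_pairing (e : X ⟶ G.obj a) (f : Y ⟶ G.obj b) [IsIso e] [IsIso f] :
    IsIso (p.pairing e f) := by
  have := p.isIso_tensor (asIso e) (asIso f)
  exact @IsIso.comp_isIso _ _ _ _ _ _ _ this _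

-- Composed with an invertible fourfold pairing, each associator becomes a transport between equal
-- words, and parallel composites of transports agree. The triangle and the distortion axioms follow
-- the same pattern: cancel a pairing and quote the strict law for words.
include p in
theorem pentagon (W X Y Z : V) :
    ((α_ W X Y).hom ⊗ₘ 𝟙 Z) ≫ (α_ W (X ⊗ Y) Z).hom ≫ (𝟙 W ⊗ₘ (α_ X Y Z).hom) =
      (α_ (W ⊗ X) Y Z).hom ≫ (α_ W X (Y ⊗ Z)).hom := by
  let e := (p.single W).hom
  let f := (p.single X).hom
  let g := (p.single Y).hom
  let h := (p.single Z).hom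
  have := p.isIso_pairing g h
  have := p.isIso_pairing f (p.pairing g h)
  have := p.isIso_pairing e (p.pairing f (p.pairing g h))
  rw [← cancel_mono (p.pairing e (p.pairing f (p.pairing g h)))]
  simp only [Category.assoc]
  rw [p.tensor_pairing, Category.id_comp, p.associator_pairing f g h, p.pairing_map_right,
    reassoc_of% p.associator_pairing, reassoc_of% p.tensor_pairing, p.associator_pairing e f g,
    Category.id_comp, p.pairing_map_left, p.associator_pairing, reassoc_of% p.associator_pairing,
    Words.tens_id_eqToHom, Words.tens_eqToHom_id]
  simp only [Category.assoc, ← G.map_comp, eqToHom_trans]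

include p in
theorem triangle (X Y : V) :
    (α_ X (𝟙_ V) Y).hom ≫ (𝟙 X ⊗ₘ (λ_ Y).hom) = (ρ_ X).hom ⊗ₘ 𝟙 Y := by
  let e := (p.single X).hom
  let f := (p.single Y).hom
  have := p.isIso_pairing e f
  rw [← cancel_mono (p.pairing e f), p.tensor_pairing, p.rightUnitor_pairing e, p.pairing_map_left,
    Category.assoc, p.tensor_pairing, p.leftUnitor_pairing f, Category.id_comp, Category.id_comp]
  refine (p.associator_pairing e p.ε.hom f).trans ?_
  rw [Words.tens_eqToHom_id]

/-- The monoidal structure determined by a frame. -/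
abbrev monoidalCategory : MonoidalCategory V :=
  .ofTensorHom p.id_tensor_id p.id_tensor p.tensor_id p.tensor_comp p.associator_naturality
    p.leftUnitor_naturality p.rightUnitor_naturality p.pentagon p.triangle

theorem distortion_unit (X : V) :
    p.distortion X (𝟙_ V) = (ρ_ X).hom ≫ (λ_ X).inv := by
  rw [Iso.eq_comp_inv, ← cancel_mono (p.single X).hom, Category.assoc, p.leftUnitor_pairing,
    p.rightUnitor_pairing]
  refine (p.distortion_pairing _ _).trans ?_
  rw [Words.sigma_nil]

theorem unit_distortion (X : V) :
    p.distortion (𝟙_ V) X = (λ_ X).hom ≫ (ρ_ X).inv := by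
  rw [Iso.eq_comp_inv, ← cancel_mono (p.single X).hom, Category.assoc, p.leftUnitor_pairing,
    p.rightUnitor_pairing, reassoc_of% p.distortion_pairing, Words.nil_sigma, ← G.map_comp,
    eqToHom_trans]
  exact (congrArg (fun z => _ ≫ z) (G.map_id _)).trans (Category.comp_id _)

theorem unitDistortion_unit : p.unitDistortion (𝟙_ V) = 𝟙 _ := by
  rw [← cancel_mono p.ε.hom, p.unitDistortion_pairing, Words.lam_nil, G.map_id]
  simp

/-- The hexagon in `Words`, `Words.sigma_append_left`, seen through the threefold pairing of
letters: its transports match the associators and its `σ` factors the distortions. -/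
theorem distortion_tensor_left (X Y Z : V) : p.distortion (X ⊗ Y) Z =
    (α_ X Y Z).hom ≫ (𝟙 X ⊗ₘ p.distortion Y Z) ≫ (α_ X Z Y).inv ≫
      (p.distortion X Z ⊗ₘ 𝟙 Y) ≫ (α_ Z X Y).hom := by
  let e := (p.single X).hom
  let f := (p.single Y).hom
  let g := (p.single Z).hom
  have := p.isIso_pairing e f
  have := p.isIso_pairing g (p.pairing e f)
  have h : (α_ X Z Y).inv ≫ p.pairing (p.pairing e g) f =
      p.pairing e (p.pairing g f) ≫ G.map (eqToHom (Words.append_assoc _ _ _).symm) := by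
    rw [Iso.inv_comp_eq, reassoc_of% p.associator_pairing, ← G.map_comp, eqToHom_trans]
    exact ((congrArg (fun z => _ ≫ z) (G.map_id _)).trans (Category.comp_id _)).symm
  rw [← cancel_mono (p.pairing g (p.pairing e f)), p.distortion_pairing, Words.sigma_append_left]
  simp only [Category.assoc, G.map_comp]
  rw [p.associator_pairing g e f, reassoc_of% p.tensor_pairing, p.distortion_pairing,
    p.pairing_map_left, Category.id_comp, Category.assoc, reassoc_of% h, reassoc_of%
    p.tensor_pairing, p.distortion_pairing, p.pairing_map_right, Category.id_comp, Category.assoc,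
    reassoc_of% p.associator_pairing]

theorem distortion_tensor_right (X Y Z : V) : p.distortion X (Y ⊗ Z) =
    (α_ X Y Z).inv ≫ (p.distortion X Y ⊗ₘ 𝟙 Z) ≫ (α_ Y X Z).hom ≫
      (𝟙 Y ⊗ₘ p.distortion X Z) ≫ (α_ Y Z X).inv := by
  let e := (p.single X).hom
  let f := (p.single Y).hom
  let g := (p.single Z).hom
  have := p.isIso_pairing f g
  have := p.isIso_pairing (p.pairing f g) e
  have h {S T U : V} {a b c : Words V} (e : S ⟶ G.obj a) (f : T ⟶ G.obj b) (g : U ⟶ G.obj c) :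
      (α_ S T U).inv ≫ p.pairing (p.pairing e f) g =
      p.pairing e (p.pairing f g) ≫ G.map (eqToHom (Words.append_assoc _ _ _).symm) := by
    rw [Iso.inv_comp_eq, reassoc_of% p.associator_pairing, ← G.map_comp, eqToHom_trans]
    exact ((congrArg (fun z => _ ≫ z) (G.map_id _)).trans (Category.comp_id _)).symm
  rw [← cancel_mono (p.pairing (p.pairing f g) e), p.distortion_pairing, Words.sigma_append_right]
  simp only [Category.assoc, G.map_comp]
  rw [h, reassoc_of% p.tensor_pairing, p.distortion_pairing,
    p.pairing_map_right, Category.id_comp, Category.assoc, reassoc_of% p.associator_pairing,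
    reassoc_of% p.tensor_pairing, p.distortion_pairing, p.pairing_map_left, Category.id_comp,
    Category.assoc, reassoc_of% h]

theorem unitDistortion_tensor (X Y : V) :
    p.unitDistortion (X ⊗ Y) = p.unitDistortion X ⊗ₘ p.unitDistortion Y := by
  let e := (p.single X).hom
  let f := (p.single Y).hom
  have := p.isIso_pairing e f
  rw [← cancel_mono (p.pairing e f), p.unitDistortion_pairing, p.tensor_pairing,
    p.unitDistortion_pairing e, p.unitDistortion_pairing f, p.pairing_map, Words.lam_append]

/-- The distorted monoidal structure determined by a frame. -/
abbrev distortedMonoidal : @DistortedMonoidal V _ p.monoidalCategory :=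
  letI := p.monoidalCategory
  { unitDistortion := { app := p.unitDistortion
                        naturality := fun _ _ f => p.unitDistortion_naturality f }
    distortion := p.distortion
    naturality := p.distortion_naturality
    distortion_unit := p.distortion_unit
    unit_distortion := p.unit_distortion
    unitDistortion_unit := p.unitDistortion_unit
    distortion_tensor_left := p.distortion_tensor_left
    distortion_tensor_right := p.distortion_tensor_right
    unitDistortion_tensor := p.unitDistortion_tensor }

end

section

variable {C : Cat.{v, u}} [MonoidalCategoryStruct C] {G : Words C ⥤ C} (p : WordFrame G)

/-- The distorted monoidal category determined by a frame. -/
def distMon : DistMon.{v, u} where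
  carrier := C
  monoidal := p.monoidalCategory
  distorted := p.distortedMonoidal

/-- The strong distorted monoidal structure determined by a frame. -/
def wordLax :
    letI := p.monoidalCategory
    letI := p.distortedMonoidal
    WordLax (V := C) G :=
  letI := p.monoidalCategory
  letI := p.distortedMonoidal
  { μ a b := (p.μ a b).hom
    ε := p.ε.hom
    μ_natural := p.μ_natural
    associativity := p.associativity
    left_unitality := p.left_unitality
    right_unitality := p.right_unitality
    map_sigma := p.map_sigma
    map_lam := p.map_lam }

theorem isStrong_wordLax :
    letI := p.monoidalCategory
    letI := p.distortedMonoidal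
    p.wordLax.IsStrong :=
  letI := p.monoidalCategory
  letI := p.distortedMonoidal
  { μ_isIso := fun a b => (p.μ a b).isIso_hom
    ε_isIso := p.ε.isIso_hom }

end

end WordFrame

end Distorted

/-! ### The tensor product and distortions given by a pseudoalgebra -/

namespace Distorted

open MonoidalCategory

namespace Words

variable {C : Type u} [Category.{v} C] {D : Type u'} [Category.{v'} D]

theorem unwrap_map_tens {a b c d : Words C} (f : a ⟶ b) (g : c ⟶ d) :
    (unwrap C).map (tens f g) = Free.tens ((unwrap C).map f) ((unwrap C).map g) :=
  unwrap_map_wrap_map _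

theorem tens_assoc {a b c a' b' c' : Words C} (f : a ⟶ a') (g : b ⟶ b') (h : c ⟶ c') :
    tens (tens f g) h ≫ eqToHom (append_assoc a' b' c') =
      eqToHom (append_assoc a b c) ≫ tens f (tens g h) := by
  have e := congrArg (wrap C).map (Free.tens_assoc ((unwrap C).map f) ((unwrap C).map g)
    ((unwrap C).map h))
  rw [Functor.map_comp, Functor.map_comp, wrap_map_eqToHom, wrap_map_eqToHom] at e
  have h₁ : tens (tens f g) h = (wrap C).map (Free.tens (Free.tens ((unwrap C).map f)
    ((unwrap C).map g)) ((unwrap C).map h)) :=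
    congrArg (fun z => (wrap C).map (Free.tens z ((unwrap C).map h))) (unwrap_map_tens f g)
  have h₂ : tens f (tens g h) = (wrap C).map (Free.tens ((unwrap C).map f)
    (Free.tens ((unwrap C).map g) ((unwrap C).map h))) :=
    congrArg (fun z => (wrap C).map (Free.tens ((unwrap C).map f) z)) (unwrap_map_tens g h)
  rw [h₁, h₂]
  exact e

theorem nil_tens {a b : Words C} (f : a ⟶ b) : tens (𝟙 nil) f = f := by
  have h : tens (𝟙 nil) f = (wrap C).map (Free.tens (𝟙 ([] : Free C)) ((unwrap C).map f)) :=
    congrArg (fun z => (wrap C).map (Free.tens z ((unwrap C).map f))) ((unwrap C).map_id nil)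
  rw [h]
  exact (congrArg (wrap C).map (Free.nil_tens _)).trans (wrap_map_unwrap_map f)

theorem tens_nil {a b : Words C} (f : a ⟶ b) :
    tens f (𝟙 nil) ≫ eqToHom (append_nil b) = eqToHom (append_nil a) ≫ f := by
  have e := congrArg (wrap C).map (Free.tens_nil ((unwrap C).map f))
  rw [Functor.map_comp, Functor.map_comp, wrap_map_eqToHom, wrap_map_eqToHom] at e
  have h : tens f (𝟙 nil) = (wrap C).map (Free.tens ((unwrap C).map f) (𝟙 ([] : Free C))) :=
    congrArg (fun z => (wrap C).map (Free.tens ((unwrap C).map f) z)) ((unwrap C).map_id nil)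
  rw [h]
  exact e.trans (congrArg (fun z => _ ≫ z) (wrap_map_unwrap_map f))

theorem tens_conj {a b c d a' b' c' d' : Words C} (f : a ⟶ b) (g : c ⟶ d) (ha : a' = a)
    (hb : b = b') (hc : c' = c) (hd : d = d') :
    tens (eqToHom ha ≫ f ≫ eqToHom hb) (eqToHom hc ≫ g ≫ eqToHom hd) =
      eqToHom (congrArg₂ append ha hc) ≫ tens f g ≫ eqToHom (congrArg₂ append hb hd) := by
  subst ha hb hc hd; simp

theorem ofHom_id (X : C) : ofHom (𝟙 X) = 𝟙 (single X) := (of C).map_id X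

theorem ofHom_comp {X Y Z : C} (f : X ⟶ Y) (g : Y ⟶ Z) : ofHom (f ≫ g) = ofHom f ≫ ofHom g :=
  (of C).map_comp f g

theorem comp_eqToHom_of_conj {a a' b b' x y : Words C} {t : a ⟶ b} {f : x ⟶ y}
    {p : a = a'} {q : a' = x} {r : y = b'} {s : b' = b}
    (h : t = eqToHom p ≫ (eqToHom q ≫ f ≫ eqToHom r) ≫ eqToHom s) (k : b = y) (l : a = x) :
    t ≫ eqToHom k = eqToHom l ≫ f := by
  subst h p q r; simp

/-- Evaluating a word of two words leaves a trailing empty word, as in `b ++ (d ++ [])`; the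
transports only remove it. -/
theorem mult_map_tens_ofHom {a b c d : Words C} (f : a ⟶ b) (g : c ⟶ d) :
    (mult C).map (tens (ofHom f) (ofHom g)) ≫ eqToHom (congrArg (append b) (append_nil d)) =
      eqToHom (congrArg (append a) (append_nil c)) ≫ tens f g := by
  have h := ((IsStrict.mult (C := C)).tens (ofHom f) (ofHom g)).trans
    (congrArg (fun z => _ ≫ z ≫ _) ((congrArg₂ tens (mult_map_of f) (mult_map_of g)).trans
      (tens_conj _ _ _ _ _ _)))
  exact comp_eqToHom_of_conj h _ _

theorem mult_map_sigma (a b : Words C) :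
    (mult C).map (sigma (single a) (single b)) ≫ eqToHom (congrArg (append b) (append_nil a)) =
      eqToHom (congrArg (append a) (append_nil b)) ≫ sigma a b := by
  have h := ((IsStrict.mult (C := C)).sigma (single a) (single b)).trans
    (congrArg (fun z => _ ≫ z ≫ _) (sigma_congr (append_nil a) (append_nil b)))
  exact comp_eqToHom_of_conj h _ _

theorem mult_map_lam (a : Words C) :
    (mult C).map (lam (single a)) =
      eqToHom (append_nil a) ≫ lam a ≫ eqToHom (append_nil a).symm :=
  ((IsStrict.mult (C := C)).lam (single a)).trans (lam_congr (append_nil a))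

end Words

namespace PseudoAlgebra

variable {C : Cat.{v, u}} (A : PseudoAlgebra Tσ.{v, u} C)

/-- The value of the action at a word of length two. -/
abbrev tensorObj (X Y : C) : C := A.action.obj (.append (.single X) (.single Y))

/-- The value of the action at a pair of morphisms. -/
noncomputable def tensorMap {X X' Y Y' : C} (f : X ⟶ X') (g : Y ⟶ Y') :
    A.tensorObj X Y ⟶ A.tensorObj X' Y' :=
  A.action.map (Words.tens (Words.ofHom f) (Words.ofHom g))

theorem tensorMap_id (X Y : C) : A.tensorMap (𝟙 X) (𝟙 Y) = 𝟙 (A.tensorObj X Y) := by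
  rw [tensorMap, Words.ofHom_id, Words.ofHom_id, Words.tens_id, A.action.map_id]

theorem tensorMap_comp {X X' X'' Y Y' Y'' : C} (f : X ⟶ X') (g : Y ⟶ Y') (f' : X' ⟶ X'')
    (g' : Y' ⟶ Y'') :
    A.tensorMap f g ≫ A.tensorMap f' g' = A.tensorMap (f ≫ f') (g ≫ g') := by
  rw [tensorMap, tensorMap, ← A.action.map_comp, ← Words.tens_comp, ← Words.ofHom_comp,
    ← Words.ofHom_comp, tensorMap]

/-- The value of the action at a pair of isomorphisms. -/
noncomputable def tensorMapIso {X X' Y Y' : C} (e : X ≅ X') (f : Y ≅ Y') :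
    A.tensorObj X Y ≅ A.tensorObj X' Y' where
  hom := A.tensorMap e.hom f.hom
  inv := A.tensorMap e.inv f.inv
  hom_inv_id := by rw [tensorMap_comp, e.hom_inv_id, f.hom_inv_id, tensorMap_id]
  inv_hom_id := by rw [tensorMap_comp, e.inv_hom_id, f.inv_hom_id, tensorMap_id]

theorem multTwo_natural {a b c d : Words C} (f : a ⟶ b) (g : c ⟶ d) :
    A.tensorMap (A.action.map f) (A.action.map g) ≫ (A.multTwo b d).hom =
      (A.multTwo a c).hom ≫ A.action.map (Words.tens f g) := by
  have h := (congrArg (fun z => z ≫ _)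
    (congrArg A.action.map (Words.map_map_tens_ofHom A.action f g)).symm).trans
    (A.multApp_naturality (Words.tens (Words.ofHom f) (Words.ofHom g)))
  rw [A.multTwo_hom, A.multTwo_hom]
  refine (Category.assoc _ _ _).symm.trans ((congrArg (fun z => z ≫ _) h).trans ?_)
  refine (Category.assoc _ _ _).trans (Eq.trans ?_ (Category.assoc _ _ _).symm)
  refine congrArg (fun z => _ ≫ z) ?_
  refine (A.action.map_comp _ _).symm.trans (Eq.trans ?_ (A.action.map_comp _ _))
  exact congrArg A.action.map (Words.mult_map_tens_ofHom f g)

/-- Naturality of the multiplication at `σ` of the words of words `[a]` and `[b]`: `T` of the action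
sends it to `σ` of two letters of `C`, and `mult` sends it to `σ` of `a` and `b`. So `σ` on all
words is governed by `σ` on letters; `map_lam` is the same argument for `Λ`. -/
theorem multTwo_sigma (a b : Words C) :
    (A.multTwo a b).hom ≫ A.action.map (Words.sigma a b) =
      A.action.map (Words.sigma (.single (A.action.obj a)) (.single (A.action.obj b))) ≫
        (A.multTwo b a).hom := by
  have e : (Words.map A.action).map (Words.sigma (.single a) (.single b)) =
      Words.sigma (.single (A.action.obj a)) (.single (A.action.obj b)) :=
    ((Words.IsStrict.map A.action).sigma _ _).trans
      ((Category.id_comp _).trans (Category.comp_id _))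
  have h := (congrArg (fun z => z ≫ _) (congrArg A.action.map e).symm).trans
    (A.multApp_naturality (Words.sigma (.single a) (.single b)))
  rw [A.multTwo_hom, A.multTwo_hom]
  refine Eq.trans ?_ (Category.assoc _ _ _)
  refine Eq.trans ?_ (congrArg (fun z => z ≫ _) h).symm
  refine (Category.assoc _ _ _).trans (Eq.trans ?_ (Category.assoc _ _ _).symm)
  refine congrArg (fun z => _ ≫ z) ?_
  refine (A.action.map_comp _ _).symm.trans (Eq.trans ?_ (A.action.map_comp _ _))
  exact congrArg A.action.map (Words.mult_map_sigma a b).symm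

theorem eq_conj_of_comp_eq {W : Type u'} [Category.{v'} W] {V : Type u''} [Category.{v''} V]
    (G : W ⥤ V) {a a' : W} {b : V} {i : G.obj a ⟶ b} {j : b ⟶ G.obj a} {x x' : b ⟶ b} {l : a ⟶ a}
    {m : a' ⟶ a'} {e : a = a'} {e' : a' = a}
    (h : x ≫ j ≫ G.map (eqToHom e) = (j ≫ G.map (eqToHom e)) ≫ G.map m)
    (hx : x = x') (hm : m = eqToHom e' ≫ l ≫ eqToHom e) (hi : i ≫ j = 𝟙 _) :
    G.map l = i ≫ x' ≫ j := by
  subst e hx hm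
  simp only [eqToHom_refl, Category.id_comp, Category.comp_id, G.map_id] at h
  rw [h, reassoc_of% hi]

theorem map_lam (a : Words C) : A.action.map (Words.lam a) = A.unitHom (A.action.obj a) ≫
    A.action.map (Words.lam (.single (A.action.obj a))) ≫ A.unitInv (A.action.obj a) := by
  have h := A.multApp_naturality (Words.lam (.single a))
  rw [A.multApp_single] at h
  exact eq_conj_of_comp_eq A.action h (congrArg A.action.map ((Words.IsStrict.map A.action).lam _))
    (Words.mult_map_lam a) (A.unitHom_unitInv _)

theorem eq_id_of_comp_eq_id {V : Type u''} [Category.{v''} V] {a : V} {e f g k l : a ⟶ a}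
    (h : e ≫ f ≫ g ≫ k ≫ l = 𝟙 a) (he : e = 𝟙 a) (hf : f = 𝟙 a) (hg : g = 𝟙 a) (hl : l = 𝟙 a) :
    k = 𝟙 a := by
  subst he hf hg hl; simpa using h

/-- In the right unit axiom at the empty word every other factor is an identity. -/
theorem multApp_nil : A.multApp .nil = 𝟙 (A.action.obj .nil) := by
  have h := A.unit_right .nil
  have e : (Words.map₂ (C := C) A.unitIso.hom).app .nil = 𝟙 _ := Words.ext₂_nil _
  refine eq_id_of_comp_eq_id h (A.action.map_id _) ?_ (A.action.map_id _) (A.action.map_id _)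
  exact (congrArg A.action.map e).trans (A.action.map_id _)

/-- The associativity axiom of a pseudoalgebra, at a word of two words of words. -/
theorem tensorMap_multApp (U W : Words (Words C)) :
    A.tensorMap (A.multApp U) (A.multApp W) ≫
        (A.multTwo ((Words.mult C).obj U) ((Words.mult C).obj W)).hom ≫
          A.action.map (eqToHom (Words.IsStrict.mult.append U W).symm) =
      (A.multTwo ((Words.map A.action).obj U) ((Words.map A.action).obj W)).hom ≫
        A.action.map (eqToHom ((Words.IsStrict.map A.action).append U W).symm) ≫
          A.multApp (.append U W) := by
  have h := A.mult_assoc (.append (.single U) (.single W))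
  have e := Words.map₂_append_single (C := Words (Words C)) A.multIso.hom U W
  have h₁ := A.multTwo_hom ((Words.mult C).obj U) ((Words.mult C).obj W)
  have h₂ := A.multTwo_hom ((Words.map A.action).obj U) ((Words.map A.action).obj W)
  have h₃ := WordLax.app_eqToHom (G := Words.map A.action ⋙ A.action)
    (H := Words.mult C ⋙ A.action) A.multApp (congrArg (Words.append U) (Words.append_nil W))
  have h₄ : A.action.map (eqToHom (congrArg (Words.append ((Words.mult C).obj U))
      (Words.append_nil ((Words.mult C).obj W)))) ≫
      A.action.map (eqToHom (Words.IsStrict.mult.append U W).symm) =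
      A.action.map (eqToHom (Functor.congr_obj Words.mult_assoc
        (.append (.single U) (.single W)))) ≫
      (Words.mult C ⋙ A.action).map (eqToHom (congrArg (Words.append U) (Words.append_nil W))) := by
    refine (map_eqToHom_trans A.action _ _ ((congrArg (Words.append _) (Words.append_nil _)).trans
      (Words.IsStrict.mult.append U W).symm)).trans (Eq.symm ?_)
    refine (congrArg (fun z => _ ≫ A.action.map z) (eqToHom_map (Words.mult C) _)).trans ?_
    exact map_eqToHom_trans A.action _ _ _
  rw [h₁, h₂]
  refine (congrArg (fun z => _ ≫ z) ((Category.assoc _ _ _).trans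
    (congrArg (fun z => _ ≫ z) h₄))).trans ?_
  refine Model.mult_aux_two h (congrArg A.action.map e) (A.action.map_id _) (A.action.map_id _)
    h₃ ?_
  refine (congrArg (fun z => _ ≫ A.action.map z) (eqToHom_map (Words.map A.action) _)).trans ?_
  exact (map_eqToHom_trans A.action _ _ _).trans (map_eqToHom_trans A.action _ _
    ((congrArg (Words.append _) (Words.append_nil _)).trans
      ((Words.IsStrict.map A.action).append U W).symm)).symm

end PseudoAlgebra

end Distorted

/-! ### Associator, unitors and the frame of a pseudoalgebra -/

namespace Distorted

open MonoidalCategory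

namespace PseudoAlgebra

variable {C : Cat.{v, u}} (A : PseudoAlgebra Tσ.{v, u} C)

/-- The unit isomorphism at an object. -/
def unitApp (X : C) : X ≅ A.action.obj (.single X) where
  hom := A.unitHom X
  inv := A.unitInv X

theorem multApp_single_eqToHom (a : Words C) :
    A.multApp (.single a) ≫ A.action.map (eqToHom (Words.append_nil a)) =
      A.unitInv (A.action.obj a) := by
  refine (congrArg (fun z => z ≫ _) (A.multApp_single a)).trans ?_
  refine (Category.assoc _ _ _).trans ?_
  exact (congrArg (fun z => _ ≫ z) ((map_eqToHom_trans A.action _ _ rfl).trans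
    (A.action.map_id _))).trans (Category.comp_id _)

/-- The associativity axiom of a pseudoalgebra, for prescribed values of the multiplication. -/
theorem tensorMap_multTwo (U W : Words (Words C)) {a b : Words C} (hU : (Words.mult C).obj U = a)
    (hW : (Words.mult C).obj W = b) :
    A.tensorMap (A.multApp U ≫ A.action.map (eqToHom hU)) (A.multApp W ≫ A.action.map (eqToHom hW)) ≫
        (A.multTwo a b).hom =
      (A.multTwo ((Words.map A.action).obj U) ((Words.map A.action).obj W)).hom ≫
        A.action.map (eqToHom ((Words.IsStrict.map A.action).append U W).symm) ≫
          A.multApp (.append U W) ≫ A.action.map (eqToHom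
            ((Words.IsStrict.mult.append U W).trans (congrArg₂ Words.append hU hW))) := by
  subst hU hW
  have h := congrArg (fun z => z ≫ A.action.map (eqToHom (Words.IsStrict.mult.append U W)))
    (A.tensorMap_multApp U W)
  have e : A.action.map (eqToHom (Words.IsStrict.mult.append U W).symm) ≫
      A.action.map (eqToHom (Words.IsStrict.mult.append U W)) = 𝟙 _ :=
    (map_eqToHom_trans A.action _ _ rfl).trans (A.action.map_id _)
  simp only [Category.assoc] at h
  rw [e, Category.comp_id] at h
  rw [eqToHom_refl, A.action.map_id, Category.comp_id, eqToHom_refl, A.action.map_id,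
    Category.comp_id]
  exact h

/-- The associator of the tensor product given by the action. -/
noncomputable def associatorIso (X Y Z : C) :
    A.tensorObj (A.tensorObj X Y) Z ≅ A.tensorObj X (A.tensorObj Y Z) :=
  -- Writing `a` for the action, the chain is `a[a[X,Y], Z] ≅ a[a[X,Y], a[Z]] ≅ a[X,Y,Z] ≅ a[a[X],
  -- a[Y,Z]] ≅ a[X, a[Y,Z]]`.
  A.tensorMapIso (Iso.refl _) (A.unitApp Z) ≪≫ A.multTwo (.append (.single X) (.single Y)) (.single Z) ≪≫
    A.action.mapIso (eqToIso (Words.append_assoc _ _ _)) ≪≫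
      (A.multTwo (.single X) (.append (.single Y) (.single Z))).symm ≪≫
        A.tensorMapIso (A.unitApp X).symm (Iso.refl _)

/-- The left unitor of the tensor product given by the action. -/
noncomputable def leftUnitorIso (X : C) : A.tensorObj (A.action.obj .nil) X ≅ X :=
  A.tensorMapIso (Iso.refl _) (A.unitApp X) ≪≫ A.multTwo .nil (.single X) ≪≫ (A.unitApp X).symm

/-- The right unitor of the tensor product given by the action. -/
noncomputable def rightUnitorIso (X : C) : A.tensorObj X (A.action.obj .nil) ≅ X :=
  A.tensorMapIso (A.unitApp X) (Iso.refl _) ≪≫ A.multTwo (.single X) .nil ≪≫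
    A.action.mapIso (eqToIso (Words.append_nil _)) ≪≫ (A.unitApp X).symm

theorem associatorIso_hom (X Y Z : C) : (A.associatorIso X Y Z).hom =
    A.tensorMap (𝟙 _) (A.unitHom Z) ≫
      (A.multTwo (.append (.single X) (.single Y)) (.single Z)).hom ≫
        A.action.map (eqToHom (Words.append_assoc _ _ _)) ≫
          (A.multTwo (.single X) (.append (.single Y) (.single Z))).inv ≫
            A.tensorMap (A.unitInv X) (𝟙 _) := rfl

theorem leftUnitorIso_hom (X : C) : (A.leftUnitorIso X).hom =
    A.tensorMap (𝟙 _) (A.unitHom X) ≫ (A.multTwo .nil (.single X)).hom ≫ A.unitInv X := rfl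

theorem rightUnitorIso_hom (X : C) : (A.rightUnitorIso X).hom =
    A.tensorMap (A.unitHom X) (𝟙 _) ≫ (A.multTwo (.single X) .nil).hom ≫
      A.action.map (eqToHom (Words.append_nil _)) ≫ A.unitInv X := rfl

theorem associator_aux {V : Type u} [Category.{v} V] {a b c d e f g h k l : V}
    {t : a ⟶ b} {s : b ⟶ c} {st : a ⟶ c} {μ₁ : c ⟶ d} {m : b ⟶ e} {r : e ⟶ d} {y : d ⟶ f}
    {x : e ⟶ g} {r' : g ⟶ f} {m' : h ≅ g} {t' : h ⟶ k} {s' : k ⟶ l} {st' : h ⟶ l}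
    {μ₂ : l ⟶ f}
    (hs : t ≫ s = st) (hs' : t' ≫ s' = st') (h₁ : s ≫ μ₁ = m ≫ r) (h₂ : st' ≫ μ₂ = m'.hom ≫ r')
    (hr : r ≫ y = x ≫ r') :
    st ≫ μ₁ ≫ y = (t ≫ m ≫ x ≫ m'.inv ≫ t') ≫ s' ≫ μ₂ := by
  subst hs hs'
  simp only [Category.assoc] at h₂ ⊢
  rw [h₂, reassoc_of% h₁, hr, Iso.inv_hom_id_assoc]

theorem associativity_aux {W : Type u'} [Category.{v'} W] {V : Type u''} [Category.{v''} V]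
    (G : W ⥤ V) {a b c d e a' : W} {k : G.obj b ⟶ G.obj c} {k' : G.obj b ⟶ G.obj c}
    {p : a = b} {q : c = d} {r : d = e} {p' : a = a'} {p'' : a' = b} {q' : c = e}
    (h : k = k') :
    (G.map (eqToHom p) ≫ k ≫ G.map (eqToHom q)) ≫ G.map (eqToHom r) =
      G.map (eqToHom p') ≫ G.map (eqToHom p'') ≫ k' ≫ G.map (eqToHom q') := by
  subst h p q r p'; simp

/-- Both routes are compared with the multiplication at the word of words `[a, b, c]`, split once as
`[a, b]`, `[c]` and once as `[a]`, `[b, c]`. `tensorMap_multTwo` evaluates each splitting, and the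
associator joins the two by its definition. -/
theorem associativity (a b c : Words C) :
    A.tensorMap (A.multTwo a b).hom (𝟙 _) ≫ (A.multTwo (.append a b) c).hom ≫
        A.action.map (eqToHom (Words.append_assoc a b c)) =
      (A.associatorIso _ _ _).hom ≫ A.tensorMap (𝟙 _) (A.multTwo b c).hom ≫
        (A.multTwo a (.append b c)).hom := by
  have h₁ := A.tensorMap_multTwo (.append (.single a) (.single b)) (.single c)
    (congrArg (Words.append a) (Words.append_nil b)) (Words.append_nil c)
  have h₂ := A.tensorMap_multTwo (.single a) (.append (.single b) (.single c))
    (Words.append_nil a) (congrArg (Words.append b) (Words.append_nil c))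
  have e₁ := (congrArg₂ (fun x y => A.tensorMap x y ≫ (A.multTwo (.append a b) c).hom)
    (A.multTwo_hom a b) (A.multApp_single_eqToHom c).symm).trans h₁
  have e₂ := (congrArg₂ (fun x y => A.tensorMap x y ≫ (A.multTwo a (.append b c)).hom)
    (A.multApp_single_eqToHom a).symm (A.multTwo_hom b c)).trans h₂
  rw [associatorIso_hom]
  refine associator_aux ?_ ?_ e₁ e₂ ?_
  · rw [tensorMap_comp, Category.id_comp, unitHom_unitInv]
  · rw [tensorMap_comp, Category.comp_id, Category.id_comp]
  · exact associativity_aux A.action rfl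

/-- The splitting of `[a]` into `[]` and `[a]`: `multApp_nil` trivializes the first factor and
`multApp_single` makes the second the inverse unit. -/
theorem left_unitality (a : Words C) :
    A.tensorMap (𝟙 (A.action.obj .nil)) (𝟙 _) ≫ (A.multTwo .nil a).hom =
      (A.leftUnitorIso (A.action.obj a)).hom := by
  have h := A.tensorMap_multTwo .nil (.single a) (a := .nil) rfl (Words.append_nil a)
  have e : A.multApp .nil ≫ A.action.map (eqToHom rfl) = 𝟙 (A.action.obj .nil) :=
    (congrArg₂ (fun x y => x ≫ y) A.multApp_nil (A.action.map_id _)).trans (Category.comp_id _)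
  have h' := ((congrArg₂ (fun x y => A.tensorMap x y ≫ (A.multTwo .nil a).hom) e
    (A.multApp_single_eqToHom a)).symm.trans h).trans (congrArg (fun z => _ ≫ z)
      ((congrArg (fun z => z ≫ _) (A.action.map_id _)).trans ((Category.id_comp _).trans
        (A.multApp_single_eqToHom a))))
  have k : A.tensorMap (𝟙 (A.action.obj .nil)) (A.unitHom (A.action.obj a)) ≫
      A.tensorMap (𝟙 (A.action.obj .nil)) (A.unitInv (A.action.obj a)) =
      A.tensorMap (𝟙 _) (𝟙 (A.action.obj a)) := by
    rw [tensorMap_comp, Category.comp_id, unitHom_unitInv]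
  refine Eq.trans ?_ (congrArg (fun z => A.tensorMap (𝟙 _) (A.unitHom (A.action.obj a)) ≫ z) h')
  exact (congrArg (fun z => z ≫ _) k).symm.trans (Category.assoc _ _ _)

theorem right_unitality_aux {V : Type u} [Category.{v} V] {a b c d e f : V} {s : a ⟶ b} {t : b ⟶ a}
    {μ : a ⟶ c} {x : c ⟶ d} {m : b ⟶ e} {r : e ⟶ c} {y : e ⟶ f} {z : f ⟶ d} {s' : a ⟶ a}
    (hs : s ≫ t = s') (h : t ≫ μ = m ≫ r) (hr : r ≫ x = y ≫ z) :
    s' ≫ μ ≫ x = s ≫ m ≫ y ≫ z := by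
  rw [← hs, Category.assoc, reassoc_of% h, hr]

theorem right_unitality (a : Words C) :
    A.tensorMap (𝟙 _) (𝟙 (A.action.obj .nil)) ≫ (A.multTwo a .nil).hom ≫
        A.action.map (eqToHom (Words.append_nil a)) =
      (A.rightUnitorIso (A.action.obj a)).hom := by
  have h := A.tensorMap_multTwo (.single a) .nil (b := .nil) (Words.append_nil a) rfl
  have e : A.multApp .nil ≫ A.action.map (eqToHom rfl) = 𝟙 (A.action.obj .nil) :=
    (congrArg₂ (fun x y => x ≫ y) A.multApp_nil (A.action.map_id _)).trans (Category.comp_id _)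
  have h' := (congrArg₂ (fun x y => A.tensorMap x y ≫ (A.multTwo a .nil).hom)
    (A.multApp_single_eqToHom a) e).symm.trans h
  have k : A.tensorMap (A.unitHom (A.action.obj a)) (𝟙 (A.action.obj .nil)) ≫
      A.tensorMap (A.unitInv (A.action.obj a)) (𝟙 (A.action.obj .nil)) =
      A.tensorMap (𝟙 (A.action.obj a)) (𝟙 _) := by
    rw [tensorMap_comp, Category.comp_id, unitHom_unitInv]
  rw [rightUnitorIso_hom]
  refine right_unitality_aux k h' ?_
  refine Eq.trans ?_ (congrArg (fun z => _ ≫ z) (A.multApp_single_eqToHom a))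
  exact (Category.assoc _ _ _).trans (congrArg (fun z => _ ≫ z)
    ((Category.assoc _ _ _).trans (congrArg (fun z => _ ≫ z)
      (map_eqToHom_trans A.action _ _ _))))

theorem multTwo_inv_natural {a b c d : Words C} (f : a ⟶ b) (g : c ⟶ d) :
    A.action.map (Words.tens f g) ≫ (A.multTwo b d).inv =
      (A.multTwo a c).inv ≫ A.tensorMap (A.action.map f) (A.action.map g) := by
  rw [Iso.comp_inv_eq, Category.assoc, multTwo_natural, Iso.inv_hom_id_assoc]

theorem associatorIso_naturality {X X' Y Y' Z Z' : C} (f : X ⟶ X') (g : Y ⟶ Y') (h : Z ⟶ Z') :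
    A.tensorMap (A.tensorMap f g) h ≫ (A.associatorIso X' Y' Z').hom =
      (A.associatorIso X Y Z).hom ≫ A.tensorMap f (A.tensorMap g h) := by
  have n₁ : A.tensorMap (A.tensorMap f g) h ≫ A.tensorMap (𝟙 _) (A.unitHom Z') =
      A.tensorMap (𝟙 _) (A.unitHom Z) ≫ A.tensorMap (A.action.map
        (Words.tens (Words.ofHom f) (Words.ofHom g))) (A.action.map (Words.ofHom h)) := by
    rw [tensorMap_comp, tensorMap_comp, unitHom_naturality, Category.id_comp, Category.comp_id]
    rfl
  have n₂ := congrArg A.action.map (Words.tens_assoc (Words.ofHom f) (Words.ofHom g)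
    (Words.ofHom h))
  have n₃ : A.tensorMap (A.action.map (Words.ofHom f)) (A.action.map
      (Words.tens (Words.ofHom g) (Words.ofHom h))) ≫ A.tensorMap (A.unitInv X') (𝟙 _) =
      A.tensorMap (A.unitInv X) (𝟙 _) ≫ A.tensorMap f (A.tensorMap g h) := by
    rw [tensorMap_comp, tensorMap_comp, unitInv_naturality, Category.id_comp, Category.comp_id]
    rfl
  rw [A.action.map_comp, A.action.map_comp] at n₂
  rw [associatorIso_hom, associatorIso_hom, reassoc_of% n₁, reassoc_of% A.multTwo_natural,
    reassoc_of% n₂, reassoc_of% A.multTwo_inv_natural, n₃]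
  simp only [Category.assoc]

theorem leftUnitorIso_naturality {X X' : C} (f : X ⟶ X') :
    A.tensorMap (𝟙 _) f ≫ (A.leftUnitorIso X').hom = (A.leftUnitorIso X).hom ≫ f := by
  have n₁ : A.tensorMap (𝟙 _) f ≫ A.tensorMap (𝟙 (A.action.obj .nil)) (A.unitHom X') =
      A.tensorMap (𝟙 _) (A.unitHom X) ≫ A.tensorMap (A.action.map (𝟙 _))
        (A.action.map (Words.ofHom f)) := by
    rw [tensorMap_comp, tensorMap_comp, unitHom_naturality, Category.id_comp, A.action.map_id,
      Category.comp_id]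
  have n₂ := congrArg A.action.map (Words.nil_tens (Words.ofHom f))
  have n₃ := A.unitInv_naturality f
  rw [leftUnitorIso_hom, leftUnitorIso_hom, reassoc_of% n₁, reassoc_of% A.multTwo_natural]
  simp only [Category.assoc]
  exact congrArg (fun z => _ ≫ _ ≫ z) ((congrArg (fun z => z ≫ _) n₂).trans n₃)

theorem rightUnitorIso_naturality {X X' : C} (f : X ⟶ X') :
    A.tensorMap f (𝟙 _) ≫ (A.rightUnitorIso X').hom = (A.rightUnitorIso X).hom ≫ f := by
  have n₁ : A.tensorMap f (𝟙 _) ≫ A.tensorMap (A.unitHom X') (𝟙 (A.action.obj .nil)) =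
      A.tensorMap (A.unitHom X) (𝟙 _) ≫ A.tensorMap (A.action.map (Words.ofHom f))
        (A.action.map (𝟙 _)) := by
    rw [tensorMap_comp, tensorMap_comp, unitHom_naturality, Category.id_comp, A.action.map_id,
      Category.comp_id]
  have n₂ := congrArg A.action.map (Words.tens_nil (Words.ofHom f))
  rw [A.action.map_comp, A.action.map_comp] at n₂
  rw [rightUnitorIso_hom, rightUnitorIso_hom, reassoc_of% n₁, reassoc_of% A.multTwo_natural,
    reassoc_of% n₂, unitInv_naturality]
  simp only [Category.assoc]

/-- The tensor product given by the action. -/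
noncomputable abbrev monoidalCategoryStruct : MonoidalCategoryStruct C where
  tensorObj := A.tensorObj
  tensorUnit := A.action.obj .nil
  tensorHom := A.tensorMap
  whiskerLeft X _ _ f := A.tensorMap (𝟙 X) f
  whiskerRight f Y := A.tensorMap f (𝟙 Y)
  associator := A.associatorIso
  leftUnitor := A.leftUnitorIso
  rightUnitor := A.rightUnitorIso

/-- The frame given by the action. -/
noncomputable def frame : @WordFrame C _ A.monoidalCategoryStruct A.action :=
  letI := A.monoidalCategoryStruct
  { single := A.unitApp
    μ := A.multTwo
    ε := Iso.refl _
    distortion := fun X Y => A.action.map (Words.sigma (.single X) (.single Y))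
    unitDistortion := fun X =>
      -- `Λ` acts on the value at `[X]`, which is only isomorphic to `X`, hence the conjugation by
      -- the unit.
      A.unitHom X ≫ A.action.map (Words.lam (.single X)) ≫ A.unitInv X
    id_tensor_id := A.tensorMap_id
    tensor_comp := A.tensorMap_comp
    id_tensor := fun _ _ _ _ => rfl
    tensor_id := fun _ _ => rfl
    associator_naturality := A.associatorIso_naturality
    leftUnitor_naturality := A.leftUnitorIso_naturality
    rightUnitor_naturality := A.rightUnitorIso_naturality
    distortion_naturality := fun f g => by
      change A.action.map _ ≫ A.action.map _ = A.action.map _ ≫ A.action.map _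
      rw [← A.action.map_comp, ← A.action.map_comp, Words.tens_naturality_sigma]
    unitDistortion_naturality := fun f => by
      have h := congrArg A.action.map (Words.lam_naturality (Words.ofHom f))
      rw [A.action.map_comp, A.action.map_comp] at h
      rw [← reassoc_of% A.unitHom_naturality, reassoc_of% h, A.unitInv_naturality]
      simp only [Category.assoc]
    μ_natural := A.multTwo_natural
    associativity := A.associativity
    left_unitality := A.left_unitality
    right_unitality := A.right_unitality
    map_sigma := A.multTwo_sigma
    map_lam := A.map_lam }

end PseudoAlgebra

end Distorted

/-! ### Comparison of models, and the biequivalence -/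

namespace Distorted

open MonoidalCategory

/-- The distorted monoidal category of a pseudoalgebra. -/
noncomputable def PseudoAlgebra.distMon {C : Cat.{v, u}} (A : PseudoAlgebra Tσ.{v, u} C) :
    DistMon.{v, u} :=
  letI := A.monoidalCategoryStruct
  A.frame.distMon

/-- A pseudoalgebra is a model of its distorted monoidal category. -/
noncomputable def PseudoAlgebra.toModel {C : Cat.{v, u}} (A : PseudoAlgebra Tσ.{v, u} C) :
    Model A.distMon A :=
  letI := A.monoidalCategoryStruct
  { lax := A.frame.wordLax
    isStrong := A.frame.isStrong_wordLax
    mult :=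
      { unit := by
          refine (congrArg (fun z => _ ≫ z) A.multApp_nil).trans ?_
          exact Category.comp_id _
        -- With tensor products given by the action, multiplicativity of the multiplication is the
        -- associativity axiom at `[U, W]`.
        tensor := fun U W => (Category.assoc _ _ _).trans (A.tensorMap_multApp U W).symm } }

/-- The statement makes sense because `𝟭 ⋙ 𝟭` is definitionally `𝟭`; it lets strict functoriality of
`toLax` compute round trips between two models. -/
theorem SigmaLax.id_comp_id (M : DistMon.{v, u}) :
    ((SigmaLax.id M).comp (SigmaLax.id M) : SigmaLax M M (𝟭 M.carrier)) = SigmaLax.id M :=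
  SigmaLax.ext (Functor.LaxMonoidal.ext (Category.id_comp _)
    (funext fun _ => funext fun _ => Category.id_comp _))

/-- Any two pseudoalgebras with models over the same distorted monoidal category are equivalent. -/
noncomputable def Model.equivalence {M : DistMon.{v, u}} {A B : PseudoAlgebra Tσ.{v, u} M.carrier}
    (m : Model M A) (n : Model M B) :
    Bicategory.Equivalence (PsAlg.mk M.carrier A) (PsAlg.mk M.carrier B) :=
  -- The round trip is `toLax` of a composite of identities, hence equal, and not merely isomorphic,
  -- to the identity morphism. With the roles exchanged, the same statement gives the other triangle
  -- of the equivalence data.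
  have key : ∀ {A B : PseudoAlgebra Tσ.{v, u} M.carrier} (m : Model M A) (n : Model M B),
      (toLax m n (.id M)).comp (toLax n m (.id M)) = LaxMorphism.id A := fun m n =>
    (toLax_comp m n m (.id M) (.id M)).symm.trans
      ((congrArg (toLax m m) (SigmaLax.id_comp_id M)).trans (toLax_id m))
  .mkOfAdjointifyCounit
    (f := PsAlg.Hom.mk (A := ⟨M.carrier, A⟩) (B := ⟨M.carrier, B⟩) (𝟭 M.carrier) (toLax m n (.id M)))
    (g := PsAlg.Hom.mk (A := ⟨M.carrier, B⟩) (B := ⟨M.carrier, A⟩) (𝟭 M.carrier) (toLax n m (.id M)))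
    (PsAlg.isoOfEq (A := ⟨M.carrier, A⟩) (B := ⟨M.carrier, A⟩) (key m n).symm)
    (PsAlg.isoOfEq (A := ⟨M.carrier, B⟩) (B := ⟨M.carrier, B⟩) (key n m))

/-- The 2-functor from distorted monoidal categories to pseudoalgebras. -/
noncomputable def correspondence : Correspondence Tσ.{v, u} where
  obj M := M.pseudoAlgebra
  map {M N _} φ := Model.toLax M.model N.model φ
  map₂ {M N _ _ _ _ _} h := Model.isTransformation_of_isMonoidal M.model N.model h
  map_id M := Model.toLax_id M.model
  map_comp {M N P _ _} φ ψ := Model.toLax_comp M.model N.model P.model φ ψ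

/-- A pseudoalgebra and the one rebuilt from its distorted monoidal category are two models of that
category, hence equivalent. On hom-categories fullness is the converse direction for
transformations, and every lax morphism is already equal to an image on the same underlying functor.
-/
theorem isBiequivalence_correspondence :
    IsBiequivalence correspondence.{v, u}.toPseudofunctor := by
  refine ⟨fun A => ⟨A.str.distMon, ⟨A.str.distMon.model.equivalence A.str.toModel⟩⟩, fun M N => ?_⟩
  have : (correspondence.{v, u}.toPseudofunctor.mapFunctor M N).Faithful :=
    ⟨fun h => DistMon.Hom₂.ext (congrArg PsAlg.Hom₂.natTrans h)⟩
  have : (correspondence.{v, u}.toPseudofunctor.mapFunctor M N).Full :=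
    ⟨fun θ => ⟨⟨θ.natTrans, Model.isMonoidal_of_isTransformation M.model N.model
      θ.isTransformation⟩, rfl⟩⟩
  have : (correspondence.{v, u}.toPseudofunctor.mapFunctor M N).EssSurj :=
    ⟨fun f => ⟨⟨f.functor, (M.model.transport N.model f.lax).sigmaLax⟩,
      ⟨PsAlg.isoOfEq (A := ⟨_, M.pseudoAlgebra⟩) (B := ⟨_, N.pseudoAlgebra⟩)
        (M.model.toLax_sigmaLax N.model f.lax)⟩⟩⟩
  exact { }

end Distorted

theorem mainTheorem3 :
    ∃ Φ : Distorted.Correspondence Distorted.Tσ.{v, u},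
      Distorted.IsBiequivalence Φ.toPseudofunctor ∧
      (∀ (M N : Distorted.DistMon.{v, u}) (F : M.carrier ⥤ N.carrier),
        Function.Bijective (fun φ : Distorted.SigmaLax M N F => Φ.map φ)) ∧
      (∀ (M N : Distorted.DistMon.{v, u}) (F G : M.carrier ⥤ N.carrier)
        (φ : Distorted.SigmaLax M N F) (ψ : Distorted.SigmaLax M N G) (θ : F ⟶ G),
        Distorted.IsMonoidal φ ψ θ ↔ Distorted.IsTransformation (Φ.map φ) (Φ.map ψ) θ) ∧
      ∃ I : ∀ M : Distorted.DistMon.{v, u}, Distorted.Interpretation M (Φ.obj M),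
        ∀ (M N : Distorted.DistMon.{v, u}) (F : M.carrier ⥤ N.carrier)
          (φ : Distorted.SigmaLax M N F),
          Distorted.Interprets (I M) (I N) φ (Φ.map φ) :=
  ⟨Distorted.correspondence, Distorted.isBiequivalence_correspondence,
    fun M N _ => Distorted.Model.toLax_bijective M.model N.model,
    fun M N _ _ _ _ _ => ⟨Distorted.Model.isTransformation_of_isMonoidal M.model N.model,
      Distorted.Model.isMonoidal_of_isTransformation M.model N.model⟩,
    fun M => M.model.interpretation,
    fun M N _ φ => M.model.interprets N.model φ⟩
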